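/- Throughout, $M$ and $N$ are Hausdorff second countable $C^\infty$-manifolds of dimensions $n\ge 1$ and $n+1$, and $g$ is a Riemannian metric on $N$. A smooth map $f:M\to N$ is a *front* if near every point it has a smooth unit normal field $\nu$ (that is, $g(\nu,df(w))=0$ for all $w$) such that $(f,\nu)$ is an immersion; $S(f)$ is the set of points where $f$ is not an immersion. For $1\le k\le n$ the *$A_{k+1}$-singularity* is the right-left class of the germ at the origin of $$(t,x_2,\dots,x_n)\mapsto\Bigl((k+1)t^{k+2}+\sum_{j=2}^k(j-1)t^jx_j,\ -(k+2)t^{k+1}-\sum_{j=2}^kjt^{j-1}x_j,\ x_2,\dots,x_n\Bigr),$$ which parametrizes the discriminant set $\{F=F_t=0\}$ of $F(t,u)=t^{k+2}+u_kt^k+\dots+u_1t+u_0$. An *A-front* is a front all of whose singular points are $A_{k+1}$-singularities with $1\le k\le n$. At a regular point near a singular point, a unit normal vector of $f$ is *inward* if it points to the side on which $F(\cdot,u)$ has more real roots (counted near the parameter $t$ of the point). Let $f$ be an A-front, $o\notin S(f)$, $\nu_0$ a unit normal vector of $f$ at $o$, and $\gamma:[0,1]\to M$ a loop at $o$ that is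 *co-orientable*, i.e. there is a continuous unit normal field $\nu(t)$ of $f$ along $\gamma$ with $\nu(0)=\nu(1)$. Choose disjoint connected open sets $O_\alpha$ containing the connected components $\Gamma_\alpha$ of $S(f)$, such that the inward unit normal field extends continuously to $\bigcup_\alpha O_\alpha\setminus S(f)$. Choose $0=t_0^+<t_1^-<t_1^+<\dots<t_m^-<t_m^+<t_{m+1}^-=1$ such that the open intervals $I_j=(t_j^-,t_j^+)$, $1\le j\le m$, cover $\gamma^{-1}(S(f))$ and $\gamma$ maps each $[t_j^-,t_j^+]$ into some $O_\alpha$. For $0\le j\le m$ let $\hat\nu_j$ be the continuous unit normal field along $\gamma|_{[t_j^+,t_{j+1}^-]}$ that starts at the inward vector (at $\nu_0$ if $j=0$). Put $\varepsilon_0=+1$, and $\varepsilon_{j+1}=\varepsilon_j$ or $-\varepsilon_j$ according to whether $\hat\nu_j(t_{j+1}^-)$ or $-\hat\nu_j(t_{j+1}^-)$ is inward (is $\nu_0$ if $j=m$). From $\varepsilon_0,\dots,\varepsilon_{m+1}$ omit the $\varepsilon_j$, $1\le j\le m$, for those $I_j$ on which $\gamma$ does not change sides of $S(f)$, that is, on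 which the continuous unit normal field along $\gamma$ that is inward at $t_j^-$ is inward at $t_j^+$. Cancel pairs of successive equal signs until none are left. The number of minus signs that remain is the *zig-zag number* $z(\gamma)=z_{f,\nu_0}(\gamma)$. **Proposition.** 1. For every A-front $f$, every $o\notin S(f)$, every $\nu_0$ and every co-orientable loop $\gamma$ at $o$, such choices exist and $z(\gamma)$ does not depend on them. If $\varepsilon_{m+1}=+1$ for some choice, then $z(\gamma)$ does not change when $\nu_0$ is replaced by $-\nu_0$. If $\gamma'$ is a loop at $o$ that is homotopic to $\gamma$ relative to the end points, then $\gamma'$ is co-orientable and $z(\gamma')=z(\gamma)$. 2. Let $f_s:M\to N$, $s\in[0,1]$, be a deformation of A-fronts: every $f_s$ is an A-front, $f_s(p)$ is smooth in $(s,p)$, and near every $(s,p)$ there is a unit normal vector of $f_s$ at $p$ that is smooth in $(s,p)$. Let $\gamma$ be a loop at $o\in M$, and let $\nu_0^s$ be a unit normal vector of $f_s$ at $o$ that is continuous in $s\in[0,1]$. If $\gamma$ is co-orientable for $f_s$, then it is co-orientable for $f_{s'}$, for all $s,s'\in[0,1]$. If moreover $o$ is a regular point of $f_s$ and $f_{s'}$,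 and either $o$ is a regular point of $f_r$ for all $r\in[0,1]$ or $\varepsilon_{m+1}=+1$ for some choice for $(f_s,\nu_0^s,\gamma)$, then $z_{f_{s'},\nu_0^{s'}}(\gamma)=z_{f_s,\nu_0^s}(\gamma)$. -/

import Mathlib

open Set Filter Topology Manifold ContDiff

noncomputable section

/-! ### The normal forms of front singularities -/

/-- The polynomial `F(t,u) = t^(k+2) + u_k t^k + ⋯ + u_1 t + u_0`. -/
def versal {n : ℕ} (k : ℕ) (u : EuclideanSpace ℝ (Fin (n + 1))) (t : ℝ) : ℝ :=
  t ^ (k + 2) + ∑ j : Fin (n + 1), if (j : ℕ) ≤ k then u j * t ^ (j : ℕ) else 0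

/-- The normal form of the `A_{k+1}`-front singularity,
`(t, x₂, …, xₙ) ↦ ((k+1) t^(k+2) + ∑_{j=2}^k (j-1) t^j x_j,
  -(k+2) t^(k+1) - ∑_{j=2}^k j t^(j-1) x_j, x₂, …, xₙ)`.
The coordinate `x_j` is `X i` with `i = j - 1`, and `t = X 0`. -/
def normalForm (n k : ℕ) [NeZero n] (X : EuclideanSpace ℝ (Fin n)) :
    EuclideanSpace ℝ (Fin (n + 1)) :=
  WithLp.toLp 2 (Fin.cases
    (((k : ℝ) + 1) * X 0 ^ (k + 2)
      + ∑ i : Fin n, if 1 ≤ (i : ℕ) ∧ (i : ℕ) + 1 ≤ k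
          then (i : ℝ) * X 0 ^ ((i : ℕ) + 1) * X i else 0)
    (fun j : Fin n =>
      if j = 0 then
        -(((k : ℝ) + 2) * X 0 ^ (k + 1))
          - ∑ i : Fin n, if 1 ≤ (i : ℕ) ∧ (i : ℕ) + 1 ≤ k
              then ((i : ℝ) + 1) * X 0 ^ (i : ℕ) * X i else 0
      else X j))

section Fronts

variable {n : ℕ} [NeZero n]
  {M : Type*} [TopologicalSpace M] [ChartedSpace (EuclideanSpace ℝ (Fin n)) M]
  {N : Type*} [TopologicalSpace N] [ChartedSpace (EuclideanSpace ℝ (Fin (n + 1))) N]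

/-- The points at which `f` is not an immersion. -/
def singularSet (n : ℕ) {M : Type*} [TopologicalSpace M]
    [ChartedSpace (EuclideanSpace ℝ (Fin n)) M] {N : Type*} [TopologicalSpace N]
    [ChartedSpace (EuclideanSpace ℝ (Fin (n + 1))) N] (f : M → N) : Set M :=
  {p | ¬ Function.Injective (mfderiv (𝓡 n) (𝓡 (n + 1)) f p)}

/-- The charts `φ` of `M` around `p` and `ψ` of `N` around `f p` exhibit `f` at `p` as
right-left equivalent to the `A_{k+1}`-front singularity. -/
structure IsNormalFormChart (k : ℕ) (f : M → N) (p : M)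
    (φ : OpenPartialHomeomorph M (EuclideanSpace ℝ (Fin n)))
    (ψ : OpenPartialHomeomorph N (EuclideanSpace ℝ (Fin (n + 1)))) : Prop where
  source_mem_atlas : φ ∈ IsManifold.maximalAtlas (𝓡 n) ∞ M
  target_mem_atlas : ψ ∈ IsManifold.maximalAtlas (𝓡 (n + 1)) ∞ N
  mem_source : p ∈ φ.source
  centered : φ p = 0
  mapsTo : MapsTo f φ.source ψ.source
  eq_normalForm : ∀ x ∈ φ.source, ψ (f x) = normalForm n k (φ x)

variable [IsManifold (𝓡 (n + 1)) ∞ N]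

/-- Smooth Riemannian metrics on `N`. -/
abbrev SmoothMetric (n : ℕ) (N : Type*) [TopologicalSpace N]
    [ChartedSpace (EuclideanSpace ℝ (Fin (n + 1))) N] [IsManifold (𝓡 (n + 1)) ∞ N] : Type _ :=
  Bundle.ContMDiffRiemannianMetric (𝓡 (n + 1)) ∞ (EuclideanSpace ℝ (Fin (n + 1)))
    (fun x : N => TangentSpace (𝓡 (n + 1)) x)

variable (g : SmoothMetric n N)

/-- `v` is a unit vector at `f q` orthogonal to the image of `df_q`. -/
def IsUnitOrthogonal (f : M → N) (q : M) (v : TangentSpace (𝓡 (n + 1)) (f q)) : Prop :=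
  g.inner (f q) v v = 1 ∧
    ∀ w : TangentSpace (𝓡 n) q, g.inner (f q) v (mfderiv (𝓡 n) (𝓡 (n + 1)) f q w) = 0

/-- The map `q ↦ (f q, ν q)` into the tangent bundle given by a vector field `ν` along `f`. -/
def fieldLift (f : M → N) (ν : ∀ q : M, TangentSpace (𝓡 (n + 1)) (f q)) (q : M) :
    TangentBundle (𝓡 (n + 1)) N :=
  ⟨f q, ν q⟩

/-- `ν` is a continuous unit normal vector field of `f` on `U`. -/
def IsUnitNormalField (f : M → N) (U : Set M)
    (ν : ∀ q : M, TangentSpace (𝓡 (n + 1)) (f q)) : Prop :=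
  ContinuousOn (fieldLift f ν) U ∧ ∀ q ∈ U, IsUnitOrthogonal g f q (ν q)

/-- `f` is a (wave) front: it is smooth, and near every point it has a smooth unit normal vector
field `ν` such that the Legendrian lift `(f, ν)` is an immersion. -/
def IsFront (f : M → N) : Prop :=
  ContMDiff (𝓡 n) (𝓡 (n + 1)) ∞ f ∧
    ∀ p : M, ∃ U : Set M, IsOpen U ∧ p ∈ U ∧
      ∃ ν : ∀ q : M, TangentSpace (𝓡 (n + 1)) (f q),
        ContMDiffOn (𝓡 n) (𝓡 (n + 1)).tangent ∞ (fieldLift f ν) U ∧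
        (∀ q ∈ U, IsUnitOrthogonal g f q (ν q)) ∧
        ∀ q ∈ U, Function.Injective (mfderiv (𝓡 n) (𝓡 (n + 1)).tangent (fieldLift f ν) q)

/-- `f` is an A-front: a front all of whose singular points are `A_{k+1}`-front singularities
with `1 ≤ k ≤ n`. -/
def IsAFront (f : M → N) : Prop :=
  IsFront g f ∧ ∀ p ∈ singularSet n f, ∃ k : ℕ, 1 ≤ k ∧ k ≤ n ∧
    ∃ (φ : OpenPartialHomeomorph M (EuclideanSpace ℝ (Fin n)))
      (ψ : OpenPartialHomeomorph N (EuclideanSpace ℝ (Fin (n + 1)))),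
      IsNormalFormChart k f p φ ψ

/-- `v` is a unit normal vector of the front `f` at `p` (which may be singular): a value at `p` of
a continuous unit normal vector field of `f` near `p`. -/
def IsUnitNormalAt (f : M → N) (p : M) (v : TangentBundle (𝓡 (n + 1)) N) : Prop :=
  ∃ U ∈ 𝓝 p, ∃ ν, IsUnitNormalField g f U ν ∧ v = fieldLift f ν p

/-- The opposite tangent vector at the same base point. -/
def oppositeVector (v : TangentBundle (𝓡 (n + 1)) N) : TangentBundle (𝓡 (n + 1)) N :=
  ⟨v.proj, -v.snd⟩

/-- `μ` is a continuous unit normal vector field of `f` along the restriction of `γ` to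
`[a, b]`. -/
def IsUnitNormalAlong (f : M → N) {o : M} (γ : Path o o) (a b : ℝ)
    (μ : ℝ → TangentBundle (𝓡 (n + 1)) N) : Prop :=
  ContinuousOn μ (Icc a b) ∧ ∀ t ∈ Icc a b, IsUnitNormalAt g f (γ.extend t) (μ t)

/-- A loop is co-orientable if there is a continuous unit normal vector field along it with the
same value at both ends. -/
def IsCoorientable (f : M → N) {o : M} (γ : Path o o) : Prop :=
  ∃ μ, IsUnitNormalAlong g f γ 0 1 μ ∧ μ 0 = μ 1

/-! ### The inward direction -/

/-- The vector `v` at the regular point `q`, lying in the domain of normal form charts `φ`, `ψ`,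
is inward: in the direction of `v` the number of real roots of `F(t) = 0` increases. The roots are
counted near the parameter `t = φ(q)₀` of `q`, so that at a self-intersection of the image only
the sheet through `q` counts. -/
def IsInward (k : ℕ) (φ : OpenPartialHomeomorph M (EuclideanSpace ℝ (Fin n)))
    (ψ : OpenPartialHomeomorph N (EuclideanSpace ℝ (Fin (n + 1))))
    (q : M) (v : TangentBundle (𝓡 (n + 1)) N) : Prop :=
  let u : EuclideanSpace ℝ (Fin (n + 1)) := ψ v.proj
  let w : EuclideanSpace ℝ (Fin (n + 1)) :=
    mfderiv (𝓡 (n + 1)) (𝓡 (n + 1)) ψ v.proj v.snd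
  ∀ᶠ δ in 𝓝[>] (0 : ℝ), ∀ᶠ s in 𝓝[>] (0 : ℝ),
    {t : ℝ | |t - φ q 0| < δ ∧ versal k (u - s • w) t = 0}.ncard <
      {t : ℝ | |t - φ q 0| < δ ∧ versal k (u + s • w) t = 0}.ncard

/-- A disjoint family of open domains `O_α ⊇ Γ_α`, indexed by the connected components `Γ_α` of
the singular set, on which (outside of the singular set) the inward unit normal vector field is
defined: a continuous unit normal vector field that near each singular point is inward. -/
structure InwardSystem (f : M → N) where
  /-- The domains. -/
  O : ConnectedComponents (singularSet n f) → Set M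
  isOpen : ∀ α, IsOpen (O α)
  isConnected : ∀ α, IsConnected (O α)
  disjoint : ∀ α β, α ≠ β → Disjoint (O α) (O β)
  mem : ∀ p : singularSet n f, (p : M) ∈ O (ConnectedComponents.mk p)
  /-- The inward unit normal vector field. -/
  field : ∀ q : M, TangentSpace (𝓡 (n + 1)) (f q)
  isUnitNormalField : IsUnitNormalField g f ((⋃ α, O α) \ singularSet n f) field
  inward : ∀ p ∈ singularSet n f, ∃ k : ℕ, 1 ≤ k ∧ k ≤ n ∧
    ∃ (φ : OpenPartialHomeomorph M (EuclideanSpace ℝ (Fin n)))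
      (ψ : OpenPartialHomeomorph N (EuclideanSpace ℝ (Fin (n + 1)))),
      IsNormalFormChart k f p φ ψ ∧
      ∀ᶠ q in 𝓝 p, q ∉ singularSet n f → IsInward k φ ψ q (fieldLift f field q)

/-! ### Zig-zag numbers -/

/-- A subdivision `0 = b 0 < a 1 < b 1 < a 2 < ⋯ < a m < b m < a (m+1) = 1` such that the
intervals `I_j = (a j, b j)`, `1 ≤ j ≤ m`, cover the parameters at which the loop `γ` is in the
singular set and `γ` maps each of them into some `O_α`, together with the signs
`ε 0, …, ε (m+1)` that it produces. -/
structure SignedSubdivision (f : M → N) {o : M} (ν₀ : TangentBundle (𝓡 (n + 1)) N)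
    (γ : Path o o) where
  /-- The domains and the inward direction. -/
  system : InwardSystem g f
  m : ℕ
  a : ℕ → ℝ
  b : ℕ → ℝ
  b_zero : b 0 = 0
  a_last : a (m + 1) = 1
  b_lt_a : ∀ j ≤ m, b j < a (j + 1)
  a_lt_b : ∀ j, 1 ≤ j → j ≤ m → a j < b j
  cover : ∀ t ∈ Icc (0 : ℝ) 1, γ.extend t ∈ singularSet n f →
    ∃ j, 1 ≤ j ∧ j ≤ m ∧ t ∈ Ioo (a j) (b j)
  mapsTo : ∀ j, 1 ≤ j → j ≤ m → ∃ α, ∀ t ∈ Icc (a j) (b j), γ.extend t ∈ system.O α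
  /-- The unit normal vector fields along `γ` on the intervals `[b j, a (j+1)]`. -/
  normal : ℕ → ℝ → TangentBundle (𝓡 (n + 1)) N
  isUnitNormalAlong : ∀ j ≤ m, IsUnitNormalAlong g f γ (b j) (a (j + 1)) (normal j)
  normal_zero : normal 0 (b 0) = ν₀
  normal_start : ∀ j, 1 ≤ j → j ≤ m →
    normal j (b j) = fieldLift f system.field (γ.extend (b j))
  /-- The signs. -/
  ε : ℕ → ℤˣ
  ε_zero : ε 0 = 1
  ε_step : ∀ j < m,
    (normal j (a (j + 1)) = fieldLift f system.field (γ.extend (a (j + 1))) ∧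
      ε (j + 1) = ε j) ∨
    (oppositeVector (normal j (a (j + 1))) =
        fieldLift f system.field (γ.extend (a (j + 1))) ∧
      ε (j + 1) = -ε j)
  ε_last :
    (normal m (a (m + 1)) = ν₀ ∧ ε (m + 1) = ε m) ∨
    (oppositeVector (normal m (a (m + 1))) = ν₀ ∧ ε (m + 1) = -ε m)

/-- On the interval `I_j` the loop passes from one side of the singular set to the other side:
the unit normal vector field along `γ` that is inward at the beginning of `I_j` is outward at its
end. -/
def SignedSubdivision.Crosses {g : SmoothMetric n N} {f : M → N} {o : M}
    {ν₀ : TangentBundle (𝓡 (n + 1)) N} {γ : Path o o} (D : SignedSubdivision g f ν₀ γ)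
    (j : ℕ) : Prop :=
  ∃ μ, IsUnitNormalAlong g f γ (D.a j) (D.b j) μ ∧
    μ (D.a j) = fieldLift f D.system.field (γ.extend (D.a j)) ∧
    oppositeVector (μ (D.b j)) = fieldLift f D.system.field (γ.extend (D.b j))

open Classical in
/-- The sequence of signs `ε 0`, then `ε j` for those `j = 1, …, m` for which the loop crosses
the singular set on `I_j`, then `ε (m+1)`. -/
def SignedSubdivision.signs {g : SmoothMetric n N} {f : M → N} {o : M}
    {ν₀ : TangentBundle (𝓡 (n + 1)) N} {γ : Path o o} (D : SignedSubdivision g f ν₀ γ) :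
    List ℤˣ :=
  [D.ε 0] ++ ((List.range' 1 D.m).filter (fun j => decide (D.Crosses j))).map D.ε
    ++ [D.ε (D.m + 1)]

/-- Normalization of a sequence of signs: successive equal signs are cancelled in pairs until
none are left. -/
def normalizeSigns : List ℤˣ → List ℤˣ
  | [] => []
  | x :: l => if (normalizeSigns l).head? = some x then (normalizeSigns l).tail
      else x :: normalizeSigns l

/-- The number of minus signs after normalization. -/
def minusCount (l : List ℤˣ) : ℕ := (normalizeSigns l).count (-1)

open Classical in
/-- The zig-zag number of the co-orientable loop `γ`, for the unit normal vector `ν₀` at its base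
point, computed from any sequence of signs. -/
def zigzagNumber (f : M → N) {o : M} (ν₀ : TangentBundle (𝓡 (n + 1)) N) (γ : Path o o) : ℕ :=
  if h : Nonempty (SignedSubdivision g f ν₀ γ) then minusCount h.some.signs else 0

/-! ### Deformations -/

/-- `F s`, `s ∈ [0, 1]`, is a deformation through A-fronts: a smooth family of A-fronts whose
Legendrian lifts (unit normal vectors up to sign) form a smooth family too. -/
structure IsAFrontDeformation (F : ℝ → M → N) : Prop where
  contMDiffOn : ContMDiffOn (𝓘(ℝ, ℝ).prod (𝓡 n)) (𝓡 (n + 1)) ∞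
    (fun x : ℝ × M => F x.1 x.2) (Icc 0 1 ×ˢ univ)
  normal : ∀ s ∈ Icc (0 : ℝ) 1, ∀ p : M, ∃ U ∈ 𝓝 (s, p),
    ∃ ν : ∀ (r : ℝ) (q : M), TangentSpace (𝓡 (n + 1)) (F r q),
      ContMDiffOn (𝓘(ℝ, ℝ).prod (𝓡 n)) (𝓡 (n + 1)).tangent ∞
        (fun x : ℝ × M => fieldLift (F x.1) (ν x.1) x.2) (U ∩ Icc 0 1 ×ˢ univ) ∧
      ∀ x ∈ U ∩ Icc 0 1 ×ˢ univ, IsUnitOrthogonal g (F x.1) x.2 (ν x.1 x.2)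
  isAFront : ∀ s ∈ Icc (0 : ℝ) 1, IsAFront g (F s)

end Fronts

end

/-! Fix a continuous unit normal field `μ` along the loop. Near the singular set the regular
parameters fall into two sides, according to whether `μ` is inward or outward there. Let `H` be a
continuous real function of the parameter that is integral exactly at the singular parameters and,
near each of them, larger exactly on the inward side (`CountsCrossings`). Across an interval `I_j`
the integer `⌊H⌋` changes by `±1` if the loop changes sides, and otherwise not at all. The word of
signs carries the same information: its alternating sum is `d = ⌊H 1⌋ - ⌊H 0⌋`, and its last sign is
`+1` if and only if `d` is even (`alternatingSum_signs`, `SignedSubdivision.minusCount_signs`).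
Cancelling two equal neighbours does not change the alternating sum, and a word without equal
neighbours is determined by it. Hence the zig-zag number is `|d / 2|`, with division rounding down
(`minusCount_eq`), whatever choices were made. Replacing `ν₀` by its opposite exchanges the sides,
hence replaces `d` by `-d`, which does not affect `|d / 2|` when `d` is even.

For the invariance, a homotopy of loops and a deformation of fronts are both treated as a map `c`
from the plane of pairs `(r, t)` to `[0,1] × M`, with the same curve on the edges `t = 0` and `t =
1`. Unit normal vectors form a double covering, so there is a continuous unit normal `G` over the
plane (`IsAFrontDeformation.exists_lift`). Because the plane is simply connected, a counting
function `H` exists on all of it: it is the lift of a map to `ℝ/ℤ` (`exists_countsCrossings`). On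
the two edges the singular points and the sides coincide, so the restrictions of `⌊H⌋` differ by a
constant (`CountsCrossings.floor_sub_floor`). This constant is `d` for every `r` at which the base
point is regular; no condition on the values of `r` in between is needed for this.

The geometric input is that the sides fit together in a family, even where the type `A_{k+1}`
changes with the parameter. Let `η` be the conormal covector in charts, `k` a vector spanning the
kernel of the differential at a singular point, and write `df k = β e` nearby. The form `dη(k)(e)`
does not vanish, and the sign of `β dη(k)(e)` decides whether the normal is inward
(`eventually_isInward_iff`). This expression makes sense in any charts and is continuous in the
family parameter. That its sign does not depend on the charts follows from the symmetry of the
second fundamental form (`IsSheetAt.dConormal_dMap_comm`, `eventually_sideFunction_mul_pos`). The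
local inward fields therefore agree near the singular set and glue (`exists_glue_germs`). -/

noncomputable section

/-! ### Gluing germs along a closed set -/

/-- Germs of functions along a closed subset of a paracompact space that are compatible come from
a single function. -/
theorem exists_glue_germs {X : Type*} [TopologicalSpace X] [ParacompactSpace X] [NormalSpace X]
    {Y : X → Type*} [∀ x, Nonempty (Y x)] {A : Set X} (hA : IsClosed A) (s : X → ∀ x, Y x)
    (U : X → Set X) (hU : ∀ a ∈ A, IsOpen (U a)) (haU : ∀ a ∈ A, a ∈ U a)
    (cons : ∀ a ∈ A, ∀ b ∈ A, b ∈ U a → ∀ᶠ y in 𝓝 b, y ∉ A → s a y = s b y) :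
    ∃ q : ∀ x, Y x, ∀ a ∈ A, ∀ᶠ y in 𝓝 a, y ∉ A → q y = s a y := by
  classical
  -- Any choice of index will do: by local finiteness, only the finitely many `w i` with `a ∈
  -- closure (w i)` matter near `a`. Passing from `v` to `w` puts these closures inside `U i`, where
  -- `cons` compares the germs.
  obtain ⟨v, hvo, hAv, hvf, hvU⟩ := precise_refinement_set hA (fun a : A => U a)
    (fun a => hU a a.2) (fun a ha => mem_iUnion.2 ⟨⟨a, ha⟩, haU a ha⟩)
  obtain ⟨w, hAw, hwo, hwv⟩ := exists_subset_iUnion_closure_subset hA hvo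
    (fun x _ => hvf.point_finite x) hAv
  have hwf : LocallyFinite (fun i => closure (w i)) := hvf.subset hwv
  let q : ∀ x, Y x := fun x =>
    if h : ∃ i, x ∈ w i then s (h.choose : A) x else Classical.arbitrary _
  refine ⟨q, fun a ha => ?_⟩
  obtain ⟨i₀, hi₀⟩ := mem_iUnion.1 (hAw ha)
  have h1 : ∀ᶠ y in 𝓝 a, y ∈ w i₀ := (hwo i₀).mem_nhds hi₀
  have h2 : ∀ᶠ y in 𝓝 a, ∀ i, y ∈ closure (w i) → a ∈ closure (w i) := by
    have := hwf.iInter_compl_mem_nhds (fun i => isClosed_closure) a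
    filter_upwards [this] with y hy i hi
    by_contra hai
    exact (mem_iInter₂.1 hy i hai) hi
  have h3 : ∀ᶠ y in 𝓝 a, ∀ i ∈ {i | a ∈ closure (w i)}, y ∉ A → s (i : A) y = s a y := by
    rw [eventually_all_finite (hwf.point_finite a)]
    intro i hi
    exact cons i i.2 a ha (hvU i (hwv i hi))
  filter_upwards [h1, h2, h3] with y hy1 hy2 hy3 hyA
  have hex : ∃ i, y ∈ w i := ⟨i₀, hy1⟩
  have : q y = s (hex.choose : A) y := dif_pos hex
  rw [this]
  exact hy3 _ (hy2 _ (subset_closure hex.choose_spec)) hyA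

/-! ### Counting functions -/

/-- A continuous function counts the crossings of the closed set `A` if it takes integral values
exactly on `A` and, near `A`, increases on the side `P` of `A`. -/
structure CountsCrossings {X : Type*} [TopologicalSpace X] (A P : Set X) (H : X → ℝ) : Prop where
  continuous : Continuous H
  mem_iff : ∀ x, x ∈ A ↔ ∃ m : ℤ, H x = m
  lt_iff : ∀ a ∈ A, ∀ᶠ y in 𝓝 a, y ∉ A → (H a < H y ↔ y ∈ P)

namespace CountsCrossings

variable {X : Type*} [TopologicalSpace X] {A P : Set X} {H H' : X → ℝ}

-- Points of `A` count as points of the side `P`: near `a` the integral part is that of `H a` on `A`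
-- and on `P`, and one less on the other side. All later counting rests on this jump.
open Classical in
theorem floor_eventually_of_mem (h : CountsCrossings A P H) {a : X} (ha : a ∈ A) :
    ∀ᶠ y in 𝓝 a, ⌊H y⌋ = ⌊H a⌋ - if y ∉ A ∧ y ∉ P then 1 else 0 := by
  obtain ⟨m, hm⟩ := (h.mem_iff a).1 ha
  have h1 : ∀ᶠ y in 𝓝 a, H y ∈ Ioo ((m : ℝ) - 1) (m + 1) :=
    h.continuous.continuousAt.eventually_mem (Ioo_mem_nhds (by linarith) (by linarith))
  filter_upwards [h1, h.lt_iff a ha] with y hy1 hy2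
  rw [hm, Int.floor_intCast]
  by_cases hyA : y ∈ A
  · obtain ⟨l, hl⟩ := (h.mem_iff y).1 hyA
    rw [hl] at hy1
    have h1 : m - 1 < l := by exact_mod_cast hy1.1
    have h2 : l < m + 1 := by exact_mod_cast hy1.2
    simp only [hyA, hl, Int.floor_intCast]
    simp
    omega
  · have hlt := hy2 hyA
    by_cases hyP : y ∈ P
    · have := hlt.2 hyP
      simp only [hyP, not_true_eq_false, and_false, if_false, sub_zero]
      rw [Int.floor_eq_iff]
      rw [hm] at this
      exact ⟨this.le, hy1.2⟩
    · have : ¬ H a < H y := fun h => hyP (hlt.1 h)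
      simp only [hyA, hyP, not_false_eq_true, and_self, if_true]
      rw [Int.floor_eq_iff]
      push_cast
      have hne : H y ≠ m := fun h' => hyA ((h.mem_iff y).2 ⟨m, h'⟩)
      rw [hm] at this
      refine ⟨hy1.1.le, ?_⟩
      have : H y < m := lt_of_le_of_ne (not_lt.1 this) hne
      linarith

theorem floor_eventually_of_notMem (h : CountsCrossings A P H) {a : X} (ha : a ∉ A) :
    ∀ᶠ y in 𝓝 a, ⌊H y⌋ = ⌊H a⌋ := by
  have hne : ∀ m : ℤ, H a ≠ m := fun m hm => ha ((h.mem_iff a).2 ⟨m, hm⟩)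
  have h1 : H a ∈ Ioo ((⌊H a⌋ : ℤ) : ℝ) (⌊H a⌋ + 1) :=
    ⟨lt_of_le_of_ne (Int.floor_le _) (hne _).symm, Int.lt_floor_add_one _⟩
  filter_upwards [h.continuous.continuousAt.eventually_mem (isOpen_Ioo.mem_nhds h1)] with y hy
  rw [Int.floor_eq_iff]
  exact ⟨hy.1.le, hy.2⟩

theorem isClosed (h : CountsCrossings A P H) : IsClosed A := by
  have : A = H ⁻¹' (range ((↑) : ℤ → ℝ)) := by
    ext x; rw [h.mem_iff]; simp [eq_comm]
  rw [this]
  exact (Int.isClosedEmbedding_coe_real.isClosed_range).preimage h.continuous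

/-- Two counting functions differ by a constant. -/
theorem floor_sub_floor [PreconnectedSpace X] (h : CountsCrossings A P H)
    (h' : CountsCrossings A P H') (x y : X) : ⌊H x⌋ - ⌊H' x⌋ = ⌊H y⌋ - ⌊H' y⌋ := by
  -- The jump near `A` depends only on `A` and `P`, so it cancels in the difference.
  have hc : IsLocallyConstant (fun x => ⌊H x⌋ - ⌊H' x⌋) := by
    rw [IsLocallyConstant.iff_eventually_eq]
    intro x
    by_cases hx : x ∈ A
    · filter_upwards [h.floor_eventually_of_mem hx, h'.floor_eventually_of_mem hx] with y h1 h2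
      rw [h1, h2]; ring
    · filter_upwards [h.floor_eventually_of_notMem hx, h'.floor_eventually_of_notMem hx]
        with y h1 h2
      rw [h1, h2]
  exact hc.apply_eq_of_preconnectedSpace x y

/-- A counting function does not change its integral part away from `A`. -/
theorem floor_eq_of_disjoint (h : CountsCrossings A P H) {S : Set X} (hS : IsPreconnected S)
    (hd : ∀ x ∈ S, x ∉ A) {x y : X} (hx : x ∈ S) (hy : y ∈ S) : ⌊H x⌋ = ⌊H y⌋ := by
  refine hS.constant (f := fun x => ⌊H x⌋) (fun z hz => ?_) hx hy
  refine ContinuousAt.continuousWithinAt ?_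
  exact (continuousAt_const (y := ⌊H z⌋)).congr
    ((h.floor_eventually_of_notMem (hd z hz)).mono fun _ h => h.symm)

open Classical in
/-- The change of a counting function on a connected set on which the side `P` is extended
to a locally constant side `Q`. -/
theorem floor_add_eq (h : CountsCrossings A P H) {S Q : Set X} (hS : IsPreconnected S)
    (h1 : ∀ x ∈ S, x ∉ A → ∀ᶠ y in 𝓝[S] x, (y ∈ Q ↔ x ∈ Q))
    (h2 : ∀ x ∈ S, x ∈ A → ∀ᶠ y in 𝓝[S] x, y ∉ A → (y ∈ Q ↔ y ∈ P)) {x y : X} (hx : x ∈ S)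
    (hy : y ∈ S) : ⌊H x⌋ + (if x ∉ A ∧ x ∉ Q then 1 else 0) =
      ⌊H y⌋ + (if y ∉ A ∧ y ∉ Q then 1 else 0) := by
  -- The added term compensates the drop of `⌊H⌋` on the side outside `P`. It is expressed through
  -- `Q`, which agrees with `P` near `A` and is locally constant away from `A`, so the sum is
  -- locally constant on `S`.
  refine hS.constant (f := fun x => ⌊H x⌋ + (if x ∉ A ∧ x ∉ Q then 1 else 0))
    (fun z hz => ?_) hx hy
  by_cases hzA : z ∈ A
  · refine (continuousWithinAt_const (b := ⌊H z⌋)).congr_of_eventuallyEq ?_ (by simp [hzA])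
    filter_upwards [(h.floor_eventually_of_mem hzA).filter_mono nhdsWithin_le_nhds, h2 z hz hzA]
      with y h1 h2
    rw [h1]
    by_cases hyA : y ∈ A
    · simp [hyA]
    · simp [hyA, h2 hyA]
  · refine (continuousWithinAt_const
      (b := ⌊H z⌋ + (if z ∉ A ∧ z ∉ Q then 1 else 0))).congr_of_eventuallyEq ?_ rfl
    filter_upwards [(h.floor_eventually_of_notMem hzA).filter_mono nhdsWithin_le_nhds,
      h1 z hz hzA, (h.isClosed.isOpen_compl.mem_nhds hzA |> mem_nhdsWithin_of_mem_nhds)]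
      with y h1 h2 h3
    have h3' : y ∉ A := h3
    simp [h1, h2, h3', hzA]

theorem comp {Z : Type*} [TopologicalSpace Z] (h : CountsCrossings A P H) {c : Z → X}
    (hc : Continuous c) : CountsCrossings (c ⁻¹' A) (c ⁻¹' P) (H ∘ c) where
  continuous := h.continuous.comp hc
  mem_iff x := h.mem_iff (c x)
  lt_iff a ha := hc.continuousAt.eventually (h.lt_iff (c a) ha)

theorem congr {P' : Set X} (h : CountsCrossings A P H)
    (hP : ∀ a ∈ A, ∀ᶠ y in 𝓝 a, y ∉ A → (y ∈ P ↔ y ∈ P')) : CountsCrossings A P' H where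
  continuous := h.continuous
  mem_iff := h.mem_iff
  lt_iff a ha := by
    filter_upwards [h.lt_iff a ha, hP a ha] with y h1 h2 hy
    rw [h1 hy, h2 hy]

/-- Changing the sides changes the sign of the counting function. -/
theorem neg (h : CountsCrossings A P H) : CountsCrossings A Pᶜ (-H) where
  continuous := h.continuous.neg
  mem_iff x := by
    rw [h.mem_iff]
    constructor
    · rintro ⟨m, hm⟩; exact ⟨-m, by simp [hm]⟩
    · rintro ⟨m, hm⟩; exact ⟨-m, by simpa [neg_eq_iff_eq_neg] using hm⟩
  lt_iff a ha := by
    filter_upwards [h.lt_iff a ha, h.floor_eventually_of_mem ha] with y h1 h2 hy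
    rw [mem_compl_iff, ← h1 hy]
    simp only [Pi.neg_apply, neg_lt_neg_iff, not_lt]
    refine ⟨le_of_lt, fun h' => lt_of_le_of_ne h' fun h'' => hy ?_⟩
    rw [h.mem_iff, h'', ← h.mem_iff]; exact ha

theorem floor_neg (h : CountsCrossings A P H) {x : X} (hx : x ∉ A) : ⌊(-H) x⌋ = -⌊H x⌋ - 1 := by
  rw [Int.floor_eq_iff]
  push_cast
  have h1 := Int.floor_le (H x)
  have h2 := Int.lt_floor_add_one (H x)
  have h3 : H x ≠ ⌊H x⌋ := fun h' => hx ((h.mem_iff x).2 ⟨_, h'⟩)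
  have h4 := lt_of_le_of_ne h1 h3.symm
  simp only [Pi.neg_apply]
  constructor <;> linarith

end CountsCrossings

/-- Counting functions exist on simply connected spaces, for every closed set with a locally
constant choice of sides. -/
theorem exists_countsCrossings {X : Type*} [MetricSpace X] [SimplyConnectedSpace X]
    [LocallyPathConnectedSpace X] {A P : Set X} (hA : IsClosed A)
    (hP : ∀ a ∈ A, ∀ᶠ x in 𝓝 a, x ∉ A → ∀ᶠ y in 𝓝 x, (y ∈ P ↔ x ∈ P)) :
    ∃ H, CountsCrossings A P H := by
  classical
  rcases A.eq_empty_or_nonempty with rfl | hne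
  · refine ⟨fun _ => 1 / 2, continuous_const, fun x => ?_, by simp⟩
    simp only [mem_empty_iff_false, false_iff, not_exists]
    intro m hm
    have h1 : (2 * m : ℤ) = 1 := by
      have : (2 * m : ℝ) = 1 := by linarith
      exact_mod_cast this
    omega
  let G : Set X := interior {x | x ∉ A → ∀ᶠ y in 𝓝 x, (y ∈ P ↔ x ∈ P)}
  have hAG : A ⊆ G := fun a ha => mem_interior_iff_mem_nhds.2 (hP a ha)
  have hG : IsOpen G := isOpen_interior
  -- a function that vanishes exactly on `A` and is one outside of `G`
  obtain ⟨h, hc, h0, h1, hle⟩ : ∃ h : X → ℝ, Continuous h ∧ (∀ x, h x = 0 ↔ x ∈ A) ∧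
      (∀ x, x ∉ G → h x = 1) ∧ ∀ x, h x ∈ Icc (0 : ℝ) 1 := by
    rcases (Gᶜ).eq_empty_or_nonempty with hGe | hGne
    · refine ⟨fun x => min (Metric.infDist x A) 1, by fun_prop, fun x => ?_, fun x hx => ?_,
        fun x => ⟨le_min Metric.infDist_nonneg zero_le_one, min_le_right _ _⟩⟩
      · rw [hA.mem_iff_infDist_zero hne]
        dsimp only
        constructor
        · intro h
          rcases min_choice (Metric.infDist x A) 1 with h' | h' <;> rw [h'] at h
          · exact h
          · norm_num at h
        · intro h; rw [h]; simp
      · have : x ∈ Gᶜ := hx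
        simp [hGe] at this
    · have hpos : ∀ x, 0 < Metric.infDist x A + Metric.infDist x Gᶜ := by
        intro x
        by_cases hx : x ∈ A
        · have : 0 < Metric.infDist x Gᶜ :=
            (hG.isClosed_compl.notMem_iff_infDist_pos hGne).1 (fun h => h (hAG hx))
          have := Metric.infDist_nonneg (x := x) (s := A)
          linarith
        · have := (hA.notMem_iff_infDist_pos hne).1 hx
          have := Metric.infDist_nonneg (x := x) (s := Gᶜ)
          linarith
      refine ⟨fun x => Metric.infDist x A / (Metric.infDist x A + Metric.infDist x Gᶜ),
        ?_, fun x => ?_, fun x hx => ?_, fun x => ⟨?_, ?_⟩⟩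
      · exact (Metric.continuous_infDist_pt _).div
          ((Metric.continuous_infDist_pt _).add (Metric.continuous_infDist_pt _))
          (fun x => (hpos x).ne')
      · rw [hA.mem_iff_infDist_zero hne, div_eq_zero_iff, or_iff_left (hpos x).ne']
      · dsimp only
        have h2 : Metric.infDist x Gᶜ = 0 := Metric.infDist_zero_of_mem hx
        have := hpos x
        rw [h2, add_zero] at this ⊢
        exact div_self this.ne'
      · exact div_nonneg Metric.infDist_nonneg (hpos x).le
      · refine (div_le_one (hpos x)).2 ?_
        have := Metric.infDist_nonneg (x := x) (s := Gᶜ)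
        linarith
  -- `σ` is a signed height above `A`: continuous on `G`, and equal to `±1/2` outside `G`, where `P`
  -- is not controlled. Modulo `1` the two values `±1/2` coincide, so `θ` is continuous everywhere.
  let σ : X → ℝ := fun x => if x ∈ P then h x / 2 else -(h x / 2)
  have hσabs : ∀ x, |σ x| = h x / 2 := by
    intro x
    have := (hle x).1
    by_cases hx : x ∈ P <;> simp only [σ, hx, if_true, if_false, abs_neg] <;>
      exact abs_of_nonneg (by linarith)
  let θ : X → AddCircle (1 : ℝ) := fun x => (σ x : AddCircle (1 : ℝ))
  have hθ : Continuous θ := by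
    have hq : Continuous ((↑) : ℝ → AddCircle (1 : ℝ)) := AddCircle.continuous_mk' 1
    rw [continuous_iff_continuousAt]
    intro x
    by_cases hxG : x ∈ G
    · have : ContinuousAt σ x := by
        by_cases hxA : x ∈ A
        · have hx0 : σ x = 0 := by
            rw [← abs_eq_zero, hσabs, (h0 x).2 hxA, zero_div]
          rw [ContinuousAt, hx0, tendsto_zero_iff_abs_tendsto_zero]
          have : Tendsto (fun y => h y / 2) (𝓝 x) (𝓝 (h x / 2)) :=
            (hc.continuousAt.div_const 2)
          rw [(h0 x).2 hxA, zero_div] at this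
          exact this.congr (fun y => (hσabs y).symm)
        · have hloc : ∀ᶠ y in 𝓝 x, (y ∈ P ↔ x ∈ P) := interior_subset hxG hxA
          by_cases hxP : x ∈ P
          · refine ContinuousAt.congr (f := fun y => h y / 2) (hc.continuousAt.div_const 2) ?_
            filter_upwards [hloc] with y hy
            simp [σ, hy.2 hxP]
          · refine ContinuousAt.congr (f := fun y => -(h y / 2))
              (hc.continuousAt.div_const 2).neg ?_
            filter_upwards [hloc] with y hy
            simp [σ, hy, hxP]
      exact hq.continuousAt.comp this
    · have hhalf : (((-(1 / 2) : ℝ)) : AddCircle (1 : ℝ)) = ((1 / 2 : ℝ) : AddCircle (1 : ℝ)) := by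
        rw [← sub_eq_zero, ← AddCircle.coe_sub, AddCircle.coe_eq_zero_iff]
        exact ⟨-1, by norm_num⟩
      have t1 : Tendsto (fun y => ((h y / 2 : ℝ) : AddCircle (1 : ℝ))) (𝓝 x)
          (𝓝 ((1 / 2 : ℝ) : AddCircle (1 : ℝ))) := by
        have := (hq.comp (hc.div_const 2)).tendsto x
        simp only [Function.comp_apply, h1 x hxG] at this
        exact this
      have t2 : Tendsto (fun y => ((-(h y / 2) : ℝ) : AddCircle (1 : ℝ))) (𝓝 x)
          (𝓝 ((1 / 2 : ℝ) : AddCircle (1 : ℝ))) := by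
        have := (hq.comp (hc.div_const 2).neg).tendsto x
        simp only [Function.comp_apply, Pi.neg_apply, h1 x hxG] at this
        rw [hhalf] at this
        exact this
      have hx : θ x = ((1 / 2 : ℝ) : AddCircle (1 : ℝ)) := by
        by_cases hxP : x ∈ P
        · simp only [θ, σ, hxP, if_true, h1 x hxG]
        · simp only [θ, σ, hxP, if_false, h1 x hxG]; exact hhalf
      rw [ContinuousAt, hx]
      have : θ = fun y => if y ∈ P then ((h y / 2 : ℝ) : AddCircle (1 : ℝ))
          else ((-(h y / 2) : ℝ) : AddCircle (1 : ℝ)) := by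
        funext y; by_cases hy : y ∈ P <;> simp [θ, σ, hy]
      rw [this]
      exact Tendsto.if' t1 t2
  obtain ⟨a₀, ha₀⟩ := hne
  -- The lift of `θ` to `ℝ` is the counting function; it differs from `σ` by an integer at each
  -- point.
  obtain ⟨H, ⟨-, hH⟩, -⟩ := (AddCircle.isCoveringMap_coe (1 : ℝ)).existsUnique_continuousMap_lifts
    (⟨θ, hθ⟩ : C(X, AddCircle (1 : ℝ))) a₀ (σ a₀) rfl
  have hH' : ∀ x, ∃ m : ℤ, H x = m + σ x := by
    intro x
    have : ((H x : ℝ) : AddCircle (1 : ℝ)) = ((σ x : ℝ) : AddCircle (1 : ℝ)) := congrFun hH x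
    rw [← sub_eq_zero, ← AddCircle.coe_sub, AddCircle.coe_eq_zero_iff] at this
    obtain ⟨m, hm⟩ := this
    refine ⟨m, ?_⟩
    simp at hm
    linarith
  have hσle : ∀ x, |σ x| ≤ 1 / 2 := fun x => by rw [hσabs]; have := (hle x).2; linarith
  refine ⟨H, H.continuous, fun x => ?_, fun a ha => ?_⟩
  · obtain ⟨m, hm⟩ := hH' x
    constructor
    · intro hx
      refine ⟨m, ?_⟩
      rw [hm, abs_eq_zero.1 ((hσabs x).trans (by rw [(h0 x).2 hx, zero_div])), add_zero]
    · rintro ⟨l, hl⟩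
      have h3 : σ x = ((l - m : ℤ) : ℝ) := by push_cast; linarith
      have h4 := hσle x
      rw [h3, abs_le] at h4
      have h5 : l - m < 1 := by
        have : ((l - m : ℤ) : ℝ) < 1 := by linarith [h4.2]
        exact_mod_cast this
      have h6 : -1 < l - m := by
        have : (-1 : ℝ) < ((l - m : ℤ) : ℝ) := by linarith [h4.1]
        exact_mod_cast this
      have h7 : l - m = 0 := by omega
      rw [h7, Int.cast_zero] at h3
      have h8 := hσabs x
      rw [h3, abs_zero] at h8
      exact (h0 x).1 (by linarith)
  · obtain ⟨m, hm⟩ := hH' a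
    have hσa : σ a = 0 := abs_eq_zero.1 ((hσabs a).trans (by rw [(h0 a).2 ha, zero_div]))
    rw [hσa, add_zero] at hm
    have h1 : ∀ᶠ y in 𝓝 a, H y ∈ Ioo ((m : ℝ) - 1 / 2) (m + 1 / 2) :=
      H.continuous.continuousAt.eventually_mem (Ioo_mem_nhds (by linarith) (by linarith))
    filter_upwards [h1] with y hy hyA
    obtain ⟨l, hl⟩ := hH' y
    have h4 := abs_le.1 (hσle y)
    -- Close to `a` the integer `H - σ` cannot jump, so `H y - H a = σ y` and the sign of `σ`
    -- decides.
    have h5 : l = m := by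
      have h6 : l < m + 1 := by
        have : (l : ℝ) < m + 1 := by linarith [hy.2, h4.1]
        exact_mod_cast this
      have h7 : m < l + 1 := by
        have : (m : ℝ) < l + 1 := by linarith [hy.1, h4.2]
        exact_mod_cast this
      omega
    rw [hm, hl, h5, lt_add_iff_pos_right]
    have hpos : 0 < h y := lt_of_le_of_ne (hle y).1 (fun h' => hyA ((h0 y).1 h'.symm))
    by_cases hyP : y ∈ P
    · simp only [σ, hyP, if_true, iff_true]; linarith
    · simp only [σ, hyP, if_false, iff_false, not_lt]; linarith

/-! ### Signs -/

/-- The alternating sum of a sequence of signs. -/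
def alternatingSum : List ℤˣ → ℤ
  | [] => 0
  | x :: l => x - alternatingSum l

/-- A normalized sequence of signs is determined by its alternating sum. -/
theorem count_of_isChain : ∀ l : List ℤˣ, l.IsChain (· ≠ ·) →
    ((l.count (-1) : ℕ) : ℤ) = |alternatingSum l / 2| ∧
      (∀ x ∈ l.head?, (x : ℤ) = 1 ∧ 0 < alternatingSum l ∨ (x : ℤ) = -1 ∧ alternatingSum l < 0) ∧
      (l.head? = none → alternatingSum l = 0)
  | [], _ => by simp [alternatingSum]
  | x :: l, h => by
    -- Signs without equal neighbours alternate, so a word of length `L` has alternating sum `L` or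
    -- `-L`, with the sign of its first entry. It has `⌊L/2⌋` minus signs if it starts with `+1` and
    -- `⌈L/2⌉` if it starts with `-1`; division rounding down gives both.
    obtain ⟨ih1, ih2, ih3⟩ := count_of_isChain l (List.IsChain.tail h)
    rcases l with _ | ⟨y, l⟩
    · rcases Int.units_eq_one_or x with rfl | rfl <;> simp [alternatingSum]
    · have hxy : x ≠ y := (List.isChain_cons_cons.1 h).1
      have ih2 := ih2 y (by simp)
      rcases Int.units_eq_one_or x with rfl | rfl <;> rcases Int.units_eq_one_or y with rfl | rfl
      · exact absurd rfl hxy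
      · have : alternatingSum (-1 :: l) < 0 := by simpa using ih2
        generalize hd : alternatingSum (-1 :: l) = d at *
        rw [alternatingSum, hd, List.count_cons_of_ne (by decide), ih1]
        simp
        refine ⟨?_, by omega⟩
        rw [abs_of_neg (show d / 2 < 0 by omega), abs_of_nonneg (show 0 ≤ (1 - d) / 2 by omega)]
        omega
      · have : 0 < alternatingSum (1 :: l) := by simpa using ih2
        generalize hd : alternatingSum (1 :: l) = d at *
        rw [alternatingSum, hd, List.count_cons_self]
        push_cast
        rw [ih1]
        simp
        refine ⟨?_, by omega⟩
        rw [abs_of_nonneg (show 0 ≤ d / 2 by omega), abs_of_neg (show (-1 - d) / 2 < 0 by omega)]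
        omega
      · exact absurd rfl hxy

theorem normalizeSigns_isChain : ∀ l : List ℤˣ, (normalizeSigns l).IsChain (· ≠ ·)
  | [] => by simp [normalizeSigns]
  | x :: l => by
    have ih := normalizeSigns_isChain l
    rw [normalizeSigns]
    split_ifs with h
    · exact ih.tail
    · rcases hl : normalizeSigns l with _ | ⟨y, l'⟩
      · simp
      · rw [hl] at h ih
        refine List.isChain_cons_cons.2 ⟨?_, ih⟩
        rintro rfl
        simp at h

/-- Two equal neighbours contribute `x - (x - S) = S`, so cancelling them is invisible to the
alternating sum. -/
theorem alternatingSum_normalizeSigns : ∀ l : List ℤˣ,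
    alternatingSum (normalizeSigns l) = alternatingSum l
  | [] => rfl
  | x :: l => by
    have ih := alternatingSum_normalizeSigns l
    rw [normalizeSigns]
    split_ifs with h
    · rcases hl : normalizeSigns l with _ | ⟨y, l'⟩
      · simp [hl] at h
      · rw [hl] at h ih
        simp at h
        subst h
        rw [alternatingSum, ← ih, alternatingSum, List.tail_cons]
        ring
    · rw [alternatingSum, alternatingSum, ih]

/-- The number of minus signs after normalization is determined by the alternating sum. -/
theorem minusCount_eq (l : List ℤˣ) : (minusCount l : ℤ) = |alternatingSum l / 2| := by
  rw [minusCount, (count_of_isChain _ (normalizeSigns_isChain l)).1, alternatingSum_normalizeSigns]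

/-! ### Calculus of the normal forms -/

section NormalForm

variable {n : ℕ}

/-- The second derivative `F_tt` of the versal polynomial at a point of the normal form. -/
def versalSecond [NeZero n] (k : ℕ) (X : EuclideanSpace ℝ (Fin n)) : ℝ :=
  ((k : ℝ) + 2) * ((k : ℝ) + 1) * X 0 ^ k +
    ∑ i : Fin n, if 1 ≤ (i : ℕ) ∧ (i : ℕ) + 1 ≤ k
      then ((i : ℝ) + 1) * (i : ℝ) * X 0 ^ ((i : ℕ) - 1) * X i else 0

/-- The derivative `∑ j ≤ k, u_j t^j` of `F(t, ·)`. -/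
def versalLinear (k : ℕ) (u : EuclideanSpace ℝ (Fin (n + 1))) (t : ℝ) : ℝ :=
  ∑ j : Fin (n + 1), if (j : ℕ) ≤ k then u j * t ^ (j : ℕ) else 0

theorem versal_eq (k : ℕ) (u : EuclideanSpace ℝ (Fin (n + 1))) (t : ℝ) :
    versal k u t = t ^ (k + 2) + versalLinear k u t := rfl

theorem versalLinear_add_smul (k : ℕ) (u w : EuclideanSpace ℝ (Fin (n + 1))) (s t : ℝ) :
    versalLinear k (u + s • w) t = versalLinear k u t + s * versalLinear k w t := by
  simp only [versalLinear, Finset.mul_sum, ← Finset.sum_add_distrib]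
  refine Finset.sum_congr rfl fun j _ => ?_
  split_ifs <;> simp
  ring

/-- A vector with components `a`, `b`, and `w j` for `j ≠ 0`. -/
def targetVector [NeZero n] (a b : ℝ) (w : EuclideanSpace ℝ (Fin n)) : EuclideanSpace ℝ (Fin (n + 1)) :=
  WithLp.toLp 2 (Fin.cases a (fun j : Fin n => if j = 0 then b else w j))

theorem versalLinear_targetVector [NeZero n] {k : ℕ} (hk : 1 ≤ k) (a b : ℝ) (w : EuclideanSpace ℝ (Fin n))
    (t : ℝ) : versalLinear k (targetVector a b w) t = a + b * t +
      ∑ i : Fin n, if 1 ≤ (i : ℕ) ∧ (i : ℕ) + 1 ≤ k then w i * t ^ ((i : ℕ) + 1) else 0 := by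
  rw [versalLinear, Fin.sum_univ_succ]
  have h1 : ∀ i : Fin n, (if ((i.succ : Fin (n + 1)) : ℕ) ≤ k
      then targetVector a b w i.succ * t ^ ((i.succ : Fin (n + 1)) : ℕ) else 0) =
      (if i = 0 then b * t else 0) +
        if 1 ≤ (i : ℕ) ∧ (i : ℕ) + 1 ≤ k then w i * t ^ ((i : ℕ) + 1) else 0 := by
    intro i
    by_cases hi : i = 0
    · subst hi
      have h0 : (((0 : Fin n).succ : Fin (n + 1)) : ℕ) = 1 := by
        rw [Fin.val_succ]; simp
      rw [h0]
      simp only [targetVector, Fin.cases_succ, hk, if_true]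
      simp
    · have : 1 ≤ (i : ℕ) := Nat.one_le_iff_ne_zero.2 (fun h => hi (Fin.ext (by simpa using h)))
      simp [targetVector, hi, this]
  rw [Finset.sum_congr rfl (fun i _ => h1 i), Finset.sum_add_distrib]
  simp [targetVector]
  ring

/-- The derivative of the normal form. -/
theorem hasFDerivAt_normalForm [NeZero n] (k : ℕ) (X : EuclideanSpace ℝ (Fin n)) :
    ∃ L : EuclideanSpace ℝ (Fin n) →L[ℝ] EuclideanSpace ℝ (Fin (n + 1)),
      HasFDerivAt (normalForm n k) L X ∧ ∀ w, L w = targetVector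
        (X 0 * versalSecond k X * w 0 + ∑ i : Fin n, if 1 ≤ (i : ℕ) ∧ (i : ℕ) + 1 ≤ k
          then (i : ℝ) * X 0 ^ ((i : ℕ) + 1) * w i else 0)
        (-(versalSecond k X * w 0) - ∑ i : Fin n, if 1 ≤ (i : ℕ) ∧ (i : ℕ) + 1 ≤ k
          then ((i : ℝ) + 1) * X 0 ^ (i : ℕ) * w i else 0) w := by
  have hp : ∀ i : Fin n, HasFDerivAt (fun X : EuclideanSpace ℝ (Fin n) => X i)
      (EuclideanSpace.proj i : EuclideanSpace ℝ (Fin n) →L[ℝ] ℝ) X := fun i =>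
    (EuclideanSpace.proj i : EuclideanSpace ℝ (Fin n) →L[ℝ] ℝ).hasFDerivAt
  have hs : ∀ (c : Fin n → ℝ) (m : Fin n → ℕ), ∃ L : EuclideanSpace ℝ (Fin n) →L[ℝ] ℝ,
      HasFDerivAt (fun X : EuclideanSpace ℝ (Fin n) =>
      ∑ i : Fin n, if 1 ≤ (i : ℕ) ∧ (i : ℕ) + 1 ≤ k then c i * X 0 ^ (m i) * X i else 0) L X ∧
      ∀ w, L w = ∑ i : Fin n, if 1 ≤ (i : ℕ) ∧ (i : ℕ) + 1 ≤ k then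
        c i * X 0 ^ (m i) * w i + X i * (c i * (m i * X 0 ^ (m i - 1) * w 0)) else 0 := by
    intro c m
    have : ∀ i : Fin n, HasFDerivAt (fun X : EuclideanSpace ℝ (Fin n) =>
        if 1 ≤ (i : ℕ) ∧ (i : ℕ) + 1 ≤ k then c i * X 0 ^ (m i) * X i else 0)
        (if 1 ≤ (i : ℕ) ∧ (i : ℕ) + 1 ≤ k then
        (c i * X 0 ^ (m i)) • (EuclideanSpace.proj i : EuclideanSpace ℝ (Fin n) →L[ℝ] ℝ) +
        X i • (c i • ((m i • X 0 ^ (m i - 1)) •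
          (EuclideanSpace.proj 0 : EuclideanSpace ℝ (Fin n) →L[ℝ] ℝ))) else 0) X := by
      intro i
      split_ifs
      · exact ((HasFDerivAt.pow (hp 0) (m i)).const_mul (c i)).mul (hp i)
      · exact hasFDerivAt_const _ _
    refine ⟨_, HasFDerivAt.fun_sum fun i _ => this i, fun w => ?_⟩
    rw [sum_apply]
    refine Finset.sum_congr rfl fun i _ => ?_
    split_ifs <;> simp
  have hq : ∀ (c : ℝ) (m : ℕ), ∃ L : EuclideanSpace ℝ (Fin n) →L[ℝ] ℝ,
      HasFDerivAt (fun X : EuclideanSpace ℝ (Fin n) => c * X 0 ^ m) L X ∧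
      ∀ w, L w = c * (m * X 0 ^ (m - 1) * w 0) :=
    fun c m => ⟨_, (HasFDerivAt.pow (hp 0) m).const_mul c, fun w => by simp⟩
  obtain ⟨A0, hA0, eA0⟩ := hq ((k : ℝ) + 1) (k + 2)
  obtain ⟨A1, hA1, eA1⟩ := hq ((k : ℝ) + 2) (k + 1)
  obtain ⟨B0, hB0, eB0⟩ := hs (fun i => (i : ℝ)) (fun i => (i : ℕ) + 1)
  obtain ⟨B1, hB1, eB1⟩ := hs (fun i => (i : ℝ) + 1) (fun i => (i : ℕ))
  let L' : Fin (n + 1) → (EuclideanSpace ℝ (Fin n) →L[ℝ] ℝ) :=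
    Fin.cases (A0 + B0) (fun j : Fin n => if j = 0 then -A1 - B1 else EuclideanSpace.proj j)
  let L : EuclideanSpace ℝ (Fin n) →L[ℝ] EuclideanSpace ℝ (Fin (n + 1)) :=
    (EuclideanSpace.equiv (Fin (n + 1)) ℝ).symm.toContinuousLinearMap ∘L ContinuousLinearMap.pi L'
  have hL : ∀ w i, L w i = L' i w := fun w i => by simp [L]
  refine ⟨L, ?_, fun w => ?_⟩
  · rw [← hasFDerivWithinAt_univ, hasFDerivWithinAt_euclidean]
    intro i
    rw [hasFDerivWithinAt_univ]
    have hc : (EuclideanSpace.proj i : EuclideanSpace ℝ (Fin (n + 1)) →L[ℝ] ℝ) ∘L L = L' i := by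
      ext w; exact hL w i
    rw [hc]
    refine Fin.cases ?_ (fun j => ?_) i
    · exact hA0.add hB0
    · by_cases hj : j = 0
      · simp only [L', Fin.cases_succ, hj, if_true]
        refine (hA1.neg.sub hB1).congr_of_eventuallyEq (Eventually.of_forall fun X => ?_)
        simp only [normalForm, Fin.cases_succ, if_true]
        rfl
      · simp only [L', Fin.cases_succ, hj, if_false]
        refine (hp j).congr_of_eventuallyEq (Eventually.of_forall fun X => ?_)
        simp [normalForm, hj]
  · ext i
    rw [hL]
    refine Fin.cases ?_ (fun j => ?_) i
    · simp only [L', targetVector, Fin.cases_zero, add_apply, eA0, eB0, versalSecond]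
      rw [mul_add, add_mul (X 0 * (((k : ℝ) + 2) * ((k : ℝ) + 1) * X 0 ^ k)), Finset.mul_sum, Finset.sum_mul, add_assoc, ← Finset.sum_add_distrib]
      congr 1
      · simp; ring
      · refine Finset.sum_congr rfl fun i _ => ?_
        split_ifs with hi
        -- Since `i ≥ 1`, the exponent `i - 1` in `versalSecond` is a true difference, and the
        -- `t`-derivative of the first component is `t F_tt`.
        · obtain ⟨m, hm⟩ := Nat.exists_eq_add_of_le hi.1
          rw [hm]
          simp
          ring
        · simp
    · by_cases hj : j = 0
      · simp only [L', targetVector, Fin.cases_succ, hj, if_true, sub_apply, neg_apply, eA1, eB1,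
          versalSecond]
        rw [add_mul (((k : ℝ) + 2) * ((k : ℝ) + 1) * X 0 ^ k), neg_add, Finset.sum_mul, sub_eq_add_neg, sub_eq_add_neg, add_assoc,
          ← Finset.sum_neg_distrib, ← Finset.sum_neg_distrib, ← Finset.sum_neg_distrib,
          ← Finset.sum_add_distrib]
        congr 1
        · simp; ring
        · refine Finset.sum_congr rfl fun i _ => ?_
          split_ifs with hi
          · ring
          · simp
      · simp [L', targetVector, hj]

end NormalForm

/-- At a local minimum of value zero, a small positive perturbation removes every nearby root,
whereas a negative one makes the value at `t₀` negative and forces a root by the intermediate value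
theorem. Applied to `F(·, u)`, this makes the definition of the inward direction computable. -/
theorem eventually_ncard_zeros {h W : ℝ → ℝ} {t₀ : ℝ} (hc : Continuous h) (hW : Continuous W)
    (hfin : ∀ s, {t | h t + s * W t = 0}.Finite) (h0 : h t₀ = 0) (hpos : ∀ᶠ t in 𝓝 t₀, 0 ≤ h t)
    (hW0 : 0 < W t₀) : ∀ᶠ δ in 𝓝[>] (0 : ℝ), ∀ᶠ s in 𝓝[>] (0 : ℝ),
      {t | |t - t₀| < δ ∧ h t + s * W t = 0}.ncard = 0 ∧
      0 < {t | |t - t₀| < δ ∧ h t + (-s) * W t = 0}.ncard := by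
  have h1 : ∀ᶠ t in 𝓝 t₀, 0 ≤ h t ∧ 0 < W t :=
    hpos.and (hW.continuousAt.eventually_mem (Ioi_mem_nhds hW0))
  obtain ⟨ε, hε, hball⟩ := Metric.eventually_nhds_iff.1 h1
  have h2 : ∀ᶠ δ in 𝓝[>] (0 : ℝ), δ ∈ Ioo 0 ε := Ioo_mem_nhdsGT hε
  filter_upwards [h2] with δ hδ
  -- Finiteness of the zero set excludes that `h` vanishes identically to the right of `t₀`.
  obtain ⟨t₁, ht₁, hht₁⟩ : ∃ t₁, t₁ ∈ Ioo t₀ (t₀ + δ) ∧ 0 < h t₁ := by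
    by_contra! hcon
    have hinf : (Ioo t₀ (t₀ + δ)).Infinite := Ioo_infinite (by linarith [hδ.1])
    refine hinf ((hfin 0).subset fun t ht => ?_)
    have := hball (y := t) (by rw [Real.dist_eq, abs_lt]; constructor <;> linarith [ht.1, ht.2, hδ.2])
    simpa using le_antisymm (hcon t ht) this.1
  have h3 : ∀ᶠ s in 𝓝[>] (0 : ℝ), 0 < h t₁ + (-s) * W t₁ := by
    have hcont : ContinuousAt (fun s : ℝ => h t₁ + (-s) * W t₁) 0 := by fun_prop
    exact (hcont.eventually_mem (Ioi_mem_nhds (by simpa using hht₁))).filter_mono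
      nhdsWithin_le_nhds
  filter_upwards [h3, self_mem_nhdsWithin] with s hs (hs0 : 0 < s)
  constructor
  · rw [Set.ncard_eq_zero ((hfin s).subset fun t ht => ht.2)]
    refine Set.eq_empty_iff_forall_notMem.2 fun t ht => ?_
    have := hball (y := t) (by rw [Real.dist_eq]; exact ht.1.trans hδ.2)
    have h4 := ht.2
    have := mul_pos hs0 this.2
    linarith [(hball (y := t) (by rw [Real.dist_eq]; exact ht.1.trans hδ.2)).1]
  · rw [Set.ncard_pos ((hfin (-s)).subset fun t ht => ht.2)]
    have hcont : ContinuousOn (fun t => h t + (-s) * W t) (Icc t₀ t₁) := by fun_prop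
    have h5 := intermediate_value_Icc ht₁.1.le hcont
    have h6 : h t₀ + (-s) * W t₀ ≤ 0 := by
      rw [h0]; have := mul_pos hs0 hW0; linarith
    obtain ⟨t, ht, hte⟩ := h5 ⟨h6, hs.le⟩
    refine ⟨t, ?_, hte⟩
    rw [abs_lt]; constructor <;> linarith [ht.1, ht.2, ht₁.2, hδ.1]

section NormalForm

variable {n : ℕ}

theorem continuous_versal (k : ℕ) (u : EuclideanSpace ℝ (Fin (n + 1))) :
    Continuous (versal k u) := by
  unfold versal
  refine (continuous_id.pow _).add (continuous_finsetSum _ fun j _ => ?_)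
  split_ifs <;> fun_prop

theorem continuous_versalLinear (k : ℕ) (u : EuclideanSpace ℝ (Fin (n + 1))) :
    Continuous (versalLinear k u) := by
  unfold versalLinear
  refine (continuous_finsetSum _ fun j _ => ?_)
  split_ifs <;> fun_prop

theorem finite_zeros_versal (k : ℕ) (u : EuclideanSpace ℝ (Fin (n + 1))) :
    {t | versal k u t = 0}.Finite := by
  classical
  open Polynomial in
  let p : ℝ[X] := ∑ j : Fin (n + 1), if (j : ℕ) ≤ k then C (u j) * X ^ (j : ℕ) else 0
  have hp : p.degree < (k + 2 : ℕ) := by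
    refine lt_of_le_of_lt (Polynomial.degree_sum_le _ _) ?_
    rw [Finset.sup_lt_iff (WithBot.bot_lt_coe _)]
    intro j _
    split_ifs with hj
    · refine lt_of_le_of_lt (Polynomial.degree_C_mul_X_pow_le _ _) ?_
      exact_mod_cast (show (j : ℕ) < k + 2 by omega)
    · rw [Polynomial.degree_zero]; exact WithBot.bot_lt_coe _
  have hm := Polynomial.monic_X_pow_add (n := k + 2) (p := p) hp
  refine (Polynomial.finite_setOfPred_isRoot hm.ne_zero).subset fun t ht => ?_
  rw [mem_ofPred_eq] at ht
  simp only [mem_ofPred_eq, Polynomial.IsRoot, Polynomial.eval_add, Polynomial.eval_pow,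
    Polynomial.eval_X, p, Polynomial.eval_finsetSum]
  rw [← ht, versal]
  congr 1
  refine Finset.sum_congr rfl fun j _ => ?_
  split_ifs <;> simp

variable [NeZero n]

theorem normalForm_eq_targetVector (k : ℕ) (X : EuclideanSpace ℝ (Fin n)) :
    ∃ a, normalForm n k X = targetVector a (-(((k : ℝ) + 2) * X 0 ^ (k + 1))
          - ∑ i : Fin n, if 1 ≤ (i : ℕ) ∧ (i : ℕ) + 1 ≤ k
              then ((i : ℝ) + 1) * X 0 ^ (i : ℕ) * X i else 0) X ∧
      a = ((k : ℝ) + 1) * X 0 ^ (k + 2)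
      + ∑ i : Fin n, if 1 ≤ (i : ℕ) ∧ (i : ℕ) + 1 ≤ k
          then (i : ℝ) * X 0 ^ ((i : ℕ) + 1) * X i else 0 := ⟨_, rfl, rfl⟩

/-- The normal form parametrizes a part of the discriminant set. -/
theorem versal_normalForm {k : ℕ} (hk : 1 ≤ k) (X : EuclideanSpace ℝ (Fin n)) :
    versal k (normalForm n k X) (X 0) = 0 ∧
    deriv (versal k (normalForm n k X)) (X 0) = 0 ∧
    deriv (deriv (versal k (normalForm n k X))) (X 0) = versalSecond k X := by
  obtain ⟨a, ha, ha'⟩ := normalForm_eq_targetVector k X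
  set b := (-(((k : ℝ) + 2) * X 0 ^ (k + 1))
          - ∑ i : Fin n, if 1 ≤ (i : ℕ) ∧ (i : ℕ) + 1 ≤ k
              then ((i : ℝ) + 1) * X 0 ^ (i : ℕ) * X i else 0) with hb
  have e0 : versal k (normalForm n k X) = fun t => t ^ (k + 2) + (a + b * t +
      ∑ i : Fin n, if 1 ≤ (i : ℕ) ∧ (i : ℕ) + 1 ≤ k then X i * t ^ ((i : ℕ) + 1) else 0) := by
    funext t
    rw [versal_eq, ha, versalLinear_targetVector hk]
  have e1 : deriv (versal k (normalForm n k X)) = fun t => ((k : ℝ) + 2) * t ^ (k + 1) + (b +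
      ∑ i : Fin n, if 1 ≤ (i : ℕ) ∧ (i : ℕ) + 1 ≤ k then
        X i * (((i : ℝ) + 1) * t ^ (i : ℕ)) else 0) := by
    funext t
    rw [e0]
    refine HasDerivAt.deriv ?_
    refine HasDerivAt.add (by simpa using hasDerivAt_pow (k + 2) t) ?_
    refine HasDerivAt.add ?_ (HasDerivAt.fun_sum fun i _ => ?_)
    · simpa using ((hasDerivAt_id t).const_mul b).const_add a
    · split_ifs
      · simpa using (hasDerivAt_pow ((i : ℕ) + 1) t).const_mul (X i)
      · exact hasDerivAt_const _ _
  refine ⟨?_, ?_, ?_⟩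
  · rw [e0]
    dsimp only
    have hsum : (∑ i : Fin n, if 1 ≤ (i : ℕ) ∧ (i : ℕ) + 1 ≤ k
        then (i : ℝ) * X 0 ^ ((i : ℕ) + 1) * X i else 0) +
        (∑ i : Fin n, if 1 ≤ (i : ℕ) ∧ (i : ℕ) + 1 ≤ k then X i * X 0 ^ ((i : ℕ) + 1) else 0) =
        (∑ i : Fin n, if 1 ≤ (i : ℕ) ∧ (i : ℕ) + 1 ≤ k
              then ((i : ℝ) + 1) * X 0 ^ (i : ℕ) * X i else 0) * X 0 := by
      rw [Finset.sum_mul, ← Finset.sum_add_distrib]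
      refine Finset.sum_congr rfl fun i _ => ?_
      split_ifs
      · ring
      · simp
    rw [ha', hb]
    linear_combination hsum
  · rw [e1]
    dsimp only
    rw [hb]
    have : ∀ i : Fin n, (if 1 ≤ (i : ℕ) ∧ (i : ℕ) + 1 ≤ k then
        X i * (((i : ℝ) + 1) * X 0 ^ (i : ℕ)) else 0) = if 1 ≤ (i : ℕ) ∧ (i : ℕ) + 1 ≤ k
              then ((i : ℝ) + 1) * X 0 ^ (i : ℕ) * X i else 0 := by
      intro i; split_ifs <;> ring
    rw [Finset.sum_congr rfl fun i _ => this i]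
    ring
  · rw [e1]
    refine HasDerivAt.deriv ?_
    refine HasDerivAt.add ?_ (HasDerivAt.const_add _ (HasDerivAt.fun_sum fun i _ => ?_))
    · simpa [mul_assoc, add_assoc] using (hasDerivAt_pow (k + 1) (X 0)).const_mul ((k : ℝ) + 2)
    · split_ifs
      · refine (((hasDerivAt_pow (i : ℕ) (X 0)).const_mul ((i : ℝ) + 1)).const_mul
          (X i)).congr_deriv ?_
        ring
      · exact hasDerivAt_const _ _

/-- The versal polynomial vanishes to first order along the normal form; the inward direction
is the one on which the sign of `F` is opposite to the sign of `F_tt`. -/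
theorem eventually_ncard_lt_iff {k : ℕ} (hk : 1 ≤ k) {X : EuclideanSpace ℝ (Fin n)}
    (hX : versalSecond k X ≠ 0) {w : EuclideanSpace ℝ (Fin (n + 1))}
    (hw : versalLinear k w (X 0) ≠ 0) :
    (∀ᶠ δ in 𝓝[>] (0 : ℝ), ∀ᶠ s in 𝓝[>] (0 : ℝ),
      {t : ℝ | |t - X 0| < δ ∧ versal k (normalForm n k X - s • w) t = 0}.ncard <
        {t : ℝ | |t - X 0| < δ ∧ versal k (normalForm n k X + s • w) t = 0}.ncard) ↔
    versalLinear k w (X 0) * versalSecond k X < 0 := by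
  obtain ⟨e0, e1, e2⟩ := versal_normalForm hk X
  set u := normalForm n k X with hu
  have hadd : ∀ s t, versal k (u + s • w) t = versal k u t + s * versalLinear k w t := by
    intro s t; rw [versal_eq, versal_eq, versalLinear_add_smul]; ring
  have hsub : ∀ s t, versal k (u - s • w) t = versal k u t + (-s) * versalLinear k w t := by
    intro s t; rw [← hadd, neg_smul, sub_eq_add_neg]
  have hfin : ∀ s, {t | versal k u t + s * versalLinear k w t = 0}.Finite := by
    intro s; simp only [← hadd]; exact finite_zeros_versal k _
  have hc := continuous_versal k u
  have hcW := continuous_versalLinear k w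
  simp only [hadd, hsub]
  -- The factors `c` and `d` are the signs of `F_tt` and of the derivative of `F` along `w`. They
  -- reduce all cases to a local minimum perturbed by a positive function; undoing them replaces `s`
  -- by `c * d * s`.
  have key : ∀ c d : ℝ, (c = 1 ∨ c = -1) → (d = 1 ∨ d = -1) → 0 < c * versalSecond k X →
      0 < d * versalLinear k w (X 0) → ∀ᶠ δ in 𝓝[>] (0 : ℝ), ∀ᶠ s in 𝓝[>] (0 : ℝ),
      {t | |t - X 0| < δ ∧ versal k u t + (c * d * s) * versalLinear k w t = 0}.ncard = 0 ∧
      0 < {t | |t - X 0| < δ ∧ versal k u t + (-(c * d * s)) * versalLinear k w t = 0}.ncard := by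
    intro c d hcc hdd hcpos hdpos
    have hcc' : c * c = 1 := by rcases hcc with rfl | rfl <;> norm_num
    have hc0 : c ≠ 0 := by rcases hcc with rfl | rfl <;> norm_num
    have hscale : ∀ s t, (c * versal k u t + s * (d * versalLinear k w t) = 0) ↔
        versal k u t + (c * d * s) * versalLinear k w t = 0 := by
      intro s t
      have : c * versal k u t + s * (d * versalLinear k w t) =
        c * (versal k u t + (c * d * s) * versalLinear k w t) := by
        have : c * (c * d * s) = d * s := by rw [← mul_assoc, ← mul_assoc, hcc', one_mul]
        rw [mul_add, ← mul_assoc c (c * d * s), this]; ring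
      rw [this, mul_eq_zero, or_iff_right hc0]
    have hmin : ∀ᶠ t in 𝓝 (X 0), 0 ≤ c * versal k u t := by
      have h1 : deriv (fun t => c * versal k u t) = fun t => c * deriv (versal k u) t := by
        funext t; exact deriv_const_mul_field c
      have h2 : IsLocalMin (fun t => c * versal k u t) (X 0) := by
        refine isLocalMin_of_deriv_deriv_pos ?_ ?_ (by fun_prop)
        · rw [h1, deriv_const_mul_field, e2]; exact hcpos
        · rw [h1]; simp [e1]
      simpa [IsLocalMin, IsMinFilter, e0] using h2
    have := eventually_ncard_zeros (h := fun t => c * versal k u t)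
      (W := fun t => d * versalLinear k w t) (t₀ := X 0) (by fun_prop) (by fun_prop)
      (fun s => by simp only [hscale]; exact hfin _) (by simp [e0]) hmin hdpos
    filter_upwards [this] with δ hδ
    filter_upwards [hδ] with s hs
    simp only [hscale] at hs
    simpa only [mul_neg] using hs
  constructor
  · intro H
    by_contra hneg
    have hpos : 0 < versalLinear k w (X 0) * versalSecond k X :=
      lt_of_le_of_ne (not_lt.1 hneg) (mul_ne_zero hw hX).symm
    have : ∃ c : ℝ, (c = 1 ∨ c = -1) ∧ 0 < c * versalSecond k X ∧
        0 < c * versalLinear k w (X 0) := by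
      rcases lt_or_gt_of_ne hX with h | h
      · exact ⟨-1, Or.inr rfl, by linarith, by nlinarith⟩
      · exact ⟨1, Or.inl rfl, by linarith, by nlinarith⟩
    obtain ⟨c, hc1, hc2, hc3⟩ := this
    have hcc' : c * c = 1 := by rcases hc1 with rfl | rfl <;> norm_num
    obtain ⟨δ, h1, h2⟩ := (H.and (key c c hc1 hc1 hc2 hc3)).exists
    obtain ⟨s, h3, h4⟩ := (h1.and h2).exists
    simp only [hcc', one_mul] at h4
    omega
  · intro H
    have : ∃ c : ℝ, (c = 1 ∨ c = -1) ∧ 0 < c * versalSecond k X ∧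
        0 < (-c) * versalLinear k w (X 0) := by
      rcases lt_or_gt_of_ne hX with h | h
      · exact ⟨-1, Or.inr rfl, by linarith, by nlinarith⟩
      · exact ⟨1, Or.inl rfl, by linarith, by nlinarith⟩
    obtain ⟨c, hc1, hc2, hc3⟩ := this
    have hcc' : c * (-c) = -1 := by rcases hc1 with rfl | rfl <;> norm_num
    have h5 : -c = 1 ∨ -c = -1 := by rcases hc1 with rfl | rfl <;> norm_num
    filter_upwards [key c (-c) hc1 h5 hc2 hc3] with δ h1
    filter_upwards [h1] with s h2
    simp only [hcc', neg_mul, one_mul, neg_neg] at h2 ⊢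
    omega

/-- On the discriminant `F = F_t = 0`, so differentiating `F = 0` along the front leaves only the
derivative in `u` at fixed `t`. This derivative is thus a conormal of the front; here it is checked
on the explicit differential. -/
theorem versalLinear_fderiv {k : ℕ} (hk : 1 ≤ k) (X w : EuclideanSpace ℝ (Fin n)) :
    versalLinear k (fderiv ℝ (normalForm n k) X w) (X 0) = 0 := by
  obtain ⟨L, hL, hLw⟩ := hasFDerivAt_normalForm k X
  rw [hL.fderiv, hLw, versalLinear_targetVector hk]
  have hsum : (∑ i : Fin n, if 1 ≤ (i : ℕ) ∧ (i : ℕ) + 1 ≤ k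
      then (i : ℝ) * X 0 ^ ((i : ℕ) + 1) * w i else 0) +
      (∑ i : Fin n, if 1 ≤ (i : ℕ) ∧ (i : ℕ) + 1 ≤ k then w i * X 0 ^ ((i : ℕ) + 1) else 0) =
      (∑ i : Fin n, if 1 ≤ (i : ℕ) ∧ (i : ℕ) + 1 ≤ k
            then ((i : ℝ) + 1) * X 0 ^ (i : ℕ) * w i else 0) * X 0 := by
    rw [Finset.sum_mul, ← Finset.sum_add_distrib]
    refine Finset.sum_congr rfl fun i _ => ?_
    split_ifs
    · ring
    · simp
  linear_combination hsum

/-- A covector that annihilates the image of the differential of the normal form at a regular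
point is proportional to the derivative of `F`. -/
theorem conormal_normalForm {k : ℕ} (hk : 1 ≤ k) {X : EuclideanSpace ℝ (Fin n)}
    (hX : versalSecond k X ≠ 0) (η : EuclideanSpace ℝ (Fin (n + 1)) →L[ℝ] ℝ)
    (hη : ∀ w, η (fderiv ℝ (normalForm n k) X w) = 0) (u : EuclideanSpace ℝ (Fin (n + 1))) :
    η u = η (EuclideanSpace.single 0 1) * versalLinear k u (X 0) := by
  have h0 := versalLinear_fderiv hk X
  obtain ⟨L, hL, hLw⟩ := hasFDerivAt_normalForm k X
  rw [hL.fderiv] at hη h0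
  set S := ∑ i : Fin n, if 1 ≤ (i : ℕ) ∧ (i : ℕ) + 1 ≤ k
    then ((i : ℝ) + 1) * X 0 ^ (i : ℕ) * u i.succ else 0 with hS
  -- This `w` is mapped to a vector that differs from `u` only in the component of index `0`.
  -- Solving for `w 0` requires `F_tt ≠ 0`. Modulo the image, `u` is therefore a multiple of the
  -- basis vector of index `0`, on which `versalLinear` is `1`.
  let w : EuclideanSpace ℝ (Fin n) := WithLp.toLp 2
    (fun j : Fin n => if j = 0 then -(u (Fin.succ 0) + S) / versalSecond k X else u j.succ)
  have hwj : ∀ j : Fin n, j ≠ 0 → w j = u j.succ := fun j hj => by simp [w, hj]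
  have hw0 : w 0 = -(u (Fin.succ 0) + S) / versalSecond k X := by simp [w]
  have hu : ∀ a, targetVector a (u (Fin.succ 0)) w = u + (a - u 0) • EuclideanSpace.single 0 1 := by
    intro a
    ext i
    refine Fin.cases ?_ (fun j => ?_) i
    · simp [targetVector]
    · by_cases hj : j = 0
      · subst hj
        simp only [targetVector, Fin.cases_succ, if_true, PiLp.add_apply, PiLp.smul_apply,
          PiLp.single_apply, Fin.succ_ne_zero, if_false, smul_zero, add_zero]
      · simp [targetVector, hj, hwj j hj]
  have hsum : (∑ i : Fin n, if 1 ≤ (i : ℕ) ∧ (i : ℕ) + 1 ≤ k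
      then ((i : ℝ) + 1) * X 0 ^ (i : ℕ) * w i else 0) = S := by
    rw [hS]
    refine Finset.sum_congr rfl fun i _ => ?_
    split_ifs with hi
    · rw [hwj i (fun h => by subst h; simp at hi)]
    · rfl
  have hb : -(versalSecond k X * w 0) - S = u (Fin.succ 0) := by
    rw [hw0, mul_div_cancel₀ _ hX]; ring
  have hLu := hLw w
  rw [hsum, hb, hu] at hLu
  set c := X 0 * versalSecond k X * w 0 + (∑ i : Fin n, if 1 ≤ (i : ℕ) ∧ (i : ℕ) + 1 ≤ k
          then (i : ℝ) * X 0 ^ ((i : ℕ) + 1) * w i else 0) - u 0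
  have h1 := hη w
  have h2 := h0 w
  rw [hLu, map_add, map_smul, smul_eq_mul] at h1
  have h3 : versalLinear k (EuclideanSpace.single (0 : Fin (n + 1)) (1 : ℝ)) (X 0) = 1 := by
    rw [versalLinear, Finset.sum_eq_single 0]
    · simp
    · intro j _ hj; simp [hj]
    · simp
  rw [hLu, versalLinear_add_smul, h3, mul_one] at h2
  linear_combination h1 - η (EuclideanSpace.single 0 1) * h2

/-- The singular points of the normal form. -/
theorem injective_fderiv_normalForm_iff (k : ℕ) (X : EuclideanSpace ℝ (Fin n)) :
    Function.Injective (fderiv ℝ (normalForm n k) X) ↔ versalSecond k X ≠ 0 := by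
  obtain ⟨L, hL, hLw⟩ := hasFDerivAt_normalForm k X
  rw [hL.fderiv]
  constructor
  · intro hinj h0
    have h1 : L (EuclideanSpace.single 0 1) = 0 := by
      rw [hLw, h0]
      have : ∀ c : Fin n → ℝ, (∑ i : Fin n, if 1 ≤ (i : ℕ) ∧ (i : ℕ) + 1 ≤ k
          then c i * (EuclideanSpace.single (0 : Fin n) (1 : ℝ)) i else 0) = 0 := by
        intro c
        refine Finset.sum_eq_zero fun i _ => ?_
        split_ifs with hi
        · have : i ≠ 0 := fun h => by subst h; simp at hi
          simp [this]
        · rfl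
      rw [this fun i => (i : ℝ) * X 0 ^ ((i : ℕ) + 1),
        this fun i => ((i : ℝ) + 1) * X 0 ^ (i : ℕ)]
      ext i
      refine Fin.cases ?_ (fun j => ?_) i
      · simp [targetVector]
      · by_cases hj : j = 0
        · subst hj
          simp only [targetVector, Fin.cases_succ, if_true, PiLp.zero_apply]
          simp
        · simp [targetVector, hj]
    have := hinj (h1.trans L.map_zero.symm)
    have h2 := congrArg (fun v : EuclideanSpace ℝ (Fin n) => v 0) this
    simp at h2
  · intro hX
    rw [injective_iff_map_eq_zero]
    intro w hw
    rw [hLw] at hw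
    have hwj : ∀ j : Fin n, j ≠ 0 → w j = 0 := by
      intro j hj
      have := congrArg (fun v : EuclideanSpace ℝ (Fin (n + 1)) => v j.succ) hw
      simpa [targetVector, hj] using this
    have hw0 : w 0 = 0 := by
      have := congrArg (fun v : EuclideanSpace ℝ (Fin (n + 1)) => v (Fin.succ 0)) hw
      simp only [targetVector, Fin.cases_succ, if_true, PiLp.zero_apply] at this
      rw [Finset.sum_eq_zero, sub_zero, neg_eq_zero] at this
      · exact (mul_eq_zero.1 this).resolve_left hX
      · intro i _
        split_ifs with hi
        · rw [hwj i (fun h => by subst h; simp at hi), mul_zero]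
        · rfl
    ext j
    by_cases hj : j = 0
    · subst hj; exact hw0
    · exact hwj j hj

/-- The singular set of the normal form is contractible: it is invariant under a weighted
scaling. -/
theorem exists_scaling (k : ℕ) (X : EuclideanSpace ℝ (Fin n)) (hX : versalSecond k X = 0) :
    ∃ c : ℝ → EuclideanSpace ℝ (Fin n), Continuous c ∧ c 0 = 0 ∧ c 1 = X ∧
      ∀ r ∈ Icc (0 : ℝ) 1, ‖c r‖ ≤ ‖X‖ ∧ versalSecond k (c r) = 0 := by
  -- With these weights each monomial `t^(i-1) X i` of `F_tt` has weight `k`, as has `t^k`.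
  -- Coordinates not occurring in `F_tt` get weight `1`, so that all coordinates tend to zero with
  -- `r`.
  let e : Fin n → ℕ := fun i => if 1 ≤ (i : ℕ) ∧ (i : ℕ) + 1 ≤ k then k + 1 - i else 1
  have he : ∀ i, 1 ≤ e i := by
    intro i; simp only [e]; split_ifs <;> omega
  have e0 : e 0 = 1 := by simp [e]
  refine ⟨fun r => WithLp.toLp 2 (fun i => r ^ (e i) * X i), ?_, ?_, ?_, fun r hr => ⟨?_, ?_⟩⟩
  · fun_prop
  · ext i; simp [(Nat.one_le_iff_ne_zero.1 (he i))]
  · ext i; simp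
  · rw [EuclideanSpace.norm_eq, EuclideanSpace.norm_eq]
    refine Real.sqrt_le_sqrt (Finset.sum_le_sum fun i _ => ?_)
    rw [norm_mul, mul_pow]
    refine mul_le_of_le_one_left (sq_nonneg _) ?_
    rw [norm_pow, Real.norm_of_nonneg hr.1]
    exact pow_le_one₀ (pow_nonneg hr.1 _) (pow_le_one₀ hr.1 hr.2)
  · have : versalSecond k (WithLp.toLp 2 (fun i => r ^ (e i) * X i)) =
        r ^ k * versalSecond k X := by
      simp only [versalSecond, e0, pow_one]
      rw [mul_add (r ^ k), Finset.mul_sum, mul_pow r]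
      congr 1
      · ring
      · refine Finset.sum_congr rfl fun i _ => ?_
        split_ifs with hi
        · have h1 : e i = k + 1 - i := if_pos hi
          rw [h1]
          have h2 : r ^ k = r ^ ((i : ℕ) - 1) * r ^ (k + 1 - i) := by
            rw [← pow_add]; congr 1; omega
          rw [h2, mul_pow]; ring
        · simp
    rw [this, hX, mul_zero]

end NormalForm

/-! ### Derivatives in charts and unit normals of hypersurfaces -/

section Charts

variable {n : ℕ}
  {M : Type*} [TopologicalSpace M] [ChartedSpace (EuclideanSpace ℝ (Fin n)) M]
  {N : Type*} [TopologicalSpace N] [ChartedSpace (EuclideanSpace ℝ (Fin (n + 1))) N]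

theorem mdifferentiable_of_mem_maximalAtlas {m : ℕ} {P : Type*} [TopologicalSpace P]
    [ChartedSpace (EuclideanSpace ℝ (Fin m)) P]
    {φ : OpenPartialHomeomorph P (EuclideanSpace ℝ (Fin m))}
    (hφ : φ ∈ IsManifold.maximalAtlas (𝓡 m) ∞ P) : φ.MDifferentiable (𝓡 m) (𝓡 m) :=
  ⟨(contMDiffOn_of_mem_maximalAtlas hφ).mdifferentiableOn (by simp),
    (contMDiffOn_symm_of_mem_maximalAtlas hφ).mdifferentiableOn (by simp)⟩

/-- The derivative of the inverse of a chart, as a map between model spaces. -/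
def chartInvDeriv {m : ℕ} {P : Type*} [TopologicalSpace P]
    [ChartedSpace (EuclideanSpace ℝ (Fin m)) P]
    (φ : OpenPartialHomeomorph P (EuclideanSpace ℝ (Fin m))) (X : EuclideanSpace ℝ (Fin m)) :
    EuclideanSpace ℝ (Fin m) →L[ℝ] EuclideanSpace ℝ (Fin m) :=
  mfderiv (𝓡 m) (𝓡 m) φ.symm X

/-- The derivative of a chart, as a map between model spaces. -/
def chartDeriv {m : ℕ} {P : Type*} [TopologicalSpace P]
    [ChartedSpace (EuclideanSpace ℝ (Fin m)) P]
    (φ : OpenPartialHomeomorph P (EuclideanSpace ℝ (Fin m))) (p : P) :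
    EuclideanSpace ℝ (Fin m) →L[ℝ] EuclideanSpace ℝ (Fin m) :=
  mfderiv (𝓡 m) (𝓡 m) φ p

/-- The derivative of a map, as a map between model spaces. -/
def modelDeriv (f : M → N) (p : M) :
    EuclideanSpace ℝ (Fin n) →L[ℝ] EuclideanSpace ℝ (Fin (n + 1)) :=
  mfderiv (𝓡 n) (𝓡 (n + 1)) f p

theorem chartInvDeriv_chartDeriv {m : ℕ} {P : Type*} [TopologicalSpace P]
    [ChartedSpace (EuclideanSpace ℝ (Fin m)) P]
    {φ : OpenPartialHomeomorph P (EuclideanSpace ℝ (Fin m))}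
    (hφ : φ ∈ IsManifold.maximalAtlas (𝓡 m) ∞ P) {p : P} (hp : p ∈ φ.source)
    (v : EuclideanSpace ℝ (Fin m)) : chartInvDeriv φ (φ p) (chartDeriv φ p v) = v := by
  have := (mdifferentiable_of_mem_maximalAtlas hφ).symm_comp_deriv hp
  exact congrArg (fun L : TangentSpace (𝓡 m) p →L[ℝ] TangentSpace (𝓡 m) p => L v) this

theorem chartDeriv_chartInvDeriv {m : ℕ} {P : Type*} [TopologicalSpace P]
    [ChartedSpace (EuclideanSpace ℝ (Fin m)) P]
    {φ : OpenPartialHomeomorph P (EuclideanSpace ℝ (Fin m))}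
    (hφ : φ ∈ IsManifold.maximalAtlas (𝓡 m) ∞ P) {p : P} (hp : p ∈ φ.source)
    (v : EuclideanSpace ℝ (Fin m)) : chartDeriv φ p (chartInvDeriv φ (φ p) v) = v := by
  have := (mdifferentiable_of_mem_maximalAtlas hφ).comp_symm_deriv (φ.map_source hp)
  rw [φ.left_inv hp] at this
  exact congrArg (fun L : TangentSpace (𝓡 m) (φ p) →L[ℝ] TangentSpace (𝓡 m) (φ p) => L v) this

/-- The chain rule for the coordinate expression of a map. -/
theorem fderiv_coordinates {f : M → N} {φ : OpenPartialHomeomorph M (EuclideanSpace ℝ (Fin n))}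
    {ψ : OpenPartialHomeomorph N (EuclideanSpace ℝ (Fin (n + 1)))}
    (hφ : φ ∈ IsManifold.maximalAtlas (𝓡 n) ∞ M)
    (hψ : ψ ∈ IsManifold.maximalAtlas (𝓡 (n + 1)) ∞ N) {p : M} (hp : p ∈ φ.source)
    (hfp : f p ∈ ψ.source) (hf : MDifferentiableAt (𝓡 n) (𝓡 (n + 1)) f p)
    (w : EuclideanSpace ℝ (Fin n)) :
    fderiv ℝ (fun X => ψ (f (φ.symm X))) (φ p) w =
      chartDeriv ψ (f p) (modelDeriv f p (chartInvDeriv φ (φ p) w)) := by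
  have h1 : MDifferentiableAt (𝓡 n) (𝓡 n) φ.symm (φ p) :=
    (mdifferentiable_of_mem_maximalAtlas hφ).mdifferentiableAt_symm (φ.map_source hp)
  have h2 : MDifferentiableAt (𝓡 (n + 1)) (𝓡 (n + 1)) ψ (f p) :=
    (mdifferentiable_of_mem_maximalAtlas hψ).mdifferentiableAt hfp
  have e : φ.symm (φ p) = p := φ.left_inv hp
  have hf' : HasMFDerivAt (𝓡 n) (𝓡 (n + 1)) f (φ.symm (φ p)) (modelDeriv f p) := by
    rw [e]; exact hf.hasMFDerivAt
  have h2' : HasMFDerivAt (𝓡 (n + 1)) (𝓡 (n + 1)) ψ (f (φ.symm (φ p))) (chartDeriv ψ (f p)) := by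
    rw [e]; exact h2.hasMFDerivAt
  have h3 := h2'.comp (φ p) (hf'.comp (φ p) h1.hasMFDerivAt)
  have h4 : HasFDerivAt (fun X => ψ (f (φ.symm X)))
      ((chartDeriv ψ (f p)).comp ((modelDeriv f p).comp (chartInvDeriv φ (φ p)))) (φ p) :=
    hasMFDerivAt_iff_hasFDerivAt.1 h3
  rw [h4.fderiv]
  rfl

theorem mem_singularSet_iff_coordinates {f : M → N}
    {φ : OpenPartialHomeomorph M (EuclideanSpace ℝ (Fin n))}
    {ψ : OpenPartialHomeomorph N (EuclideanSpace ℝ (Fin (n + 1)))}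
    (hφ : φ ∈ IsManifold.maximalAtlas (𝓡 n) ∞ M)
    (hψ : ψ ∈ IsManifold.maximalAtlas (𝓡 (n + 1)) ∞ N) {p : M} (hp : p ∈ φ.source)
    (hfp : f p ∈ ψ.source) (hf : MDifferentiableAt (𝓡 n) (𝓡 (n + 1)) f p) :
    p ∉ singularSet n f ↔
      Function.Injective (fderiv ℝ (fun X => ψ (f (φ.symm X))) (φ p)) := by
  have h : p ∉ singularSet n f ↔ Function.Injective (modelDeriv f p) := not_not
  rw [h]
  have hc := fderiv_coordinates hφ hψ hp hfp hf
  constructor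
  · intro hi v w hvw
    rw [hc, hc] at hvw
    have h1 := congrArg (chartInvDeriv ψ (ψ (f p))) hvw
    rw [chartInvDeriv_chartDeriv hψ hfp, chartInvDeriv_chartDeriv hψ hfp] at h1
    have h2 := congrArg (chartDeriv φ p) (hi h1)
    rwa [chartDeriv_chartInvDeriv hφ hp, chartDeriv_chartInvDeriv hφ hp] at h2
  · intro hi v w hvw
    have h1 := hc (chartDeriv φ p v)
    have h2 := hc (chartDeriv φ p w)
    rw [chartInvDeriv_chartDeriv hφ hp] at h1 h2
    have h3 := hi (h1.trans ((congrArg (chartDeriv ψ (f p)) hvw).trans h2.symm))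
    have h4 := congrArg (chartInvDeriv φ (φ p)) h3
    rwa [chartInvDeriv_chartDeriv hφ hp, chartInvDeriv_chartDeriv hφ hp] at h4

variable [IsManifold (𝓡 (n + 1)) ∞ N] (g : SmoothMetric n N)

/-- The metric, as a bilinear form on the model space. -/
def modelInner (y : N) :
    EuclideanSpace ℝ (Fin (n + 1)) →L[ℝ] EuclideanSpace ℝ (Fin (n + 1)) →L[ℝ] ℝ := g.inner y

/-- The covector of a tangent vector in a chart. -/
def chartCovector (ψ : OpenPartialHomeomorph N (EuclideanSpace ℝ (Fin (n + 1)))) (y : N)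
    (v : EuclideanSpace ℝ (Fin (n + 1))) : EuclideanSpace ℝ (Fin (n + 1)) →L[ℝ] ℝ :=
  (modelInner g y v).comp (chartInvDeriv ψ (ψ y))

theorem modelInner_symm (y : N) (v w : EuclideanSpace ℝ (Fin (n + 1))) :
    modelInner g y v w = modelInner g y w v := g.symm y v w

theorem modelInner_pos (y : N) (v : EuclideanSpace ℝ (Fin (n + 1))) (hv : v ≠ 0) :
    0 < modelInner g y v v := g.pos y v hv

theorem isUnitOrthogonal_iff {f : M → N} {q : M} {v : EuclideanSpace ℝ (Fin (n + 1))} :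
    IsUnitOrthogonal g f q v ↔ modelInner g (f q) v v = 1 ∧
      ∀ w, modelInner g (f q) v (modelDeriv f q w) = 0 := Iff.rfl

theorem IsUnitOrthogonal.chartCovector_fderiv {g : SmoothMetric n N} {f : M → N}
    {φ : OpenPartialHomeomorph M (EuclideanSpace ℝ (Fin n))}
    {ψ : OpenPartialHomeomorph N (EuclideanSpace ℝ (Fin (n + 1)))}
    (hφ : φ ∈ IsManifold.maximalAtlas (𝓡 n) ∞ M)
    (hψ : ψ ∈ IsManifold.maximalAtlas (𝓡 (n + 1)) ∞ N) {p : M} (hp : p ∈ φ.source)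
    (hfp : f p ∈ ψ.source) (hf : MDifferentiableAt (𝓡 n) (𝓡 (n + 1)) f p)
    {v : EuclideanSpace ℝ (Fin (n + 1))} (hv : IsUnitOrthogonal g f p v)
    (w : EuclideanSpace ℝ (Fin n)) :
    chartCovector g ψ (f p) v (fderiv ℝ (fun X => ψ (f (φ.symm X))) (φ p) w) = 0 := by
  rw [fderiv_coordinates hφ hψ hp hfp hf, chartCovector, ContinuousLinearMap.comp_apply,
    chartInvDeriv_chartDeriv hψ hfp]
  exact hv.2 _

/-- A unit normal vector of a hypersurface is determined up to sign. -/
theorem IsUnitOrthogonal.eq_or_eq_neg {g : SmoothMetric n N} {f : M → N} {q : M}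
    (hq : q ∉ singularSet n f) {v w : EuclideanSpace ℝ (Fin (n + 1))}
    (hv : IsUnitOrthogonal g f q v) (hw : IsUnitOrthogonal g f q w) : w = v ∨ w = -v := by
  rw [isUnitOrthogonal_iff] at hv hw
  have hinj : Function.Injective (modelDeriv f q) := not_not.1 hq
  set D := modelDeriv (n := n) f q
  set B := modelInner g (f q)
  have hsym : ∀ v w, B v w = B w v := modelInner_symm g (f q)
  -- By dimension, the image of the differential and `v` span the whole space. The part of `w`
  -- orthogonal to `v` is then orthogonal to everything, hence zero.
  let T : (EuclideanSpace ℝ (Fin n) × ℝ) →ₗ[ℝ] EuclideanSpace ℝ (Fin (n + 1)) :=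
    D.toLinearMap.coprod (LinearMap.toSpanSingleton ℝ _ v)
  have hT : ∀ x, T x = D x.1 + x.2 • v := fun x => by simp [T]
  have hTinj : Function.Injective T := by
    rw [injective_iff_map_eq_zero]
    rintro ⟨x, t⟩ hx
    rw [hT] at hx
    have h1 := congrArg (B v) hx
    simp only [map_add, map_smul, hv.2, hv.1, map_zero, smul_eq_mul] at h1
    have ht : t = 0 := by linarith
    subst ht
    rw [zero_smul, add_zero] at hx
    exact Prod.ext (hinj (hx.trans D.map_zero.symm)) rfl
  have hTsurj : Function.Surjective T := by
    refine (LinearMap.injective_iff_surjective_of_finrank_eq_finrank ?_).1 hTinj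
    simp
  set z := w - (B v w) • v
  have hz : ∀ y, B z y = 0 := by
    intro y
    obtain ⟨x, rfl⟩ := hTsurj y
    rw [hT]
    simp only [z, map_sub, map_smul, sub_apply, smul_apply, map_add, hv.2, hw.2, hv.1,
      hsym w v, smul_eq_mul]
    ring
  have hz0 : z = 0 := by
    by_contra h
    have := modelInner_pos g (f q) z h
    exact this.ne' (hz z)
  have hw' : w = (B v w) • v := sub_eq_zero.1 hz0
  have h2 : (B v w) * (B v w) = 1 := by
    have h1 := hw.1
    rw [hw'] at h1
    simpa [hv.1] using h1
  rcases mul_self_eq_one_iff.1 h2 with h | h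
  · left; rw [hw', h, one_smul]
  · right; rw [hw', h, neg_one_smul]

end Charts

/-! ### The singular set and the inward direction in normal form charts -/

section NormalFormChart

variable {n : ℕ} [NeZero n]
  {M : Type*} [TopologicalSpace M] [ChartedSpace (EuclideanSpace ℝ (Fin n)) M]
  {N : Type*} [TopologicalSpace N] [ChartedSpace (EuclideanSpace ℝ (Fin (n + 1))) N]
  {k : ℕ} {f : M → N} {p : M} {φ : OpenPartialHomeomorph M (EuclideanSpace ℝ (Fin n))}
  {ψ : OpenPartialHomeomorph N (EuclideanSpace ℝ (Fin (n + 1)))}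

namespace IsNormalFormChart

theorem coordinates_eventuallyEq (h : IsNormalFormChart k f p φ ψ) {X : EuclideanSpace ℝ (Fin n)}
    (hX : X ∈ φ.target) : (fun X => ψ (f (φ.symm X))) =ᶠ[𝓝 X] normalForm n k := by
  filter_upwards [φ.open_target.mem_nhds hX] with Y hY
  rw [h.eq_normalForm _ (φ.map_target hY), φ.right_inv hY]

theorem mem_singularSet_iff (h : IsNormalFormChart k f p φ ψ)
    (hf : MDifferentiable (𝓡 n) (𝓡 (n + 1)) f) {q : M} (hq : q ∈ φ.source) :
    q ∈ singularSet n f ↔ versalSecond k (φ q) = 0 := by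
  rw [← not_iff_not, mem_singularSet_iff_coordinates h.source_mem_atlas h.target_mem_atlas hq
    (h.mapsTo hq) (hf q), (h.coordinates_eventuallyEq (φ.map_source hq)).fderiv_eq,
    injective_fderiv_normalForm_iff]

/-- Regular points are dense near a singular point. -/
theorem frequently_notMem_singularSet (h : IsNormalFormChart k f p φ ψ)
    (hf : MDifferentiable (𝓡 n) (𝓡 (n + 1)) f) : ∃ᶠ q in 𝓝 p, q ∉ singularSet n f := by
  have h0 : (0 : EuclideanSpace ℝ (Fin n)) ∈ φ.target := by
    rw [← h.centered]; exact φ.map_source h.mem_source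
  -- Along the `t`-axis `F_tt = (k+2)(k+1) t^k`, which vanishes only at the origin.
  let c : ℝ → EuclideanSpace ℝ (Fin n) := fun t => t • EuclideanSpace.single 0 1
  have hc : Tendsto c (𝓝[≠] 0) (𝓝 0) := by
    have : Continuous c := by fun_prop
    have := (this.tendsto 0).mono_left (nhdsWithin_le_nhds (s := {0}ᶜ))
    simpa [c] using this
  have hp : φ.symm 0 = p := by rw [← h.centered, φ.left_inv h.mem_source]
  have hcp : Tendsto (fun t => φ.symm (c t)) (𝓝[≠] 0) (𝓝 p) := by
    have := (φ.continuousAt_symm h0).tendsto.comp hc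
    rwa [hp] at this
  refine hcp.frequently (Eventually.frequently ?_)
  filter_upwards [hc.eventually (φ.open_target.mem_nhds h0), self_mem_nhdsWithin] with t ht ht0
  rw [h.mem_singularSet_iff hf (φ.map_target ht), φ.right_inv ht, versalSecond,
    Finset.sum_eq_zero, add_zero]
  · have : (c t) 0 = t := by simp [c]
    rw [this]
    have ht0 : t ≠ 0 := ht0
    positivity
  · intro i _
    split_ifs with hi
    · have : i ≠ 0 := fun h => by subst h; simp at hi
      simp [c, this]
    · rfl

/-- The singular set is locally connected. -/
theorem exists_preconnected (h : IsNormalFormChart k f p φ ψ)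
    (hf : MDifferentiable (𝓡 n) (𝓡 (n + 1)) f) (hp : p ∈ singularSet n f) :
    ∃ V ∈ 𝓝 p, ∃ C ⊆ singularSet n f, IsPreconnected C ∧ p ∈ C ∧ V ∩ singularSet n f ⊆ C := by
  have h0 : (0 : EuclideanSpace ℝ (Fin n)) ∈ φ.target := by
    rw [← h.centered]; exact φ.map_source h.mem_source
  have hp0 : φ.symm 0 = p := by rw [← h.centered, φ.left_inv h.mem_source]
  obtain ⟨r, hr, hball⟩ := Metric.mem_nhds_iff.1 (φ.open_target.mem_nhds h0)
  let Z : Set (EuclideanSpace ℝ (Fin n)) := {X | versalSecond k X = 0} ∩ Metric.ball 0 r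
  have hZt : Z ⊆ φ.target := fun X hX => hball hX.2
  -- The weighted scaling joins each singular point of the ball to the centre without leaving the
  -- singular set or the ball.
  have hZ : IsPreconnected Z := by
    refine isPreconnected_of_forall 0 fun X hX => ?_
    obtain ⟨c, hc, hc0, hc1, hcZ⟩ := exists_scaling k X hX.1
    refine ⟨c '' Icc 0 1, ?_, ⟨0, by simp, hc0⟩, ⟨1, by simp, hc1⟩,
      isPreconnected_Icc.image c hc.continuousOn⟩
    rintro _ ⟨s, hs, rfl⟩
    refine ⟨(hcZ s hs).2, ?_⟩
    have hX2 := hX.2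
    rw [mem_ball_zero_iff] at hX2 ⊢
    exact (hcZ s hs).1.trans_lt hX2
  refine ⟨φ.source ∩ φ ⁻¹' Metric.ball 0 r, ?_, φ.symm '' Z, ?_,
    hZ.image _ (φ.symm.continuousOn.mono hZt), ?_, ?_⟩
  · refine inter_mem (φ.open_source.mem_nhds h.mem_source) ?_
    refine (φ.continuousAt h.mem_source).preimage_mem_nhds ?_
    rw [h.centered]
    exact Metric.ball_mem_nhds 0 hr
  · rintro _ ⟨X, hX, rfl⟩
    rw [h.mem_singularSet_iff hf (φ.map_target (hZt hX)), φ.right_inv (hZt hX)]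
    exact hX.1
  · refine ⟨0, ⟨?_, Metric.mem_ball_self hr⟩, hp0⟩
    rw [← h.centered]
    exact (h.mem_singularSet_iff hf h.mem_source).1 hp
  · rintro q ⟨⟨hq1, hq2⟩, hq3⟩
    exact ⟨φ q, ⟨(h.mem_singularSet_iff hf hq1).1 hq3, hq2⟩, φ.left_inv hq1⟩

variable [IsManifold (𝓡 (n + 1)) ∞ N] {g : SmoothMetric n N}

/-- The covector of a unit normal vector in a normal form chart. -/
theorem chartCovector_eq (h : IsNormalFormChart k f p φ ψ) (hk : 1 ≤ k)
    (hf : MDifferentiable (𝓡 n) (𝓡 (n + 1)) f) {q : M} (hq : q ∈ φ.source)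
    (hqs : q ∉ singularSet n f) {v : EuclideanSpace ℝ (Fin (n + 1))}
    (hv : IsUnitOrthogonal g f q v) (u : EuclideanSpace ℝ (Fin (n + 1))) :
    chartCovector g ψ (f q) v u =
      chartCovector g ψ (f q) v (EuclideanSpace.single 0 1) * versalLinear k u (φ q 0) := by
  refine conormal_normalForm hk (fun h0 => hqs ((h.mem_singularSet_iff hf hq).2 h0)) _
    (fun w => ?_) u
  rw [← (h.coordinates_eventuallyEq (φ.map_source hq)).fderiv_eq]
  exact hv.chartCovector_fderiv h.source_mem_atlas h.target_mem_atlas hq (h.mapsTo hq) (hf q) w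

/-- The inward direction in terms of the covector of the unit normal vector. -/
theorem isInward_iff (h : IsNormalFormChart k f p φ ψ) (hk : 1 ≤ k)
    (hf : MDifferentiable (𝓡 n) (𝓡 (n + 1)) f) {q : M} (hq : q ∈ φ.source)
    (hqs : q ∉ singularSet n f) {v : EuclideanSpace ℝ (Fin (n + 1))}
    (hv : IsUnitOrthogonal g f q v) :
    IsInward k φ ψ q (⟨f q, v⟩ : TangentBundle (𝓡 (n + 1)) N) ↔
      chartCovector g ψ (f q) v (EuclideanSpace.single 0 1) * versalSecond k (φ q) < 0 := by
  have hX : versalSecond k (φ q) ≠ 0 := fun h0 => hqs ((h.mem_singularSet_iff hf hq).2 h0)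
  have h1 := h.chartCovector_eq hk hf hq hqs hv (chartDeriv ψ (f q) v)
  have h2 : chartCovector g ψ (f q) v (chartDeriv ψ (f q) v) = 1 := by
    rw [chartCovector, ContinuousLinearMap.comp_apply,
      chartInvDeriv_chartDeriv h.target_mem_atlas (h.mapsTo hq)]
    exact hv.1
  rw [h2] at h1
  set c := chartCovector g ψ (f q) v (EuclideanSpace.single 0 1)
  have hw : versalLinear k (chartDeriv ψ (f q) v) (φ q 0) ≠ 0 := by
    intro h0; rw [h0, mul_zero] at h1; exact one_ne_zero h1
  have h3 := eventually_ncard_lt_iff hk hX hw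
  rw [← h.eq_normalForm q hq] at h3
  refine Iff.trans h3 ?_
  set d := versalLinear k (chartDeriv ψ (f q) v) (φ q 0)
  -- Pairing the covector of `v` with `v` itself gives `1 = c * d`. So the coefficient `c` of the
  -- conormal has the same sign as the derivative `d` of `F` in the direction `v`.
  have hcd : 0 < c * d := by rw [← h1]; exact one_pos
  constructor
  · intro h4
    by_contra h5
    have : 0 ≤ (c * versalSecond k (φ q)) * (d * d) :=
      mul_nonneg (not_lt.1 h5) (mul_self_nonneg d)
    nlinarith
  · intro h4
    by_contra h5
    have : 0 ≤ (d * versalSecond k (φ q)) * (c * c) :=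
      mul_nonneg (not_lt.1 h5) (mul_self_nonneg c)
    nlinarith

end IsNormalFormChart

end NormalFormChart

/-! ### Unit normal vectors, also at singular points -/

section Normals

variable {n : ℕ}
  {M : Type*} [TopologicalSpace M] [ChartedSpace (EuclideanSpace ℝ (Fin n)) M]
  {N : Type*} [TopologicalSpace N] [ChartedSpace (EuclideanSpace ℝ (Fin (n + 1))) N]
  [IsManifold (𝓡 (n + 1)) ∞ N] (g : SmoothMetric n N)

/-- The scalar product of two tangent vectors with the same base point. -/
def vectorInner (v w : TangentBundle (𝓡 (n + 1)) N) : ℝ := modelInner g v.proj v.snd w.snd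

theorem continuousWithinAt_vectorInner {X : Type*} [TopologicalSpace X]
    {a b : X → TangentBundle (𝓡 (n + 1)) N} {s : Set X} {x : X}
    (ha : ContinuousWithinAt a s x) (hb : ContinuousWithinAt b s x)
    (h : ∀ᶠ y in 𝓝[s] x, (a y).proj = (b y).proj) (hx : (a x).proj = (b x).proj) :
    ContinuousWithinAt (fun y => vectorInner g (a y) (b y)) s x := by
  -- `vectorInner` evaluates the metric at the base point of its first argument, so the second field
  -- must be regarded as a field over the same base map.
  have e : ∀ v w : TangentBundle (𝓡 (n + 1)) N, v.proj = w.proj →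
      (⟨v.proj, w.snd⟩ : TangentBundle (𝓡 (n + 1)) N) = w := by
    rintro ⟨y, v⟩ ⟨z, w⟩ h
    simp only at h
    subst h
    rfl
  have hb' : ContinuousWithinAt
      (fun y => (⟨(a y).proj, (b y).snd⟩ : TangentBundle (𝓡 (n + 1)) N)) s x := by
    refine hb.congr_of_eventuallyEq ?_ (e _ _ hx)
    filter_upwards [h] with y hy
    exact e _ _ hy
  have hproj : ContinuousWithinAt (fun y => (a y).proj) s x :=
    (FiberBundle.continuous_proj (EuclideanSpace ℝ (Fin (n + 1)))
      (TangentSpace (𝓡 (n + 1)) : N → Type _)).continuousAt.comp_continuousWithinAt ha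
  have hg := ContinuousAt.comp_continuousWithinAt (f := fun y => (a y).proj) (s := s) (x := x)
    (g.contMDiff.continuous.continuousAt) hproj
  have := ContinuousWithinAt.clm_bundle_apply₂ (E₃ := Bundle.Trivial N ℝ)
    (F₁ := EuclideanSpace ℝ (Fin (n + 1))) (F₂ := EuclideanSpace ℝ (Fin (n + 1))) (F₃ := ℝ)
    (E₁ := fun x : N => TangentSpace (𝓡 (n + 1)) x) (E₂ := fun x : N => TangentSpace (𝓡 (n + 1)) x)
    (b := fun y => (a y).proj) (v := fun y => (a y).snd) (w := fun y => (b y).snd) hg ha hb'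
  rw [FiberBundle.continuousWithinAt_totalSpace] at this
  exact this.2

theorem oppositeVector_oppositeVector (v : TangentBundle (𝓡 (n + 1)) N) :
    oppositeVector (oppositeVector v) = v := by
  exact congrArg (Bundle.TotalSpace.mk v.proj)
    (neg_neg (show EuclideanSpace ℝ (Fin (n + 1)) from v.snd))

theorem continuousAt_oppositeVector (v : TangentBundle (𝓡 (n + 1)) N) :
    ContinuousAt (oppositeVector : _ → TangentBundle (𝓡 (n + 1)) N) v := by
  rw [FiberBundle.continuousAt_totalSpace]
  have hproj := FiberBundle.continuous_proj (EuclideanSpace ℝ (Fin (n + 1)))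
      (TangentSpace (𝓡 (n + 1)) : N → Type _)
  refine ⟨hproj.continuousAt, ?_⟩
  have h1 := ((FiberBundle.continuousAt_totalSpace (EuclideanSpace ℝ (Fin (n + 1)))
    (id : TangentBundle (𝓡 (n + 1)) N → _)).1 (continuousAt_id (x := v))).2.neg
  refine h1.congr ?_
  set e := trivializationAt (EuclideanSpace ℝ (Fin (n + 1)))
    (TangentSpace (𝓡 (n + 1)) : N → Type _) v.proj
  have h2 : ∀ᶠ w : TangentBundle (𝓡 (n + 1)) N in 𝓝 v, w.proj ∈ e.baseSet :=
    hproj.continuousAt.eventually_mem (e.open_baseSet.mem_nhds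
      (FiberBundle.mem_baseSet_trivializationAt' v.proj))
  filter_upwards [h2] with w hw
  have h3 := (e.linear ℝ hw).map_neg w.snd
  exact h3.symm

variable {g} {f : M → N} {p : M}

theorem IsUnitOrthogonal.neg {v : EuclideanSpace ℝ (Fin (n + 1))}
    (hv : IsUnitOrthogonal g f p v) : IsUnitOrthogonal g f p (-v) := by
  rw [isUnitOrthogonal_iff] at hv ⊢
  simpa using hv

theorem IsUnitNormalAt.exists_eq {v : TangentBundle (𝓡 (n + 1)) N}
    (hv : IsUnitNormalAt g f p v) : ∃ v', IsUnitOrthogonal g f p v' ∧ v = ⟨f p, v'⟩ := by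
  obtain ⟨U, hU, ν, hν, rfl⟩ := hv
  exact ⟨ν p, hν.2 p (mem_of_mem_nhds hU), rfl⟩

theorem IsUnitNormalAt.proj_eq {v : TangentBundle (𝓡 (n + 1)) N}
    (hv : IsUnitNormalAt g f p v) : v.proj = f p := by
  obtain ⟨v', -, rfl⟩ := hv.exists_eq; rfl

theorem IsUnitNormalAt.vectorInner_self {v : TangentBundle (𝓡 (n + 1)) N}
    (hv : IsUnitNormalAt g f p v) : vectorInner g v v = 1 := by
  obtain ⟨v', h, rfl⟩ := hv.exists_eq
  exact h.1

theorem vectorInner_oppositeVector (v w : TangentBundle (𝓡 (n + 1)) N) :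
    vectorInner g v (oppositeVector w) = -vectorInner g v w := by
  exact (modelInner g v.proj v.snd).map_neg w.snd

theorem IsUnitNormalAt.ne_oppositeVector {v : TangentBundle (𝓡 (n + 1)) N}
    (hv : IsUnitNormalAt g f p v) : oppositeVector v ≠ v := by
  intro h
  have h1 := vectorInner_oppositeVector (g := g) v v
  rw [h, hv.vectorInner_self] at h1
  norm_num at h1

theorem IsUnitNormalAt.oppositeVector {v : TangentBundle (𝓡 (n + 1)) N}
    (hv : IsUnitNormalAt g f p v) : IsUnitNormalAt g f p (oppositeVector v) := by
  obtain ⟨U, hU, ν, hν, rfl⟩ := hv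
  refine ⟨U, hU, fun q => -ν q, ⟨?_, fun q hq => (hν.2 q hq).neg⟩, rfl⟩
  exact fun q hq => (continuousAt_oppositeVector _).comp_continuousWithinAt (hν.1 q hq)

theorem IsUnitNormalField.isUnitNormalAt {U : Set M}
    {ν : ∀ q : M, TangentSpace (𝓡 (n + 1)) (f q)} (hν : IsUnitNormalField g f U ν)
    (hU : U ∈ 𝓝 p) : IsUnitNormalAt g f p (fieldLift f ν p) := ⟨U, hU, ν, hν, rfl⟩

/-- Two unit vectors with scalar product `± 1` agree up to sign. -/
theorem eq_smul_of_modelInner {y : N} {v w : EuclideanSpace ℝ (Fin (n + 1))}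
    (hv : modelInner g y v v = 1) (hw : modelInner g y w w = 1)
    (h : modelInner g y v w * modelInner g y v w = 1) : w = modelInner g y v w • v := by
  by_contra hne
  -- The equality case of the Cauchy–Schwarz inequality: this vector has square length `1 - ⟨v, w⟩²
  -- = 0`.
  have h1 := modelInner_pos g y (w - modelInner g y v w • v) (sub_ne_zero.2 hne)
  simp only [map_sub, map_smul, sub_apply, smul_apply, hv, hw, modelInner_symm g y w v,
    smul_eq_mul] at h1
  nlinarith

/-- A unit normal vector is determined up to sign, also at a singular point. -/
theorem IsUnitNormalAt.eq_or_eq (hd : ∃ᶠ q in 𝓝 p, q ∉ singularSet n f)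
    {v w : TangentBundle (𝓡 (n + 1)) N}
    (hv : IsUnitNormalAt g f p v) (hw : IsUnitNormalAt g f p w) :
    w = v ∨ w = _root_.oppositeVector v := by
  obtain ⟨U, hU, ν, hν, rfl⟩ := hv
  obtain ⟨V, hV, μ, hμ, rfl⟩ := hw
  have hc : ContinuousAt (fun q => vectorInner g (fieldLift f ν q) (fieldLift f μ q)) p := by
    rw [← continuousWithinAt_univ]
    refine continuousWithinAt_vectorInner g (hν.1.continuousAt hU).continuousWithinAt
      (hμ.1.continuousAt hV).continuousWithinAt (Eventually.of_forall fun q => rfl) rfl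
  -- At regular points near `p` the two normals agree up to sign, so the square is `1` there; by
  -- continuity and density of regular points it is `1` at `p`.
  have hsq : vectorInner g (fieldLift f ν p) (fieldLift f μ p) *
      vectorInner g (fieldLift f ν p) (fieldLift f μ p) = 1 := by
    by_contra hne
    have h1 := (hc.mul hc).eventually_ne hne
    obtain ⟨q, hq, h2, h3, h4⟩ := (hd.and_eventually (h1.and (Filter.Eventually.and hU hV))).exists
    apply h2
    have hνq := hν.2 q h3
    have hμq := hμ.2 q h4
    have hone : modelInner g (f q) (ν q) (ν q) = 1 := hνq.1
    change modelInner g (f q) (ν q) (μ q) * modelInner g (f q) (ν q) (μ q) = 1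
    rcases IsUnitOrthogonal.eq_or_eq_neg hq hνq hμq with h | h
    · rw [h, hone, one_mul]
    · have : modelInner g (f q) (ν q) (μ q) = -1 := by
        rw [h]; exact ((modelInner g (f q) (ν q)).map_neg (ν q)).trans (by rw [hone])
      rw [this]; norm_num
  have h5 := eq_smul_of_modelInner (hν.2 p (mem_of_mem_nhds hU)).1
    (hμ.2 p (mem_of_mem_nhds hV)).1 hsq
  rcases mul_self_eq_one_iff.1 hsq with h | h
  · left
    have h6 : modelInner g (f p) (ν p) (μ p) = 1 := h
    rw [h6] at h5
    exact congrArg (Bundle.TotalSpace.mk (f p)) (h5.trans (one_smul ℝ _))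
  · right
    have h6 : modelInner g (f p) (ν p) (μ p) = -1 := h
    rw [h6] at h5
    exact congrArg (Bundle.TotalSpace.mk (f p)) (h5.trans (neg_one_smul ℝ _))

theorem IsAFront.contMDiff [NeZero n] (hf : IsAFront g f) : ContMDiff (𝓡 n) (𝓡 (n + 1)) ∞ f :=
  hf.1.1

theorem IsAFront.mdifferentiable [NeZero n] (hf : IsAFront g f) :
    MDifferentiable (𝓡 n) (𝓡 (n + 1)) f := hf.1.1.mdifferentiable (by simp)

theorem IsAFront.frequently_notMem [NeZero n] (hf : IsAFront g f) (p : M) :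
    ∃ᶠ q in 𝓝 p, q ∉ singularSet n f := by
  by_cases hp : p ∈ singularSet n f
  · obtain ⟨k, -, -, φ, ψ, h⟩ := hf.2 p hp
    exact h.frequently_notMem_singularSet hf.mdifferentiable
  · exact fun h => hp (not_not.1 h.self_of_nhds)

theorem IsAFront.eq_or_eq [NeZero n] (hf : IsAFront g f) {v w : TangentBundle (𝓡 (n + 1)) N}
    (hv : IsUnitNormalAt g f p v) (hw : IsUnitNormalAt g f p w) :
    w = v ∨ w = _root_.oppositeVector v := hv.eq_or_eq (hf.frequently_notMem p) hw

end Normals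

/-! ### The double covering of unit normal vectors of a family -/

section DeformationNormals

variable {n : ℕ} [NeZero n]
  {M : Type*} [TopologicalSpace M] [ChartedSpace (EuclideanSpace ℝ (Fin n)) M]
  {N : Type*} [TopologicalSpace N] [ChartedSpace (EuclideanSpace ℝ (Fin (n + 1))) N]
  [IsManifold (𝓡 (n + 1)) ∞ N] (g : SmoothMetric n N)

/-- Near `y`, and hence at `y`, the vector field `ν` along the family `F` is smooth, and `ν` is a
unit normal vector at `y`. -/
def IsSmoothNormal (F : ℝ → M → N) (ν : ∀ (r : ℝ) (q : M), TangentSpace (𝓡 (n + 1)) (F r q))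
    (y : unitInterval × M) : Prop :=
  ContMDiffWithinAt (𝓘(ℝ, ℝ).prod (𝓡 n)) (𝓡 (n + 1)).tangent ∞
    (fun x : ℝ × M => fieldLift (F x.1) (ν x.1) x.2) (Icc 0 1 ×ˢ univ) ((y.1 : ℝ), y.2) ∧
  IsUnitOrthogonal g (F y.1) y.2 (ν y.1 y.2)

variable {g} {F : ℝ → M → N}

theorem continuous_unitInterval_prod :
    Continuous (fun y : unitInterval × M => ((y.1 : ℝ), y.2)) := by fun_prop

theorem tendsto_nhdsWithin_unitInterval (y : unitInterval × M) :
    Tendsto (fun y : unitInterval × M => ((y.1 : ℝ), y.2)) (𝓝 y)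
      (𝓝[Icc 0 1 ×ˢ univ] ((y.1 : ℝ), y.2)) :=
  tendsto_nhdsWithin_iff.2 ⟨continuous_unitInterval_prod.continuousAt,
    Eventually.of_forall fun y => ⟨y.1.2, mem_univ _⟩⟩

theorem IsSmoothNormal.continuousAt {ν : ∀ (r : ℝ) (q : M), TangentSpace (𝓡 (n + 1)) (F r q)}
    {y : unitInterval × M} (h : IsSmoothNormal g F ν y) :
    ContinuousAt (fun y : unitInterval × M => fieldLift (F y.1) (ν y.1) y.2) y :=
  Tendsto.comp h.1.continuousWithinAt (tendsto_nhdsWithin_unitInterval y)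

theorem isUnitNormalAt_of_eventually
    {ν : ∀ (r : ℝ) (q : M), TangentSpace (𝓡 (n + 1)) (F r q)}
    {y : unitInterval × M} (h : ∀ᶠ y' in 𝓝 y, IsSmoothNormal g F ν y') :
    IsUnitNormalAt g (F y.1) y.2 (fieldLift (F y.1) (ν y.1) y.2) := by
  have hc : Continuous (fun q : M => (y.1, q)) := by fun_prop
  have h1 : ∀ᶠ q in 𝓝 y.2, IsSmoothNormal g F ν (y.1, q) := hc.continuousAt.eventually h
  refine ⟨{q | IsSmoothNormal g F ν (y.1, q)}, h1, ν y.1, ⟨fun q hq => ?_, fun q hq => hq.2⟩, rfl⟩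
  have h2 := hq.continuousAt
  have h3 : ContinuousAt (fun q : M => fieldLift (F y.1) (ν y.1) q) q :=
    ContinuousAt.comp (f := fun q : M => (y.1, q)) h2 hc.continuousAt
  exact h3.continuousWithinAt

theorem IsAFrontDeformation.exists_isSmoothNormal (hF : IsAFrontDeformation g F)
    (y : unitInterval × M) :
    ∃ ν : ∀ (r : ℝ) (q : M), TangentSpace (𝓡 (n + 1)) (F r q),
      ∀ᶠ y' in 𝓝 y, IsSmoothNormal g F ν y' := by
  obtain ⟨U, hU, ν, h1, h2⟩ := hF.normal y.1 y.1.2 y.2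
  refine ⟨ν, ?_⟩
  have h3 : ∀ᶠ y' : unitInterval × M in 𝓝 y, U ∈ 𝓝 ((y'.1 : ℝ), y'.2) :=
    continuous_unitInterval_prod.continuousAt.eventually (eventually_mem_nhds_iff.2 hU)
  filter_upwards [h3] with y' hy'
  have h4 : ((y'.1 : ℝ), y'.2) ∈ U ∩ Icc 0 1 ×ˢ univ :=
    ⟨mem_of_mem_nhds hy', y'.1.2, mem_univ _⟩
  refine ⟨?_, h2 _ h4⟩
  have h5 := h1 _ h4
  rwa [inter_comm, contMDiffWithinAt_inter hy'] at h5

/-- Through constant families, homotopies of loops on one front are handled by the same square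
argument as deformations. -/
theorem IsAFront.isAFrontDeformation {f : M → N} (hf : IsAFront g f) :
    IsAFrontDeformation g (fun _ => f) := by
  refine ⟨(hf.contMDiff.comp contMDiff_snd).contMDiffOn, fun s hs p => ?_, fun _ _ => hf⟩
  obtain ⟨U, hU, hp, ν, h1, h2, -⟩ := hf.1.2 p
  refine ⟨univ ×ˢ U, prod_mem_nhds univ_mem (hU.mem_nhds hp), fun _ => ν, ?_, ?_⟩
  · exact h1.comp (contMDiff_snd.contMDiffOn) fun x hx => hx.1.2
  · exact fun x hx => h2 _ hx.1.2

/-- Two continuous unit normal vector fields over a connected set that agree at a point agree. -/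
theorem eqOn_of_isUnitNormalAt {X : Type*} [TopologicalSpace X] {S : Set X}
    (hS : IsPreconnected S) {f : X → M → N} {p : X → M} {a b : X → TangentBundle (𝓡 (n + 1)) N}
    (hf : ∀ x ∈ S, IsAFront g (f x)) (ha : ContinuousOn a S) (hb : ContinuousOn b S)
    (ha' : ∀ x ∈ S, IsUnitNormalAt g (f x) (p x) (a x))
    (hb' : ∀ x ∈ S, IsUnitNormalAt g (f x) (p x) (b x)) {x₀ : X} (hx₀ : x₀ ∈ S)
    (h : a x₀ = b x₀) : EqOn a b S := by
  -- The scalar product of the two fields is continuous and takes only the values `±1`.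
  have hc : ContinuousOn (fun x => vectorInner g (a x) (b x)) S := fun x hx =>
    continuousWithinAt_vectorInner g (ha x hx) (hb x hx)
      (eventually_mem_nhdsWithin.mono fun y hy => (ha' y hy).proj_eq.trans (hb' y hy).proj_eq.symm)
      ((ha' x hx).proj_eq.trans (hb' x hx).proj_eq.symm)
  have key : ∀ x ∈ S, vectorInner g (a x) (b x) = 1 ∧ b x = a x ∨
      vectorInner g (a x) (b x) = -1 := by
    intro x hx
    rcases (hf x hx).eq_or_eq (ha' x hx) (hb' x hx) with h | h
    · left; rw [h]; exact ⟨(ha' x hx).vectorInner_self, rfl⟩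
    · right; rw [h, vectorInner_oppositeVector, (ha' x hx).vectorInner_self]
  have hS' := hS.image _ hc
  intro x hx
  rcases key x hx with h1 | h1
  · exact h1.2.symm
  · exfalso
    have h2 : vectorInner g (a x₀) (b x₀) = 1 := by
      rw [← h]; exact (ha' x₀ hx₀).vectorInner_self
    have h3 := hS'.ordConnected.out (mem_image_of_mem _ hx) (mem_image_of_mem _ hx₀)
    simp only [h1, h2] at h3
    obtain ⟨z, hz, hz'⟩ := h3 (show (0 : ℝ) ∈ Icc (-1) 1 by norm_num)
    simp only at hz'
    rcases key z hz with h4 | h4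
    · rw [h4.1] at hz'; norm_num at hz'
    · rw [h4] at hz'; norm_num at hz'

/-- The unit normal vectors of the fronts of a family. -/
def NormalVectors (g : SmoothMetric n N) (F : ℝ → M → N) : Type _ :=
  {x : (unitInterval × M) × TangentBundle (𝓡 (n + 1)) N //
    IsUnitNormalAt g (F x.1.1) x.1.2 x.2}

instance : TopologicalSpace (NormalVectors g F) := instTopologicalSpaceSubtype

/-- A local smooth normal field trivializes the space of normals: over its domain each fibre
consists of its value and the opposite vector. The sign of the scalar product with it tells the two
sheets apart continuously. -/
theorem IsAFrontDeformation.isCoveringMap (hF : IsAFrontDeformation g F) :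
    IsCoveringMap (fun x : NormalVectors g F => x.1.1) := by
  intro y₀
  suffices h : IsEvenlyCovered (fun x : NormalVectors g F => x.1.1) y₀ Bool from
    h.to_isEvenlyCovered_preimage
  obtain ⟨ν, hν⟩ := hF.exists_isSmoothNormal y₀
  obtain ⟨U, hU, hUo, hyU⟩ := eventually_nhds_iff.1 hν
  have hn : ∀ y ∈ U, ∀ᶠ y' in 𝓝 y, IsSmoothNormal g F ν y' := fun y hy =>
    Filter.Eventually.mono (hUo.mem_nhds hy) hU
  set a : unitInterval × M → TangentBundle (𝓡 (n + 1)) N :=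
    fun y => fieldLift (F y.1) (ν y.1) y.2 with ha
  have ha1 : ∀ y ∈ U, IsUnitNormalAt g (F y.1) y.2 (a y) := fun y hy =>
    isUnitNormalAt_of_eventually (hn y hy)
  have ha2 : ∀ y ∈ U, ContinuousAt a y := fun y hy => (hU y hy).continuousAt
  set π : NormalVectors g F → unitInterval × M := fun x => x.1.1 with hπ
  have hπc : Continuous π := continuous_fst.comp continuous_subtype_val
  have hvc : Continuous (fun x : NormalVectors g F => x.1.2) :=
    continuous_snd.comp continuous_subtype_val
  have hIc : ∀ x : NormalVectors g F, π x ∈ U →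
      ContinuousAt (fun x : NormalVectors g F => vectorInner g (a (π x)) x.1.2) x := by
    intro x hx
    rw [← continuousWithinAt_univ]
    refine continuousWithinAt_vectorInner g ?_ hvc.continuousAt.continuousWithinAt ?_ ?_
    · exact (ContinuousAt.comp (f := π) (ha2 _ hx) hπc.continuousAt).continuousWithinAt
    · rw [nhdsWithin_univ]
      exact (hπc.continuousAt.eventually_mem (hUo.mem_nhds hx)).mono fun z hz =>
        (ha1 _ hz).proj_eq.trans z.2.proj_eq.symm
    · exact (ha1 _ hx).proj_eq.trans x.2.proj_eq.symm
  have hcase : ∀ x : NormalVectors g F, π x ∈ U →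
      (0 < vectorInner g (a (π x)) x.1.2 ∧ x.1.2 = a (π x)) ∨
      (vectorInner g (a (π x)) x.1.2 < 0 ∧ x.1.2 = oppositeVector (a (π x))) := by
    intro x hx
    rcases (hF.isAFront x.1.1.1 x.1.1.1.2).eq_or_eq (ha1 _ hx) x.2 with h | h
    · left; refine ⟨?_, h⟩; rw [h]; rw [(ha1 _ hx).vectorInner_self]; norm_num
    · right; refine ⟨?_, h⟩
      rw [h]; rw [vectorInner_oppositeVector, (ha1 _ hx).vectorInner_self]; norm_num
  refine ⟨inferInstance, U, hyU, hUo, hUo.preimage hπc, ?_, ?_⟩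
  · exact
    { toFun := fun x => (⟨π x, x.2⟩, decide (0 < vectorInner g (a (π x)) x.1.1.2))
      invFun := fun z => ⟨⟨(z.1.1, if z.2 then a z.1.1 else oppositeVector (a z.1.1)), by
        rcases z with ⟨z, b⟩
        cases b
        · exact (ha1 _ z.2).oppositeVector
        · exact ha1 _ z.2⟩, z.1.2⟩
      left_inv := by
        rintro ⟨x, hx⟩
        apply Subtype.ext
        apply Subtype.ext
        refine Prod.ext rfl ?_
        rcases hcase x hx with h | h
        · simp only [h.1, decide_true, if_true]; exact h.2.symm
        · simp only [h.1.not_gt, decide_false]; exact h.2.symm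
      right_inv := by
        rintro ⟨⟨y, hy⟩, b⟩
        refine Prod.ext rfl ?_
        cases b
        · have : ¬ 0 < vectorInner g (a y) (oppositeVector (a y)) := by
            rw [vectorInner_oppositeVector, (ha1 _ hy).vectorInner_self]; norm_num
          simpa [hπ] using this
        · have : 0 < vectorInner g (a y) (a y) := by
            rw [(ha1 _ hy).vectorInner_self]; norm_num
          simpa [hπ] using this
      continuous_toFun := by
        refine Continuous.prodMk ((hπc.comp continuous_subtype_val).subtype_mk _) ?_
        rw [continuous_iff_continuousAt]
        rintro ⟨x, hx⟩
        have h1 : ContinuousAt (fun x : π ⁻¹' U => vectorInner g (a (π x)) x.1.1.2) ⟨x, hx⟩ :=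
          ContinuousAt.comp (f := fun x : π ⁻¹' U => x.1)
            (g := fun x : NormalVectors g F => vectorInner g (a (π x)) x.1.2)
            (x := ⟨x, hx⟩) (hIc x hx) continuous_subtype_val.continuousAt
        refine (continuousAt_const (y := decide (0 < vectorInner g (a (π x)) x.1.2))).congr ?_
        rcases hcase x hx with h | h
        · filter_upwards [h1.eventually (lt_mem_nhds h.1)]
            with z hz
          simp [h.1, hz]
        · filter_upwards [h1.eventually (gt_mem_nhds h.1)] with z hz
          simp [h.1.not_gt, not_lt.2 (le_of_lt hz)]
      continuous_invFun := by
        refine Continuous.subtype_mk (Continuous.subtype_mk ?_ _) _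
        refine Continuous.prodMk (by fun_prop) ?_
        rw [continuous_iff_continuousAt]
        rintro ⟨⟨y, hy⟩, b⟩
        have h1 : ContinuousAt (fun z : U × Bool => a z.1.1) (⟨y, hy⟩, b) :=
          ContinuousAt.comp (f := fun z : U × Bool => z.1.1) (x := (⟨y, hy⟩, b)) (ha2 y hy)
            (continuous_subtype_val.comp continuous_fst).continuousAt
        have h2 : ∀ᶠ z : U × Bool in 𝓝 (⟨y, hy⟩, b), z.2 = b :=
          (continuous_snd (X := U) (Y := Bool)).continuousAt.eventually_mem
            ((isOpen_discrete {b}).mem_nhds (mem_singleton b))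
        cases b
        · refine ContinuousAt.congr
            (ContinuousAt.comp (continuousAt_oppositeVector (a y)) h1) ?_
          filter_upwards [h2] with z hz
          simp [hz]
        · refine h1.congr ?_
          filter_upwards [h2] with z hz
          simp [hz] }
  · intro x; rfl

/-- Lifting of squares to the double covering of unit normal vectors. -/
theorem IsAFrontDeformation.exists_lift (hF : IsAFrontDeformation g F)
    {c : ℝ × ℝ → unitInterval × M} (hc : Continuous c) (x₀ : ℝ × ℝ)
    {v : TangentBundle (𝓡 (n + 1)) N} (hv : IsUnitNormalAt g (F (c x₀).1) (c x₀).2 v) :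
    ∃ G : ℝ × ℝ → TangentBundle (𝓡 (n + 1)) N, Continuous G ∧ G x₀ = v ∧
      ∀ x, IsUnitNormalAt g (F (c x).1) (c x).2 (G x) := by
  -- The plane is simply connected, so `c` lifts with any prescribed value at `x₀`.
  obtain ⟨G, ⟨h1, h2⟩, -⟩ := hF.isCoveringMap.existsUnique_continuousMap_lifts ⟨c, hc⟩ x₀
    ⟨(c x₀, v), hv⟩ rfl
  refine ⟨fun x => (G x).1.2, continuous_snd.comp (continuous_subtype_val.comp G.continuous), ?_, ?_⟩
  · simp only [h1]
  · intro x
    have h3 := congrFun h2 x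
    have h4 := (G x).2
    simp only [Function.comp_apply, ContinuousMap.coe_mk] at h3
    rwa [h3] at h4

end DeformationNormals

/-! ### Smoothness of the family and of its conormal in charts -/

section Coordinates

variable {n : ℕ} [NeZero n]
  {M : Type*} [TopologicalSpace M] [ChartedSpace (EuclideanSpace ℝ (Fin n)) M]
  {N : Type*} [TopologicalSpace N] [ChartedSpace (EuclideanSpace ℝ (Fin (n + 1))) N]
  [IsManifold (𝓡 (n + 1)) ∞ N] (g : SmoothMetric n N)

theorem contDiffWithinAt_of_clm_apply {D E G : Type*} [NormedAddCommGroup D] [NormedSpace ℝ D]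
    [NormedAddCommGroup E] [NormedSpace ℝ E] [FiniteDimensional ℝ E] [NormedAddCommGroup G]
    [NormedSpace ℝ G] {m : WithTop ℕ∞} {f : D → E →L[ℝ] G} {s : Set D} {x : D}
    (h : ∀ v, ContDiffWithinAt ℝ m (fun x => f x v) s x) : ContDiffWithinAt ℝ m f s x := by
  have hd : Module.finrank ℝ E = Module.finrank ℝ (Fin (Module.finrank ℝ E) → ℝ) :=
    (Module.finrank_fin_fun ℝ).symm
  let e₁ := ContinuousLinearEquiv.ofFinrankEq hd
  let e₂ := (e₁.arrowCongr (1 : G ≃L[ℝ] G)).trans (ContinuousLinearEquiv.piRing (Fin _))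
  rw [← Function.id_comp f, ← e₂.symm_comp_self]
  exact e₂.symm.contDiff.comp_contDiffWithinAt (contDiffWithinAt_pi.mpr fun i => h _)

theorem contMDiffAt_chartInvDeriv {ψ : OpenPartialHomeomorph N (EuclideanSpace ℝ (Fin (n + 1)))}
    (hψ : ψ ∈ IsManifold.maximalAtlas (𝓡 (n + 1)) ∞ N) (v : EuclideanSpace ℝ (Fin (n + 1)))
    {X : EuclideanSpace ℝ (Fin (n + 1))} (hX : X ∈ ψ.target) :
    ContMDiffAt (𝓡 (n + 1)) (𝓡 (n + 1)).tangent ∞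
      (fun X => (⟨ψ.symm X, chartInvDeriv ψ X v⟩ : TangentBundle (𝓡 (n + 1)) N)) X := by
  have h1 : ContMDiffAt (𝓡 (n + 1)) (𝓡 (n + 1)).tangent ∞
      (fun X => (⟨X, v⟩ : TangentBundle (𝓡 (n + 1)) (EuclideanSpace ℝ (Fin (n + 1))))) X :=
    contMDiffAt_vectorSpace_iff_contDiffAt.2 contDiffAt_const
  have h2 := (contMDiffOn_symm_of_mem_maximalAtlas hψ).contMDiffOn_tangentMapWithin
    (m := ∞) (by simp) ψ.open_target.uniqueMDiffOn
  have h3 : ContMDiffAt (𝓡 (n + 1)).tangent (𝓡 (n + 1)).tangent ∞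
      (tangentMapWithin (𝓡 (n + 1)) (𝓡 (n + 1)) ψ.symm ψ.target)
      (⟨X, v⟩ : TangentBundle (𝓡 (n + 1)) (EuclideanSpace ℝ (Fin (n + 1)))) := by
    refine (h2 _ hX).contMDiffAt ?_
    exact (FiberBundle.continuous_proj (EuclideanSpace ℝ (Fin (n + 1)))
      (TangentSpace (𝓡 (n + 1)) : (EuclideanSpace ℝ (Fin (n + 1))) → Type _)).continuousAt
      (ψ.open_target.mem_nhds hX)
  refine (h3.comp X h1).congr_of_eventuallyEq ?_
  filter_upwards [ψ.open_target.mem_nhds hX] with Z hZ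
  simp only [Function.comp_apply, tangentMapWithin, chartInvDeriv,
    mfderivWithin_of_isOpen ψ.open_target hZ]
  rfl

/-- The coordinate expression of a family of maps. -/
def coordMap (F : ℝ → M → N) (φ : OpenPartialHomeomorph M (EuclideanSpace ℝ (Fin n)))
    (ψ : OpenPartialHomeomorph N (EuclideanSpace ℝ (Fin (n + 1))))
    (x : ℝ × EuclideanSpace ℝ (Fin n)) : EuclideanSpace ℝ (Fin (n + 1)) :=
  ψ (F x.1 (φ.symm x.2))

/-- The coordinate expression of a family of vector fields, as covectors. -/
def coordConormal (F : ℝ → M → N) (ν : ∀ (r : ℝ) (q : M), TangentSpace (𝓡 (n + 1)) (F r q))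
    (φ : OpenPartialHomeomorph M (EuclideanSpace ℝ (Fin n)))
    (ψ : OpenPartialHomeomorph N (EuclideanSpace ℝ (Fin (n + 1))))
    (x : ℝ × EuclideanSpace ℝ (Fin n)) : EuclideanSpace ℝ (Fin (n + 1)) →L[ℝ] ℝ :=
  chartCovector g ψ (F x.1 (φ.symm x.2)) (ν x.1 (φ.symm x.2))

variable {g} {F : ℝ → M → N} {φ : OpenPartialHomeomorph M (EuclideanSpace ℝ (Fin n))}
  {ψ : OpenPartialHomeomorph N (EuclideanSpace ℝ (Fin (n + 1)))}

theorem contMDiffAt_prodMap_symm (hφ : φ ∈ IsManifold.maximalAtlas (𝓡 n) ∞ M)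
    {x : ℝ × EuclideanSpace ℝ (Fin n)} (hx : x.2 ∈ φ.target) :
    ContMDiffAt 𝓘(ℝ, ℝ × EuclideanSpace ℝ (Fin n)) (𝓘(ℝ, ℝ).prod (𝓡 n)) ∞
      (fun x : ℝ × EuclideanSpace ℝ (Fin n) => (x.1, φ.symm x.2)) x := by
  refine ContMDiffAt.prodMk contDiff_fst.contMDiff.contMDiffAt ?_
  exact ContMDiffAt.comp (I' := 𝓡 n) x ((contMDiffOn_symm_of_mem_maximalAtlas hφ).contMDiffAt
    (φ.open_target.mem_nhds hx)) contDiff_snd.contMDiff.contMDiffAt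

theorem comp_prodMap_symm {H : Type*} {EH : Type*} [NormedAddCommGroup EH] [NormedSpace ℝ EH]
    [TopologicalSpace H] {IH : ModelWithCorners ℝ EH H} {P : Type*} [TopologicalSpace P]
    [ChartedSpace H P] (hφ : φ ∈ IsManifold.maximalAtlas (𝓡 n) ∞ M) {f : ℝ × M → P}
    {x : ℝ × EuclideanSpace ℝ (Fin n)} (hx : x.2 ∈ φ.target)
    (hf : ContMDiffWithinAt (𝓘(ℝ, ℝ).prod (𝓡 n)) IH ∞ f (Icc 0 1 ×ˢ univ) (x.1, φ.symm x.2)) :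
    ContMDiffWithinAt 𝓘(ℝ, ℝ × EuclideanSpace ℝ (Fin n)) IH ∞
      (fun x : ℝ × EuclideanSpace ℝ (Fin n) => f (x.1, φ.symm x.2)) (Icc 0 1 ×ˢ univ) x :=
  ContMDiffWithinAt.comp (g := f) x hf (contMDiffAt_prodMap_symm hφ hx).contMDiffWithinAt
    fun _ hx => ⟨hx.1, mem_univ _⟩

theorem contDiffWithinAt_coordMap (hφ : φ ∈ IsManifold.maximalAtlas (𝓡 n) ∞ M)
    (hψ : ψ ∈ IsManifold.maximalAtlas (𝓡 (n + 1)) ∞ N)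
    {x : ℝ × EuclideanSpace ℝ (Fin n)} (hx : x.2 ∈ φ.target)
    (hF : ContMDiffWithinAt (𝓘(ℝ, ℝ).prod (𝓡 n)) (𝓡 (n + 1)) ∞ (fun x : ℝ × M => F x.1 x.2)
      (Icc 0 1 ×ˢ univ) (x.1, φ.symm x.2))
    (hy : F x.1 (φ.symm x.2) ∈ ψ.source) :
    ContDiffWithinAt ℝ ∞ (coordMap F φ ψ) (Icc 0 1 ×ˢ univ) x := by
  rw [← contMDiffWithinAt_iff_contDiffWithinAt]
  exact ContMDiffAt.comp_contMDiffWithinAt (g := ψ) x ((contMDiffOn_of_mem_maximalAtlas hψ).contMDiffAt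
    (ψ.open_source.mem_nhds hy)) (comp_prodMap_symm hφ hx hF)

theorem contDiffWithinAt_coordConormal
    {ν : ∀ (r : ℝ) (q : M), TangentSpace (𝓡 (n + 1)) (F r q)}
    (hφ : φ ∈ IsManifold.maximalAtlas (𝓡 n) ∞ M)
    (hψ : ψ ∈ IsManifold.maximalAtlas (𝓡 (n + 1)) ∞ N)
    {x : ℝ × EuclideanSpace ℝ (Fin n)} (hx : x.2 ∈ φ.target)
    (hF : ContMDiffWithinAt (𝓘(ℝ, ℝ).prod (𝓡 n)) (𝓡 (n + 1)) ∞ (fun x : ℝ × M => F x.1 x.2)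
      (Icc 0 1 ×ˢ univ) (x.1, φ.symm x.2))
    (hν : ContMDiffWithinAt (𝓘(ℝ, ℝ).prod (𝓡 n)) (𝓡 (n + 1)).tangent ∞
      (fun x : ℝ × M => fieldLift (F x.1) (ν x.1) x.2) (Icc 0 1 ×ˢ univ) (x.1, φ.symm x.2))
    (hy : F x.1 (φ.symm x.2) ∈ ψ.source) :
    ContDiffWithinAt ℝ ∞ (coordConormal g F ν φ ψ) (Icc 0 1 ×ˢ univ) x := by
  refine contDiffWithinAt_of_clm_apply fun v => ?_
  have hF' := comp_prodMap_symm hφ hx hF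
  have hν' := comp_prodMap_symm hφ hx hν
  -- The vector field that is constantly `v` in the chart `ψ`, taken along the family. The conormal
  -- applied to `v` is its metric pairing with `ν`, a pairing of smooth sections over one base map.
  have hw : ContMDiffWithinAt 𝓘(ℝ, ℝ × EuclideanSpace ℝ (Fin n)) (𝓡 (n + 1)).tangent ∞
      (fun x : ℝ × EuclideanSpace ℝ (Fin n) => (⟨F x.1 (φ.symm x.2),
        chartInvDeriv ψ (ψ (F x.1 (φ.symm x.2))) v⟩ : TangentBundle (𝓡 (n + 1)) N))
      (Icc 0 1 ×ˢ univ) x := by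
    have h1 := ContMDiffAt.comp_contMDiffWithinAt (f := coordMap F φ ψ) x
      (contMDiffAt_chartInvDeriv hψ v (ψ.map_source hy))
      (contDiffWithinAt_coordMap hφ hψ hx hF hy).contMDiffWithinAt
    have h2 : ∀ z : ℝ × EuclideanSpace ℝ (Fin n), F z.1 (φ.symm z.2) ∈ ψ.source →
        (⟨F z.1 (φ.symm z.2), chartInvDeriv ψ (ψ (F z.1 (φ.symm z.2))) v⟩ :
          TangentBundle (𝓡 (n + 1)) N) =
        ⟨ψ.symm (coordMap F φ ψ z), chartInvDeriv ψ (coordMap F φ ψ z) v⟩ := by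
      intro z hz
      have h3 : ψ.symm (coordMap F φ ψ z) = F z.1 (φ.symm z.2) := ψ.left_inv hz
      rw [h3]; rfl
    refine h1.congr_of_eventuallyEq ?_ (h2 x hy)
    filter_upwards [hF'.continuousWithinAt.eventually_mem (ψ.open_source.mem_nhds hy)] with z hz
    exact h2 z hz
  have hg := (g.contMDiff.contMDiffAt (x := F x.1 (φ.symm x.2))).comp_contMDiffWithinAt
    (f := fun x : ℝ × EuclideanSpace ℝ (Fin n) => F x.1 (φ.symm x.2)) x hF'
  have := ContMDiffWithinAt.clm_bundle_apply₂ (E₃ := Bundle.Trivial N ℝ)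
    (F₁ := EuclideanSpace ℝ (Fin (n + 1))) (F₂ := EuclideanSpace ℝ (Fin (n + 1))) (F₃ := ℝ)
    (E₁ := fun x : N => TangentSpace (𝓡 (n + 1)) x) (E₂ := fun x : N => TangentSpace (𝓡 (n + 1)) x)
    (b := fun x : ℝ × EuclideanSpace ℝ (Fin n) => F x.1 (φ.symm x.2))
    (v := fun x => ν x.1 (φ.symm x.2))
    (w := fun x => chartInvDeriv ψ (ψ (F x.1 (φ.symm x.2))) v) hg hν' hw
  rw [Bundle.contMDiffWithinAt_totalSpace] at this
  exact contMDiffWithinAt_iff_contDiffWithinAt.1 this.2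

end Coordinates

/-! ### Partial derivatives in the space variable -/

section PartialDerivative

variable {E G : Type*} [NormedAddCommGroup E] [NormedSpace ℝ E] [NormedAddCommGroup G]
  [NormedSpace ℝ G] {h : ℝ × E → G} {x : ℝ × E}

theorem contDiffAt_slice (hh : ContDiffWithinAt ℝ ∞ h (Icc 0 1 ×ˢ univ) x)
    (hx : x.1 ∈ Icc (0 : ℝ) 1) : ContDiffAt ℝ ∞ (fun X => h (x.1, X)) x.2 := by
  rw [← contDiffWithinAt_univ]
  exact ContDiffWithinAt.comp (g := h) (f := fun X : E => (x.1, X)) x.2 hh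
    (by fun_prop) fun X _ => ⟨hx, mem_univ _⟩

/-- The partial derivative is the full derivative within the strip composed with the inclusion of
the space directions. Derivatives within the strip are unique also at the end parameters `0` and
`1`. -/
theorem continuousWithinAt_fderiv_slice (hh : ContDiffWithinAt ℝ ∞ h (Icc 0 1 ×ˢ univ) x)
    (hx : x.1 ∈ Icc (0 : ℝ) 1) :
    ContinuousWithinAt (fun z : ℝ × E => fderiv ℝ (fun X => h (z.1, X)) z.2)
      (Icc 0 1 ×ˢ univ) x := by
  have hu : UniqueDiffOn ℝ (Icc (0 : ℝ) 1 ×ˢ (univ : Set E)) :=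
    (uniqueDiffOn_Icc one_pos).prod uniqueDiffOn_univ
  have hx' : x ∈ Icc (0 : ℝ) 1 ×ˢ (univ : Set E) := ⟨hx, mem_univ _⟩
  have h1 : ContinuousWithinAt (fderivWithin ℝ h (Icc 0 1 ×ˢ univ)) (Icc 0 1 ×ˢ univ) x :=
    (hh.fderivWithin_right (m := 0) hu (by simp) hx').continuousWithinAt
  have h2 : ContinuousWithinAt (fun z => (fderivWithin ℝ h (Icc 0 1 ×ˢ univ) z).comp
      (ContinuousLinearMap.inr ℝ ℝ E)) (Icc 0 1 ×ˢ univ) x := h1.clm_comp continuousWithinAt_const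
  have h3 : ∀ z ∈ Icc (0 : ℝ) 1 ×ˢ (univ : Set E), ContDiffWithinAt ℝ 1 h (Icc 0 1 ×ˢ univ) z →
      fderiv ℝ (fun X => h (z.1, X)) z.2 = (fderivWithin ℝ h (Icc 0 1 ×ˢ univ) z).comp
        (ContinuousLinearMap.inr ℝ ℝ E) := by
    intro z hz hd
    have h4 := (hd.differentiableWithinAt (by simp)).hasFDerivWithinAt
    have h5 : HasFDerivAt (fun X : E => (z.1, X)) (ContinuousLinearMap.inr ℝ ℝ E) z.2 :=
      hasFDerivAt_prodMk_right z.1 z.2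
    have h6 : ∀ᶠ X : E in 𝓝 z.2, (z.1, X) ∈ Icc (0 : ℝ) 1 ×ˢ (univ : Set E) :=
      Eventually.of_forall fun X => ⟨hz.1, mem_univ _⟩
    exact (HasFDerivWithinAt.comp_hasFDerivAt (g := h) (f := fun X : E => (z.1, X)) z.2 h4 h5
      h6).fderiv
  refine h2.congr_of_eventuallyEq ?_ (h3 x hx' (hh.of_le (by simp)))
  have h6 := (hh.of_le (show (1 : WithTop ℕ∞) ≤ ∞ by simp)).eventually (by simp)
  rw [insert_eq_of_mem hx'] at h6
  filter_upwards [h6, self_mem_nhdsWithin] with z hz1 hz2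
  exact h3 z hz2 hz1

end PartialDerivative

/-! ### First and second order data of the family in charts -/

section Sheets

variable {n : ℕ} [NeZero n]
  {M : Type*} [TopologicalSpace M] [ChartedSpace (EuclideanSpace ℝ (Fin n)) M]
  {N : Type*} [TopologicalSpace N] [ChartedSpace (EuclideanSpace ℝ (Fin (n + 1))) N]
  [IsManifold (𝓡 (n + 1)) ∞ N]

/-- The derivative of the family in charts. -/
def dMap (F : ℝ → M → N) (φ : OpenPartialHomeomorph M (EuclideanSpace ℝ (Fin n)))
    (ψ : OpenPartialHomeomorph N (EuclideanSpace ℝ (Fin (n + 1)))) (y : unitInterval × M) :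
    EuclideanSpace ℝ (Fin n) →L[ℝ] EuclideanSpace ℝ (Fin (n + 1)) :=
  fderiv ℝ (fun X => coordMap F φ ψ (y.1, X)) (φ y.2)

/-- The conormal covector in charts. -/
def conormal (g : SmoothMetric n N) (F : ℝ → M → N)
    (ν : ∀ (r : ℝ) (q : M), TangentSpace (𝓡 (n + 1)) (F r q))
    (φ : OpenPartialHomeomorph M (EuclideanSpace ℝ (Fin n)))
    (ψ : OpenPartialHomeomorph N (EuclideanSpace ℝ (Fin (n + 1)))) (y : unitInterval × M) :
    EuclideanSpace ℝ (Fin (n + 1)) →L[ℝ] ℝ :=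
  coordConormal g F ν φ ψ (y.1, φ y.2)

/-- The derivative of the conormal covector in charts. -/
def dConormal (g : SmoothMetric n N) (F : ℝ → M → N)
    (ν : ∀ (r : ℝ) (q : M), TangentSpace (𝓡 (n + 1)) (F r q))
    (φ : OpenPartialHomeomorph M (EuclideanSpace ℝ (Fin n)))
    (ψ : OpenPartialHomeomorph N (EuclideanSpace ℝ (Fin (n + 1)))) (y : unitInterval × M) :
    EuclideanSpace ℝ (Fin n) →L[ℝ] EuclideanSpace ℝ (Fin (n + 1)) →L[ℝ] ℝ :=
  fderiv ℝ (fun X => coordConormal g F ν φ ψ (y.1, X)) (φ y.2)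

/-- The charts `φ`, `ψ` contain `y` and its image, and `ν` is a smooth unit normal vector field
near `y`. -/
structure IsSheetAt (g : SmoothMetric n N) (F : ℝ → M → N)
    (ν : ∀ (r : ℝ) (q : M), TangentSpace (𝓡 (n + 1)) (F r q))
    (φ : OpenPartialHomeomorph M (EuclideanSpace ℝ (Fin n)))
    (ψ : OpenPartialHomeomorph N (EuclideanSpace ℝ (Fin (n + 1)))) (y : unitInterval × M) :
    Prop where
  source_mem_atlas : φ ∈ IsManifold.maximalAtlas (𝓡 n) ∞ M
  target_mem_atlas : ψ ∈ IsManifold.maximalAtlas (𝓡 (n + 1)) ∞ N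
  mem_source : y.2 ∈ φ.source
  map_mem_source : F y.1 y.2 ∈ ψ.source
  isSmoothNormal : ∀ᶠ y' in 𝓝 y, IsSmoothNormal g F ν y'

variable {g : SmoothMetric n N} {F : ℝ → M → N}
  {ν : ∀ (r : ℝ) (q : M), TangentSpace (𝓡 (n + 1)) (F r q)}
  {φ : OpenPartialHomeomorph M (EuclideanSpace ℝ (Fin n))}
  {ψ : OpenPartialHomeomorph N (EuclideanSpace ℝ (Fin (n + 1)))} {y : unitInterval × M}

theorem IsSmoothNormal.contMDiffWithinAt (h : IsSmoothNormal g F ν y) :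
    ContMDiffWithinAt (𝓘(ℝ, ℝ).prod (𝓡 n)) (𝓡 (n + 1)) ∞ (fun x : ℝ × M => F x.1 x.2)
      (Icc 0 1 ×ˢ univ) ((y.1 : ℝ), y.2) :=
  (Bundle.contMDiffWithinAt_totalSpace.1 h.1).1

theorem IsSmoothNormal.continuousAt_family (h : IsSmoothNormal g F ν y) :
    ContinuousAt (fun y : unitInterval × M => F y.1 y.2) y :=
  Tendsto.comp h.contMDiffWithinAt.continuousWithinAt (tendsto_nhdsWithin_unitInterval y)

namespace IsSheetAt

theorem eventually (h : IsSheetAt g F ν φ ψ y) : ∀ᶠ y' in 𝓝 y, IsSheetAt g F ν φ ψ y' := by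
  filter_upwards [eventually_eventually_nhds.2 h.isSmoothNormal,
    continuous_snd.continuousAt.eventually_mem (φ.open_source.mem_nhds h.mem_source),
    h.isSmoothNormal.self_of_nhds.continuousAt_family.eventually_mem
      (ψ.open_source.mem_nhds h.map_mem_source)] with y' h1 h2 h3
  exact ⟨h.source_mem_atlas, h.target_mem_atlas, h2, h3, h1⟩

theorem contDiffWithinAt_coordMap (h : IsSheetAt g F ν φ ψ y) :
    ContDiffWithinAt ℝ ∞ (coordMap F φ ψ) (Icc 0 1 ×ˢ univ) ((y.1 : ℝ), φ y.2) := by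
  have e : φ.symm (φ y.2) = y.2 := φ.left_inv h.mem_source
  refine _root_.contDiffWithinAt_coordMap h.source_mem_atlas h.target_mem_atlas
    (φ.map_source h.mem_source) ?_ ?_
  · simp only [e]; exact h.isSmoothNormal.self_of_nhds.contMDiffWithinAt
  · simp only [e]; exact h.map_mem_source

theorem contDiffWithinAt_coordConormal (h : IsSheetAt g F ν φ ψ y) :
    ContDiffWithinAt ℝ ∞ (coordConormal g F ν φ ψ) (Icc 0 1 ×ˢ univ) ((y.1 : ℝ), φ y.2) := by
  have e : φ.symm (φ y.2) = y.2 := φ.left_inv h.mem_source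
  refine _root_.contDiffWithinAt_coordConormal h.source_mem_atlas h.target_mem_atlas
    (φ.map_source h.mem_source) ?_ ?_ ?_
  · simp only [e]; exact h.isSmoothNormal.self_of_nhds.contMDiffWithinAt
  · simp only [e]; exact h.isSmoothNormal.self_of_nhds.1
  · simp only [e]; exact h.map_mem_source

theorem tendsto_chart (h : IsSheetAt g F ν φ ψ y) :
    Tendsto (fun y' : unitInterval × M => ((y'.1 : ℝ), φ y'.2)) (𝓝 y)
      (𝓝[Icc 0 1 ×ˢ univ] ((y.1 : ℝ), φ y.2)) := by
  refine tendsto_nhdsWithin_iff.2 ⟨?_, Eventually.of_forall fun y => ⟨y.1.2, mem_univ _⟩⟩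
  exact ContinuousAt.prodMk (continuous_subtype_val.comp continuous_fst).continuousAt
    (ContinuousAt.comp (f := Prod.snd) (g := φ) (φ.continuousAt h.mem_source)
      continuous_snd.continuousAt)

theorem continuousAt_dMap (h : IsSheetAt g F ν φ ψ y) : ContinuousAt (dMap F φ ψ) y :=
  Tendsto.comp (g := fun z : ℝ × EuclideanSpace ℝ (Fin n) =>
      fderiv ℝ (fun X => coordMap F φ ψ (z.1, X)) z.2)
    (continuousWithinAt_fderiv_slice h.contDiffWithinAt_coordMap y.1.2) h.tendsto_chart

theorem continuousAt_conormal (h : IsSheetAt g F ν φ ψ y) :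
    ContinuousAt (conormal g F ν φ ψ) y :=
  Tendsto.comp h.contDiffWithinAt_coordConormal.continuousWithinAt h.tendsto_chart

theorem continuousAt_dConormal (h : IsSheetAt g F ν φ ψ y) :
    ContinuousAt (dConormal g F ν φ ψ) y := by
  have h1 := continuousWithinAt_fderiv_slice h.contDiffWithinAt_coordConormal y.1.2
  generalize hD : (fun z : ℝ × EuclideanSpace ℝ (Fin n) =>
    fderiv ℝ (fun X => coordConormal g F ν φ ψ (z.1, X)) z.2) = D at h1
  have h2 : dConormal g F ν φ ψ = fun y => D ((y.1 : ℝ), φ y.2) := by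
    rw [← hD]; rfl
  rw [h2]
  exact Tendsto.comp h1 h.tendsto_chart

theorem contDiffAt_coordMap (h : IsSheetAt g F ν φ ψ y) :
    ContDiffAt ℝ ∞ (fun X => coordMap F φ ψ (y.1, X)) (φ y.2) :=
  contDiffAt_slice h.contDiffWithinAt_coordMap y.1.2

theorem contDiffAt_coordConormal (h : IsSheetAt g F ν φ ψ y) :
    ContDiffAt ℝ ∞ (fun X => coordConormal g F ν φ ψ (y.1, X)) (φ y.2) :=
  contDiffAt_slice h.contDiffWithinAt_coordConormal y.1.2

theorem eventually_slice (h : IsSheetAt g F ν φ ψ y) :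
    ∀ᶠ X in 𝓝 (φ y.2), X ∈ φ.target ∧ IsSheetAt g F ν φ ψ (y.1, φ.symm X) := by
  have e : φ.symm (φ y.2) = y.2 := φ.left_inv h.mem_source
  have h1 : ContinuousAt (fun X => (y.1, φ.symm X)) (φ y.2) :=
    continuousAt_const.prodMk (φ.continuousAt_symm (φ.map_source h.mem_source))
  refine Filter.Eventually.and (φ.open_target.mem_nhds (φ.map_source h.mem_source))
    (h1.eventually ?_)
  simp only [e]
  exact h.eventually

theorem conormal_eq (h : IsSheetAt g F ν φ ψ y) :
    conormal g F ν φ ψ y = chartCovector g ψ (F y.1 y.2) (ν y.1 y.2) := by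
  have e : ∀ q, q = y.2 → chartCovector g ψ (F y.1 q) (ν y.1 q) =
      chartCovector g ψ (F y.1 y.2) (ν y.1 y.2) := by
    rintro _ rfl; rfl
  exact e _ (φ.left_inv h.mem_source)

theorem conormal_dMap (hF : IsAFrontDeformation g F) (h : IsSheetAt g F ν φ ψ y)
    (w : EuclideanSpace ℝ (Fin n)) : conormal g F ν φ ψ y (dMap F φ ψ y w) = 0 := by
  have h1 := h.isSmoothNormal.self_of_nhds.2.chartCovector_fderiv h.source_mem_atlas
    h.target_mem_atlas h.mem_source h.map_mem_source
    ((hF.isAFront y.1 y.1.2).mdifferentiable y.2) w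
  rw [h.conormal_eq]
  exact h1

theorem dMap_coord_eq {X : EuclideanSpace ℝ (Fin n)} (hX : X ∈ φ.target) :
    dMap F φ ψ (y.1, φ.symm X) = fderiv ℝ (fun X => coordMap F φ ψ (y.1, X)) X := by
  simp only [dMap, φ.right_inv hX]

/-- The symmetry of the second fundamental form. -/
theorem dConormal_dMap_comm (hF : IsAFrontDeformation g F) (h : IsSheetAt g F ν φ ψ y)
    (v w : EuclideanSpace ℝ (Fin n)) :
    dConormal g F ν φ ψ y v (dMap F φ ψ y w) = dConormal g F ν φ ψ y w (dMap F φ ψ y v) := by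
  set f := fun X => coordMap F φ ψ (y.1, X) with hf
  set c := fun X => coordConormal g F ν φ ψ (y.1, X) with hc
  have hfd := h.contDiffAt_coordMap
  have hcd := h.contDiffAt_coordConormal.differentiableAt (by simp)
  have hfd' : DifferentiableAt ℝ (fderiv ℝ f) (φ y.2) :=
    (hfd.fderiv_right (m := ∞) (by simp)).differentiableAt (by simp)
  -- Differentiate the identity `c(X)(f'(X) w) = 0` in the direction `v`; the term with the second
  -- derivative of `f` is symmetric in `v` and `w`.
  have key : ∀ v w, fderiv ℝ c (φ y.2) v (fderiv ℝ f (φ y.2) w) +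
      c (φ y.2) (fderiv ℝ (fderiv ℝ f) (φ y.2) v w) = 0 := by
    intro v w
    have h1 : HasFDerivAt (fun X => c X (fderiv ℝ f X w)) _ (φ y.2) :=
      hcd.hasFDerivAt.clm_apply (hfd'.hasFDerivAt.clm_apply (hasFDerivAt_const w _))
    have h2 : (fun X => c X (fderiv ℝ f X w)) =ᶠ[𝓝 (φ y.2)] fun _ => 0 := by
      filter_upwards [h.eventually_slice] with X hX
      have := hX.2.conormal_dMap hF w
      rw [dMap_coord_eq hX.1] at this
      simp only [conormal, φ.right_inv hX.1] at this
      exact this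
    have h3 := (h1.congr_of_eventuallyEq h2.symm).unique (hasFDerivAt_const (0 : ℝ) _)
    have h4 := congrArg (fun L => L v) h3
    simp at h4
    linarith
  have hs : fderiv ℝ (fderiv ℝ f) (φ y.2) v w = fderiv ℝ (fderiv ℝ f) (φ y.2) w v :=
    (hfd.isSymmSndFDerivAt
    (by rw [minSmoothness_of_isRCLikeNormedField]; exact ENat.LEInfty.out)).eq v w
  have h1 := key v w
  have h2 := key w v
  rw [hs] at h1
  change fderiv ℝ c (φ y.2) v (fderiv ℝ f (φ y.2) w) = fderiv ℝ c (φ y.2) w (fderiv ℝ f (φ y.2) v)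
  linarith

theorem notMem_singularSet_iff (hF : IsAFrontDeformation g F) (h : IsSheetAt g F ν φ ψ y) :
    y.2 ∉ singularSet n (F y.1) ↔ Function.Injective (dMap F φ ψ y) :=
  mem_singularSet_iff_coordinates h.source_mem_atlas h.target_mem_atlas h.mem_source
    h.map_mem_source ((hF.isAFront y.1 y.1.2).mdifferentiable y.2)

end IsSheetAt

end Sheets

/-! ### Changes of charts -/

section ChartChange

variable {m : ℕ} {P : Type*} [TopologicalSpace P] [ChartedSpace (EuclideanSpace ℝ (Fin m)) P]
  {φ₀ φ₁ : OpenPartialHomeomorph P (EuclideanSpace ℝ (Fin m))} {p : P}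

theorem contDiffAt_chartChange (h₀ : φ₀ ∈ IsManifold.maximalAtlas (𝓡 m) ∞ P)
    (h₁ : φ₁ ∈ IsManifold.maximalAtlas (𝓡 m) ∞ P) (hp₀ : p ∈ φ₀.source) (hp₁ : p ∈ φ₁.source) :
    ContDiffAt ℝ ∞ (fun X => φ₁ (φ₀.symm X)) (φ₀ p) := by
  rw [← contMDiffAt_iff_contDiffAt]
  refine ContMDiffAt.comp (I' := 𝓡 m) (g := φ₁) (φ₀ p) ?_
    ((contMDiffOn_symm_of_mem_maximalAtlas h₀).contMDiffAt
      (φ₀.open_target.mem_nhds (φ₀.map_source hp₀)))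
  refine (contMDiffOn_of_mem_maximalAtlas h₁).contMDiffAt (φ₁.open_source.mem_nhds ?_)
  rwa [φ₀.left_inv hp₀]

theorem fderiv_chartChange (h₀ : φ₀ ∈ IsManifold.maximalAtlas (𝓡 m) ∞ P)
    (h₁ : φ₁ ∈ IsManifold.maximalAtlas (𝓡 m) ∞ P) (hp₀ : p ∈ φ₀.source) (hp₁ : p ∈ φ₁.source)
    (v : EuclideanSpace ℝ (Fin m)) :
    fderiv ℝ (fun X => φ₁ (φ₀.symm X)) (φ₀ p) v =
      chartDeriv φ₁ p (chartInvDeriv φ₀ (φ₀ p) v) := by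
  have hd₀ : MDifferentiableAt (𝓡 m) (𝓡 m) φ₀.symm (φ₀ p) :=
    (mdifferentiable_of_mem_maximalAtlas h₀).mdifferentiableAt_symm (φ₀.map_source hp₀)
  have hd₁ : MDifferentiableAt (𝓡 m) (𝓡 m) φ₁ p :=
    (mdifferentiable_of_mem_maximalAtlas h₁).mdifferentiableAt hp₁
  have hd₁' : HasMFDerivAt (𝓡 m) (𝓡 m) φ₁ (φ₀.symm (φ₀ p)) (chartDeriv φ₁ p) := by
    rw [φ₀.left_inv hp₀]; exact hd₁.hasMFDerivAt
  have h3 : HasFDerivAt (fun X => φ₁ (φ₀.symm X))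
      ((chartDeriv φ₁ p).comp (chartInvDeriv φ₀ (φ₀ p))) (φ₀ p) :=
    hasMFDerivAt_iff_hasFDerivAt.1 (hd₁'.comp (φ₀ p) hd₀.hasMFDerivAt)
  rw [h3.fderiv]
  rfl

/-- The derivative of a change of charts, as a function on the manifold. -/
def chartChangeDeriv (φ₀ φ₁ : OpenPartialHomeomorph P (EuclideanSpace ℝ (Fin m))) (p : P) :
    EuclideanSpace ℝ (Fin m) →L[ℝ] EuclideanSpace ℝ (Fin m) :=
  fderiv ℝ (fun X => φ₁ (φ₀.symm X)) (φ₀ p)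

theorem continuousAt_chartChangeDeriv (h₀ : φ₀ ∈ IsManifold.maximalAtlas (𝓡 m) ∞ P)
    (h₁ : φ₁ ∈ IsManifold.maximalAtlas (𝓡 m) ∞ P) (hp₀ : p ∈ φ₀.source) (hp₁ : p ∈ φ₁.source) :
    ContinuousAt (chartChangeDeriv φ₀ φ₁) p := by
  have h := ((contDiffAt_chartChange h₀ h₁ hp₀ hp₁).fderiv_right (m := ∞) (by simp)).continuousAt
  exact ContinuousAt.comp (f := φ₀) h (φ₀.continuousAt hp₀)

end ChartChange

/-! ### The side of the singular set does not depend on the charts -/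

section Comparison

variable {n : ℕ} [NeZero n]
  {M : Type*} [TopologicalSpace M] [ChartedSpace (EuclideanSpace ℝ (Fin n)) M]
  {N : Type*} [TopologicalSpace N] [ChartedSpace (EuclideanSpace ℝ (Fin (n + 1))) N]
  [IsManifold (𝓡 (n + 1)) ∞ N] {g : SmoothMetric n N} {F : ℝ → M → N}
  {ν₀ ν₁ : ∀ (r : ℝ) (q : M), TangentSpace (𝓡 (n + 1)) (F r q)}
  {φ₀ φ₁ : OpenPartialHomeomorph M (EuclideanSpace ℝ (Fin n))}
  {ψ₀ ψ₁ : OpenPartialHomeomorph N (EuclideanSpace ℝ (Fin (n + 1)))} {y : unitInterval × M}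

theorem dMap_chartChange (h₀ : IsSheetAt g F ν₀ φ₀ ψ₀ y) (h₁ : IsSheetAt g F ν₁ φ₁ ψ₁ y)
    (w : EuclideanSpace ℝ (Fin n)) :
    dMap F φ₁ ψ₁ y (chartChangeDeriv φ₀ φ₁ y.2 w) =
      chartChangeDeriv ψ₀ ψ₁ (F y.1 y.2) (dMap F φ₀ ψ₀ y w) := by
  have e₀ : φ₀.symm (φ₀ y.2) = y.2 := φ₀.left_inv h₀.mem_source
  have hτ := (contDiffAt_chartChange h₀.source_mem_atlas h₁.source_mem_atlas h₀.mem_source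
    h₁.mem_source).differentiableAt (by simp)
  have hκ := (contDiffAt_chartChange h₀.target_mem_atlas h₁.target_mem_atlas h₀.map_mem_source
    h₁.map_mem_source).differentiableAt (by simp)
  have hf₀ := h₀.contDiffAt_coordMap.differentiableAt (by simp)
  have hf₁ := h₁.contDiffAt_coordMap.differentiableAt (by simp)
  have hf₁' : HasFDerivAt (fun X => coordMap F φ₁ ψ₁ (y.1, X)) (dMap F φ₁ ψ₁ y)
      (φ₁ (φ₀.symm (φ₀ y.2))) := by rw [e₀]; exact hf₁.hasFDerivAt
  have hκ' : HasFDerivAt (fun X => ψ₁ (ψ₀.symm X)) (chartChangeDeriv ψ₀ ψ₁ (F y.1 y.2))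
      (coordMap F φ₀ ψ₀ (y.1, φ₀ y.2)) := by
    simp only [coordMap, e₀]; exact hκ.hasFDerivAt
  have h3 := hf₁'.comp (φ₀ y.2) hτ.hasFDerivAt
  have h4 := hκ'.comp (φ₀ y.2) hf₀.hasFDerivAt
  have h5 : (fun X => coordMap F φ₁ ψ₁ (y.1, X)) ∘ (fun X => φ₁ (φ₀.symm X)) =ᶠ[𝓝 (φ₀ y.2)]
      (fun X => ψ₁ (ψ₀.symm X)) ∘ fun X => coordMap F φ₀ ψ₀ (y.1, X) := by
    have h6 : ∀ᶠ X in 𝓝 (φ₀ y.2), φ₀.symm X ∈ φ₁.source :=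
      (φ₀.continuousAt_symm (φ₀.map_source h₀.mem_source)).eventually_mem
        (φ₁.open_source.mem_nhds (by rw [e₀]; exact h₁.mem_source))
    filter_upwards [h₀.eventually_slice, h6] with X hX hX'
    have h7 : ψ₀.symm (ψ₀ (F y.1 (φ₀.symm X))) = F y.1 (φ₀.symm X) :=
      ψ₀.left_inv hX.2.map_mem_source
    simp only [Function.comp_apply, coordMap, φ₁.left_inv hX', h7]
  have h6 := (h3.congr_of_eventuallyEq h5.symm).unique h4
  exact congrArg (fun L => L w) h6

theorem conormal_chartChange (h₀ : IsSheetAt g F ν₀ φ₀ ψ₀ y) (h₁ : IsSheetAt g F ν₁ φ₁ ψ₁ y)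
    {ε : ℝ} (hε : (ν₁ y.1 y.2 : EuclideanSpace ℝ (Fin (n + 1))) = ε • ν₀ y.1 y.2)
    (u : EuclideanSpace ℝ (Fin (n + 1))) :
    conormal g F ν₁ φ₁ ψ₁ y (chartChangeDeriv ψ₀ ψ₁ (F y.1 y.2) u) =
      ε * conormal g F ν₀ φ₀ ψ₀ y u := by
  rw [h₀.conormal_eq, h₁.conormal_eq, chartChangeDeriv, fderiv_chartChange h₀.target_mem_atlas
    h₁.target_mem_atlas h₀.map_mem_source h₁.map_mem_source]
  change modelInner g (F y.1 y.2) (ν₁ y.1 y.2) (chartInvDeriv ψ₁ (ψ₁ (F y.1 y.2))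
      (chartDeriv ψ₁ (F y.1 y.2) (chartInvDeriv ψ₀ (ψ₀ (F y.1 y.2)) u))) =
    ε * modelInner g (F y.1 y.2) (ν₀ y.1 y.2) (chartInvDeriv ψ₀ (ψ₀ (F y.1 y.2)) u)
  rw [chartInvDeriv_chartDeriv h₁.target_mem_atlas h₁.map_mem_source, hε]
  exact congrArg (fun L : EuclideanSpace ℝ (Fin (n + 1)) →L[ℝ] ℝ => L _)
    ((modelInner g (F y.1 y.2)).map_smul ε (show EuclideanSpace ℝ (Fin (n + 1)) from ν₀ y.1 y.2))

/-- The derivative of the conormal is not tensorial in general: the product rule produces a second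
derivative of the target chart change, evaluated on `df w`. For `w` in the kernel this term
disappears. -/
theorem dConormal_chartChange (h₀ : IsSheetAt g F ν₀ φ₀ ψ₀ y) (h₁ : IsSheetAt g F ν₁ φ₁ ψ₁ y)
    {ε : ℝ} (hε : ∀ᶠ y' : unitInterval × M in 𝓝 y,
      (ν₁ y'.1 y'.2 : EuclideanSpace ℝ (Fin (n + 1))) = ε • ν₀ y'.1 y'.2)
    {w : EuclideanSpace ℝ (Fin n)} (hw : dMap F φ₀ ψ₀ y w = 0)
    (u : EuclideanSpace ℝ (Fin (n + 1))) :
    dConormal g F ν₁ φ₁ ψ₁ y (chartChangeDeriv φ₀ φ₁ y.2 w)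
      (chartChangeDeriv ψ₀ ψ₁ (F y.1 y.2) u) = ε * dConormal g F ν₀ φ₀ ψ₀ y w u := by
  have e₀ : φ₀.symm (φ₀ y.2) = y.2 := φ₀.left_inv h₀.mem_source
  have hτ := (contDiffAt_chartChange h₀.source_mem_atlas h₁.source_mem_atlas h₀.mem_source
    h₁.mem_source).differentiableAt (by simp)
  have hκ := (((contDiffAt_chartChange h₀.target_mem_atlas h₁.target_mem_atlas h₀.map_mem_source
    h₁.map_mem_source).fderiv_right (m := ∞) (by simp)).differentiableAt (by simp))
  have hf₀ := h₀.contDiffAt_coordMap.differentiableAt (by simp)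
  have hc₀ := h₀.contDiffAt_coordConormal.differentiableAt (by simp)
  have hc₁ := h₁.contDiffAt_coordConormal.differentiableAt (by simp)
  have hc₁' : HasFDerivAt (fun X => coordConormal g F ν₁ φ₁ ψ₁ (y.1, X)) (dConormal g F ν₁ φ₁ ψ₁ y)
      (φ₁ (φ₀.symm (φ₀ y.2))) := by rw [e₀]; exact hc₁.hasFDerivAt
  set κ' := fderiv ℝ (fun X => ψ₁ (ψ₀.symm X)) with hκ'_def
  have hκ' : HasFDerivAt κ' (fderiv ℝ κ' (ψ₀ (F y.1 y.2)))
      (coordMap F φ₀ ψ₀ (y.1, φ₀ y.2)) := by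
    simp only [coordMap, e₀]; exact hκ.hasFDerivAt
  have h3 := hc₁'.comp (φ₀ y.2) hτ.hasFDerivAt
  have h4 := (hκ'.comp (φ₀ y.2) hf₀.hasFDerivAt).clm_apply (hasFDerivAt_const u (φ₀ y.2))
  have h5 := h3.clm_apply h4
  have h6 := (hc₀.hasFDerivAt.clm_apply (hasFDerivAt_const u (φ₀ y.2))).const_mul ε
  have h7 : (fun X => (((fun X => coordConormal g F ν₁ φ₁ ψ₁ (y.1, X)) ∘
        fun X => φ₁ (φ₀.symm X)) X) ((κ' ∘ fun X => coordMap F φ₀ ψ₀ (y.1, X)) X u))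
      =ᶠ[𝓝 (φ₀ y.2)] fun X => ε * coordConormal g F ν₀ φ₀ ψ₀ (y.1, X) u := by
    have h8 : ContinuousAt (fun X => (y.1, φ₀.symm X)) (φ₀ y.2) :=
      continuousAt_const.prodMk (φ₀.continuousAt_symm (φ₀.map_source h₀.mem_source))
    have h9 : ∀ᶠ X in 𝓝 (φ₀ y.2), IsSheetAt g F ν₁ φ₁ ψ₁ (y.1, φ₀.symm X) := by
      refine h8.eventually ?_
      simp only [e₀]
      exact h₁.eventually
    have h10 : ∀ᶠ X in 𝓝 (φ₀ y.2), (ν₁ y.1 (φ₀.symm X) : EuclideanSpace ℝ (Fin (n + 1))) =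
        ε • ν₀ y.1 (φ₀.symm X) := by
      refine h8.eventually (p := fun y' : unitInterval × M =>
        (ν₁ y'.1 y'.2 : EuclideanSpace ℝ (Fin (n + 1))) = ε • ν₀ y'.1 y'.2) ?_
      simp only [e₀]
      exact hε
    filter_upwards [h₀.eventually_slice, h9, h10] with X hX hX1 hX2
    have h11 := conormal_chartChange hX.2 hX1 hX2 u
    simp only [conormal, φ₀.right_inv hX.1] at h11
    exact h11
  have h8 := (h5.congr_of_eventuallyEq h7.symm).unique h6
  have h9 := congrArg (fun L => L w) h8
  have h10 : (fderiv ℝ (fun X => coordMap F φ₀ ψ₀ (y.1, X)) (φ₀ y.2)) w = 0 := hw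
  simp only [add_apply, ContinuousLinearMap.comp_apply,
    ContinuousLinearMap.flip_apply, h10, map_zero, smul_apply, smul_eq_mul,
    zero_apply, Function.comp_apply, zero_add, add_zero] at h9
  have h11 : κ' (coordMap F φ₀ ψ₀ (y.1, φ₀ y.2)) = chartChangeDeriv ψ₀ ψ₁ (F y.1 y.2) := by
    simp only [coordMap, e₀]; rfl
  rw [h11] at h9
  exact h9

/-- Near `y` the kernel of the derivative of the family is controlled by a vector `k` with
`dF k = β e`, and the second fundamental form does not vanish on `(k, e)`. -/
structure IsKernelFrameAt (g : SmoothMetric n N) (F : ℝ → M → N)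
    (ν : ∀ (r : ℝ) (q : M), TangentSpace (𝓡 (n + 1)) (F r q))
    (φ : OpenPartialHomeomorph M (EuclideanSpace ℝ (Fin n)))
    (ψ : OpenPartialHomeomorph N (EuclideanSpace ℝ (Fin (n + 1))))
    (k : unitInterval × M → EuclideanSpace ℝ (Fin n))
    (e : unitInterval × M → EuclideanSpace ℝ (Fin (n + 1))) (β : unitInterval × M → ℝ)
    (y : unitInterval × M) : Prop where
  isSheetAt : IsSheetAt g F ν φ ψ y
  continuousAt_kernel : ContinuousAt k y
  continuousAt_image : ContinuousAt e y
  kernel_ne_zero : k y ≠ 0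
  dMap_kernel : dMap F φ ψ y (k y) = β y • e y
  mem_singularSet_iff : y.2 ∈ singularSet n (F y.1) ↔ β y = 0
  exists_smul : ∀ w, dMap F φ ψ y w = 0 → ∃ c : ℝ, w = c • k y
  dConormal_ne_zero : dConormal g F ν φ ψ y (k y) (e y) ≠ 0

/-- The function whose sign tells on which side of the singular set a point lies. -/
def sideFunction (g : SmoothMetric n N) (F : ℝ → M → N)
    (ν : ∀ (r : ℝ) (q : M), TangentSpace (𝓡 (n + 1)) (F r q))
    (φ : OpenPartialHomeomorph M (EuclideanSpace ℝ (Fin n)))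
    (ψ : OpenPartialHomeomorph N (EuclideanSpace ℝ (Fin (n + 1))))
    (k : unitInterval × M → EuclideanSpace ℝ (Fin n))
    (e : unitInterval × M → EuclideanSpace ℝ (Fin (n + 1))) (β : unitInterval × M → ℝ)
    (y : unitInterval × M) : ℝ := β y * dConormal g F ν φ ψ y (k y) (e y)

variable {k₀ k₁ : unitInterval × M → EuclideanSpace ℝ (Fin n)}
    {e₀ e₁ : unitInterval × M → EuclideanSpace ℝ (Fin (n + 1))} {β₀ β₁ : unitInterval × M → ℝ}

/-- The sides of the singular set do not depend on the charts. -/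
theorem eventually_sideFunction_mul_pos (hF : IsAFrontDeformation g F)
    (h₀ : ∀ᶠ z in 𝓝 y, IsKernelFrameAt g F ν₀ φ₀ ψ₀ k₀ e₀ β₀ z)
    (h₁ : ∀ᶠ z in 𝓝 y, IsKernelFrameAt g F ν₁ φ₁ ψ₁ k₁ e₁ β₁ z)
    (hy : y.2 ∈ singularSet n (F y.1)) {ε : ℝ} (hε₁ : ε * ε = 1)
    (hε : ∀ᶠ y' : unitInterval × M in 𝓝 y,
      (ν₁ y'.1 y'.2 : EuclideanSpace ℝ (Fin (n + 1))) = ε • ν₀ y'.1 y'.2) :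
    ∀ᶠ z : unitInterval × M in 𝓝 y, z.2 ∉ singularSet n (F z.1) →
      0 < ε * (sideFunction g F ν₀ φ₀ ψ₀ k₀ e₀ β₀ z * sideFunction g F ν₁ φ₁ ψ₁ k₁ e₁ β₁ z) := by
  have hy₀ := h₀.self_of_nhds
  have hy₁ := h₁.self_of_nhds
  have s₀ := hy₀.isSheetAt
  have s₁ := hy₁.isSheetAt
  set J : unitInterval × M → _ := fun z => chartChangeDeriv φ₀ φ₁ z.2 with hJ
  set K : unitInterval × M → _ := fun z => chartChangeDeriv ψ₀ ψ₁ (F z.1 z.2) with hK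
  have hJc : ContinuousAt J y := ContinuousAt.comp (f := Prod.snd) (continuousAt_chartChangeDeriv
    s₀.source_mem_atlas s₁.source_mem_atlas s₀.mem_source s₁.mem_source) continuousAt_snd
  have hKc : ContinuousAt K y := ContinuousAt.comp (f := fun z : unitInterval × M => F z.1 z.2)
    (continuousAt_chartChangeDeriv s₀.target_mem_atlas s₁.target_mem_atlas s₀.map_mem_source
      s₁.map_mem_source) s₀.isSmoothNormal.self_of_nhds.continuousAt_family
  -- `P` and `R` are mixed values of the second form, each with one argument transported from the
  -- first pair of charts. They link the two frames both at `y` and near it.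
  set P : unitInterval × M → ℝ := fun z => dConormal g F ν₁ φ₁ ψ₁ z (k₁ z) (K z (e₀ z)) with hP
  set R : unitInterval × M → ℝ := fun z => dConormal g F ν₁ φ₁ ψ₁ z (J z (k₀ z)) (e₁ z) with hR
  set ω₀ : unitInterval × M → ℝ := fun z => dConormal g F ν₀ φ₀ ψ₀ z (k₀ z) (e₀ z) with hω₀
  set ω₁ : unitInterval × M → ℝ := fun z => dConormal g F ν₁ φ₁ ψ₁ z (k₁ z) (e₁ z) with hω₁
  have hPc : ContinuousAt P y := (s₁.continuousAt_dConormal.clm_apply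
    hy₁.continuousAt_kernel).clm_apply (hKc.clm_apply hy₀.continuousAt_image)
  have hRc : ContinuousAt R y := (s₁.continuousAt_dConormal.clm_apply
    (hJc.clm_apply hy₀.continuousAt_kernel)).clm_apply hy₁.continuousAt_image
  have hω₀c : ContinuousAt ω₀ y := (s₀.continuousAt_dConormal.clm_apply
    hy₀.continuousAt_kernel).clm_apply hy₀.continuousAt_image
  have hω₁c : ContinuousAt ω₁ y := (s₁.continuousAt_dConormal.clm_apply
    hy₁.continuousAt_kernel).clm_apply hy₁.continuousAt_image
  -- At `y` both kernel vectors span the kernel, so `J k₀ = c k₁`. The factor `c` enters `P`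
  -- inversely and `R` directly, and cancels in the product.
  have hPR : P y * R y = ε * (ω₀ y * ω₁ y) := by
    have h1 : dMap F φ₀ ψ₀ y (k₀ y) = 0 := by
      rw [hy₀.dMap_kernel, hy₀.mem_singularSet_iff.1 hy, zero_smul]
    have h2 : dMap F φ₁ ψ₁ y (J y (k₀ y)) = 0 := by
      rw [hJ, dMap_chartChange s₀ s₁, h1, map_zero]
    obtain ⟨c, hc⟩ := hy₁.exists_smul _ h2
    have h3 := dConormal_chartChange s₀ s₁ hε h1 (e₀ y)
    have h4 : c * P y = ε * ω₀ y := by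
      rw [← h3]
      change _ = dConormal g F ν₁ φ₁ ψ₁ y (J y (k₀ y)) (K y (e₀ y))
      rw [hc, map_smul]
      rfl
    have h5 : R y = c * ω₁ y := by
      simp only [hR, hω₁, hc, map_smul]
      rfl
    rw [h5]
    linear_combination ω₁ y * h4
  have hpos : ∀ᶠ z in 𝓝 y, 0 < (P z * R z) * (ε * (ω₀ z * ω₁ z)) := by
    refine ((hPc.mul hRc).mul (continuousAt_const.mul (hω₀c.mul hω₁c))).eventually
      (lt_mem_nhds ?_)
    change 0 < (P y * R y) * (ε * (ω₀ y * ω₁ y))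
    rw [hPR]
    have h1 : ε ≠ 0 := by rintro rfl; norm_num at hε₁
    have h2 : ε * (ω₀ y * ω₁ y) ≠ 0 :=
      mul_ne_zero h1 (mul_ne_zero hy₀.dConormal_ne_zero hy₁.dConormal_ne_zero)
    exact mul_self_pos.2 h2
  filter_upwards [hpos, h₀, h₁] with z hz hz₀ hz₁ hzs
  have hβ₀ : β₀ z ≠ 0 := fun h => hzs (hz₀.mem_singularSet_iff.2 h)
  -- The symmetry of the second fundamental form, applied to `k₁` and the transported `k₀`. It gives
  -- `β₀ β₁` the sign of `P R`, which near `y` is the sign of `ε ω₀ ω₁`.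
  have hrel : β₀ z * P z = β₁ z * R z := by
    have h1 := hz₁.isSheetAt.dConormal_dMap_comm hF (k₁ z) (J z (k₀ z))
    rw [hJ, dMap_chartChange hz₀.isSheetAt hz₁.isSheetAt, hz₀.dMap_kernel, hz₁.dMap_kernel] at h1
    simp only [map_smul, smul_eq_mul] at h1
    exact h1
  have hPz : P z ≠ 0 := by
    intro h; rw [h] at hz; simp at hz
  have h1 : 0 < (β₀ z * β₁ z) * (P z * R z) := by
    have h2 := mul_self_pos.2 (mul_ne_zero hβ₀ hPz)
    calc 0 < (β₀ z * P z) * (β₀ z * P z) := h2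
      _ = (β₀ z * P z) * (β₁ z * R z) := by rw [hrel]
      _ = _ := by ring
  have h2 := mul_pos h1 hz
  have h3 : 0 < (ε * (β₀ z * ω₀ z * (β₁ z * ω₁ z))) * ((P z * R z) * (P z * R z)) := by
    linarith
  exact pos_of_mul_pos_left h3 (mul_self_nonneg _)

end Comparison

/-! ### Linear algebra of kernel frames -/

section Frames

variable {n : ℕ} [NeZero n]

/-- The projection of the target to the components that are not distinguished. -/
def truncation (n : ℕ) [NeZero n] : EuclideanSpace ℝ (Fin (n + 1)) →L[ℝ] EuclideanSpace ℝ (Fin n) :=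
  LinearMap.toContinuousLinearMap
    { toFun := fun u => WithLp.toLp 2 fun i => if i = 0 then 0 else u i.succ
      map_add' := fun u v => by ext i; by_cases h : i = 0 <;> simp [h]
      map_smul' := fun c u => by ext i; by_cases h : i = 0 <;> simp [h] }

theorem truncation_apply (u : EuclideanSpace ℝ (Fin (n + 1))) (i : Fin n) :
    truncation n u i = if i = 0 then 0 else u i.succ := rfl

/-- The operator `w ↦ (w₀, (A w)₂, …, (A w)ₙ)`. -/
def frameOperator (A : EuclideanSpace ℝ (Fin n) →L[ℝ] EuclideanSpace ℝ (Fin (n + 1))) :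
    EuclideanSpace ℝ (Fin n) →L[ℝ] EuclideanSpace ℝ (Fin n) :=
  (EuclideanSpace.proj (0 : Fin n) : EuclideanSpace ℝ (Fin n) →L[ℝ] ℝ).smulRight
    (EuclideanSpace.single (0 : Fin n) (1 : ℝ)) + (truncation n).comp A

theorem frameOperator_apply
    (A : EuclideanSpace ℝ (Fin n) →L[ℝ] EuclideanSpace ℝ (Fin (n + 1)))
    (w : EuclideanSpace ℝ (Fin n)) (i : Fin n) :
    frameOperator A w i = if i = 0 then w 0 else A w i.succ := by
  by_cases h : i = 0
  · subst h; simp [frameOperator, truncation_apply]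
  · simp [frameOperator, truncation_apply, h]

theorem continuous_frameOperator : Continuous (frameOperator (n := n)) :=
  continuous_const.add (continuous_const.clm_comp continuous_id)

/-- The vector mapped to `(*, β, 0, …, 0)`. -/
def kernelVector (A : EuclideanSpace ℝ (Fin n) →L[ℝ] EuclideanSpace ℝ (Fin (n + 1))) :
    EuclideanSpace ℝ (Fin n) :=
  Ring.inverse (frameOperator A) (EuclideanSpace.single 0 1)

/-- The vector `(-η₁ / η₀, 1, 0, …, 0)` annihilated by `η`. -/
def imageVector (η : EuclideanSpace ℝ (Fin (n + 1)) →L[ℝ] ℝ) : EuclideanSpace ℝ (Fin (n + 1)) :=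
  EuclideanSpace.single (Fin.succ 0) 1 -
    (η (EuclideanSpace.single (Fin.succ 0) 1) / η (EuclideanSpace.single 0 1)) •
      EuclideanSpace.single 0 1

theorem imageVector_ne_zero (η : EuclideanSpace ℝ (Fin (n + 1)) →L[ℝ] ℝ) :
    imageVector η ≠ 0 := by
  intro h
  have := congrArg (fun u : EuclideanSpace ℝ (Fin (n + 1)) => u (Fin.succ 0)) h
  simp [imageVector] at this

variable {A : EuclideanSpace ℝ (Fin n) →L[ℝ] EuclideanSpace ℝ (Fin (n + 1))}

theorem frameOperator_kernelVector (hA : IsUnit (frameOperator A)) :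
    frameOperator A (kernelVector A) = EuclideanSpace.single 0 1 := by
  have := Ring.mul_inverse_cancel _ hA
  exact congrArg (fun L : EuclideanSpace ℝ (Fin n) →L[ℝ] EuclideanSpace ℝ (Fin n) =>
    L (EuclideanSpace.single 0 1)) this

/-- On a kernel vector of `A` the frame operator sees only the component of index `0`, so its
inverse returns a multiple of `kernelVector A`. -/
theorem eq_smul_kernelVector (hA : IsUnit (frameOperator A)) {w : EuclideanSpace ℝ (Fin n)}
    (hw : A w = 0) : w = w 0 • kernelVector A := by
  have h1 : frameOperator A w = w 0 • EuclideanSpace.single 0 1 := by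
    ext i
    rw [frameOperator_apply, hw]
    by_cases h : i = 0 <;> simp [h]
  have h2 := congrArg (fun L : EuclideanSpace ℝ (Fin n) →L[ℝ] EuclideanSpace ℝ (Fin n) =>
    L w) (Ring.inverse_mul_cancel _ hA)
  change Ring.inverse (frameOperator A) (frameOperator A w) = w at h2
  rw [h1, map_smul] at h2
  exact h2.symm

theorem kernelVector_ne_zero (hA : IsUnit (frameOperator A)) : kernelVector A ≠ 0 := by
  intro h
  have h1 := frameOperator_kernelVector hA
  rw [h, map_zero] at h1
  have := congrArg (fun u : EuclideanSpace ℝ (Fin n) => u 0) h1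
  simp at this

/-- By construction the image has only its components of index `0` and `1` left. That `η`
annihilates it fixes their ratio, as for `imageVector η`. -/
theorem apply_kernelVector (hA : IsUnit (frameOperator A))
    {η : EuclideanSpace ℝ (Fin (n + 1)) →L[ℝ] ℝ} (hη : η (EuclideanSpace.single 0 1) ≠ 0)
    (hηA : ∀ w, η (A w) = 0) :
    A (kernelVector A) = A (kernelVector A) (Fin.succ 0) • imageVector η := by
  set u := A (kernelVector A) with hu
  have h1 : ∀ i : Fin n, i ≠ 0 → u i.succ = 0 := by
    intro i hi
    have h2 := frameOperator_apply A (kernelVector A) i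
    rw [frameOperator_kernelVector hA, if_neg hi] at h2
    rw [hu, ← h2]
    simp [hi]
  have h2 : u = u 0 • EuclideanSpace.single 0 1 +
      u (Fin.succ 0) • EuclideanSpace.single (Fin.succ 0) 1 := by
    ext i
    refine Fin.cases ?_ (fun i => ?_) i
    · simp
    · by_cases hi : i = 0
      · subst hi; simp
      · have h3 : i.succ ≠ Fin.succ 0 := fun h => hi (Fin.succ_injective _ h)
        rw [Fin.succ_zero_eq_one'] at h3
        rw [h1 i hi]; simp [h3]
  have h3 := hηA (kernelVector A)
  rw [← hu] at h3
  rw [h2, map_add, map_smul, map_smul, smul_eq_mul, smul_eq_mul] at h3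
  have h4 : u 0 = -(u (Fin.succ 0) * (η (EuclideanSpace.single (Fin.succ 0) 1) /
      η (EuclideanSpace.single 0 1))) := by
    field_simp
    linarith
  conv_lhs => rw [h2, h4]
  rw [imageVector, smul_sub, smul_smul, neg_smul]
  abel

theorem continuousAt_kernelVector (hA : IsUnit (frameOperator A)) :
    ContinuousAt kernelVector A := by
  obtain ⟨u, hu⟩ := hA
  have h1 : ContinuousAt Ring.inverse (frameOperator A) := by
    rw [← hu]; exact NormedRing.inverse_continuousAt u
  exact (ContinuousAt.comp (f := frameOperator (n := n)) h1
    continuous_frameOperator.continuousAt).clm_apply continuousAt_const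

theorem continuousAt_imageVector {η : EuclideanSpace ℝ (Fin (n + 1)) →L[ℝ] ℝ}
    (hη : η (EuclideanSpace.single 0 1) ≠ 0) : ContinuousAt imageVector η := by
  have h : ∀ u, Continuous (fun η : EuclideanSpace ℝ (Fin (n + 1)) →L[ℝ] ℝ => η u) := fun u => by
    fun_prop
  exact continuousAt_const.sub (((h _).continuousAt.div (h _).continuousAt hη).smul
    continuousAt_const)

end Frames

/-! ### Kernel frames and inward vectors near a singular point -/

section FrameExistence

variable {n : ℕ} [NeZero n]
  {M : Type*} [TopologicalSpace M] [ChartedSpace (EuclideanSpace ℝ (Fin n)) M]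
  {N : Type*} [TopologicalSpace N] [ChartedSpace (EuclideanSpace ℝ (Fin (n + 1))) N]
  [IsManifold (𝓡 (n + 1)) ∞ N] {g : SmoothMetric n N} {F : ℝ → M → N}
  {ν : ∀ (r : ℝ) (q : M), TangentSpace (𝓡 (n + 1)) (F r q)}
  {φ : OpenPartialHomeomorph M (EuclideanSpace ℝ (Fin n))}
  {ψ : OpenPartialHomeomorph N (EuclideanSpace ℝ (Fin (n + 1)))} {y : unitInterval × M} {k : ℕ}

theorem IsNormalFormChart.isSheetAt (h : IsNormalFormChart k (F y.1) y.2 φ ψ)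
    (hν : ∀ᶠ y' in 𝓝 y, IsSmoothNormal g F ν y') : IsSheetAt g F ν φ ψ y :=
  ⟨h.source_mem_atlas, h.target_mem_atlas, h.mem_source, h.mapsTo h.mem_source, hν⟩

/-- The conormal covector is proportional to the derivative of the versal polynomial, also at
singular points. -/
theorem conormal_eq_versalLinear (hF : IsAFrontDeformation g F)
    {s : unitInterval} {p q : M} (h : IsNormalFormChart k (F s) p φ ψ) (hk : 1 ≤ k)
    (hq : IsSheetAt g F ν φ ψ (s, q)) (u : EuclideanSpace ℝ (Fin (n + 1))) :
    conormal g F ν φ ψ (s, q) u =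
      conormal g F ν φ ψ (s, q) (EuclideanSpace.single 0 1) * versalLinear k u (φ q 0) := by
  have hc : Continuous (fun q : M => (s, q)) := by fun_prop
  have h1 : ∀ u, ContinuousAt (fun q => conormal g F ν φ ψ (s, q) u) q := fun u =>
    (ContinuousAt.comp (f := fun q : M => (s, q)) hq.continuousAt_conormal
      hc.continuousAt).clm_apply continuousAt_const
  have h2 : ContinuousAt (fun q => versalLinear k u (φ q 0)) q := by
    refine ContinuousAt.comp (f := fun q => φ q 0) (continuous_versalLinear k u).continuousAt ?_
    exact ContinuousAt.comp (g := fun X : EuclideanSpace ℝ (Fin n) => X 0)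
      (by fun_prop) (φ.continuousAt hq.mem_source)
  by_contra hne
  -- Both sides are continuous in `q` and agree at regular points, which are dense.
  have h3 := ((h1 u).sub ((h1 (EuclideanSpace.single 0 1)).mul h2)).eventually_ne
    (sub_ne_zero.2 hne)
  have h4 : ∀ᶠ q' in 𝓝 q, IsSheetAt g F ν φ ψ (s, q') := hc.continuousAt.eventually hq.eventually
  obtain ⟨q', h5, h6, h7⟩ := (((hF.isAFront s s.2).frequently_notMem q).and_eventually
    (h3.and h4)).exists
  apply h6
  have h8 := h.chartCovector_eq hk (hF.isAFront s s.2).mdifferentiable h7.mem_source h5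
    h7.isSmoothNormal.self_of_nhds.2 u
  have h9 := h7.conormal_eq
  simp only at h9 h8
  simp only [Pi.sub_apply, Pi.mul_apply, h9]
  exact sub_eq_zero.2 h8

/-- Otherwise the conormal would vanish on every vector, although it pairs with `ν` to `1`. -/
theorem conormal_single_ne_zero (hF : IsAFrontDeformation g F)
    {s : unitInterval} {p q : M} (h : IsNormalFormChart k (F s) p φ ψ) (hk : 1 ≤ k)
    (hq : IsSheetAt g F ν φ ψ (s, q)) :
    conormal g F ν φ ψ (s, q) (EuclideanSpace.single 0 1) ≠ 0 := by
  intro h0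
  have h1 := conormal_eq_versalLinear hF h hk hq (chartDeriv ψ (F s q) (ν s q))
  rw [h0, zero_mul, hq.conormal_eq] at h1
  have h2 : modelInner g (F s q) (ν s q) (chartInvDeriv ψ (ψ (F s q))
    (chartDeriv ψ (F s q) (ν s q))) = 0 := h1
  have h3 : modelInner g (F s q) (ν s q) (ν s q) = 1 := hq.isSmoothNormal.self_of_nhds.2.1
  have h4 := congrArg (modelInner g (F s q) (ν s q))
    (chartInvDeriv_chartDeriv hq.target_mem_atlas hq.map_mem_source (ν s q))
  exact one_ne_zero (h3.symm.trans (h4.symm.trans h2))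

theorem dMap_normalForm {s : unitInterval} {p q : M} (h : IsNormalFormChart k (F s) p φ ψ)
    (hq : q ∈ φ.source) : dMap F φ ψ (s, q) = fderiv ℝ (normalForm n k) (φ q) :=
  (h.coordinates_eventuallyEq (φ.map_source hq)).fderiv_eq

theorem frameOperator_dMap_normalForm {s : unitInterval} {p q : M}
    (h : IsNormalFormChart k (F s) p φ ψ) (hq : q ∈ φ.source) :
    frameOperator (dMap F φ ψ (s, q)) = 1 := by
  rw [dMap_normalForm h hq]
  obtain ⟨L, hL, hLw⟩ := hasFDerivAt_normalForm k (φ q)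
  rw [hL.fderiv]
  ext w i
  rw [frameOperator_apply, hLw]
  by_cases hi : i = 0
  · simp [hi]
  · simp [hi, targetVector]

theorem kernelVector_normalForm {s : unitInterval} {p q : M}
    (h : IsNormalFormChart k (F s) p φ ψ) (hq : q ∈ φ.source) :
    kernelVector (dMap F φ ψ (s, q)) = EuclideanSpace.single 0 1 := by
  rw [kernelVector, frameOperator_dMap_normalForm h hq, Ring.inverse_one]
  rfl

/-- In normal form charts the kernel frame is explicit: `k` is the `t`-direction, and the factor `β`
is `-F_tt`. -/
theorem dMap_kernelVector_normalForm {s : unitInterval} {p q : M}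
    (h : IsNormalFormChart k (F s) p φ ψ) (hq : q ∈ φ.source) :
    dMap F φ ψ (s, q) (kernelVector (dMap F φ ψ (s, q))) (Fin.succ 0) =
      -versalSecond k (φ q) := by
  rw [kernelVector_normalForm h hq, dMap_normalForm h hq]
  obtain ⟨L, hL, hLw⟩ := hasFDerivAt_normalForm k (φ q)
  rw [hL.fderiv, hLw]
  have h1 : ∀ i : Fin n, (if 1 ≤ (i : ℕ) ∧ (i : ℕ) + 1 ≤ k then
      ((i : ℝ) + 1) * φ q 0 ^ (i : ℕ) * (EuclideanSpace.single (0 : Fin n) (1 : ℝ)) i else 0) = 0 := by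
    intro i
    split_ifs with hi
    · have : i ≠ 0 := fun h => by subst h; simp at hi
      simp [this]
    · rfl
  simp only [targetVector, Fin.cases_succ, if_true, h1]
  simp

theorem versalLinear_single (hk : 1 ≤ k) (t : ℝ) :
    versalLinear k (EuclideanSpace.single (Fin.succ (0 : Fin n)) (1 : ℝ)) t = t := by
  rw [versalLinear, Finset.sum_eq_single (Fin.succ (0 : Fin n))]
  · have h0 : (((0 : Fin n).succ : Fin (n + 1)) : ℕ) = 1 := by
      rw [Fin.val_succ]; simp
    rw [h0, if_pos hk]; simp
  · intro j _ hj
    rw [Fin.succ_zero_eq_one'] at hj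
    simp [hj]
  · simp

/-- The conormal satisfies `η₁ = t η₀` along the front. At the centre `t = 0`, so `e` is the basis
vector of index `1`, and the `t`-derivative of `t η₀` is `η₀`. Hence the second form is
nondegenerate on `(k, e)` for every `k ≥ 1`. -/
theorem dConormal_normalForm (hF : IsAFrontDeformation g F)
    (h : IsNormalFormChart k (F y.1) y.2 φ ψ) (hk : 1 ≤ k) (hy : IsSheetAt g F ν φ ψ y) :
    dConormal g F ν φ ψ y (EuclideanSpace.single 0 1) (imageVector (conormal g F ν φ ψ y)) =
      conormal g F ν φ ψ y (EuclideanSpace.single 0 1) := by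
  have h1 : imageVector (conormal g F ν φ ψ y) = EuclideanSpace.single (Fin.succ 0) 1 := by
    rw [imageVector, conormal_eq_versalLinear (s := y.1) (q := y.2) hF h hk hy
      (EuclideanSpace.single (Fin.succ 0) 1), versalLinear_single hk, h.centered]
    simp
  rw [h1]
  have hc := hy.contDiffAt_coordConormal.differentiableAt (by simp)
  have hc0 := hc.hasFDerivAt.clm_apply
    (hasFDerivAt_const (EuclideanSpace.single (0 : Fin (n + 1)) (1 : ℝ)) (φ y.2))
  have hc1 := hc.hasFDerivAt.clm_apply
    (hasFDerivAt_const (EuclideanSpace.single (Fin.succ (0 : Fin n)) (1 : ℝ)) (φ y.2))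
  have hX : HasFDerivAt (fun X : EuclideanSpace ℝ (Fin n) => X 0)
      (EuclideanSpace.proj 0 : EuclideanSpace ℝ (Fin n) →L[ℝ] ℝ) (φ y.2) :=
    (EuclideanSpace.proj 0 : EuclideanSpace ℝ (Fin n) →L[ℝ] ℝ).hasFDerivAt
  have h2 := hc0.mul hX
  have h3 : (fun X => coordConormal g F ν φ ψ (y.1, X) (EuclideanSpace.single (Fin.succ 0) 1))
      =ᶠ[𝓝 (φ y.2)] fun X =>
        coordConormal g F ν φ ψ (y.1, X) (EuclideanSpace.single 0 1) * X 0 := by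
    filter_upwards [hy.eventually_slice] with X hX
    have h4 := conormal_eq_versalLinear hF h hk hX.2 (EuclideanSpace.single (Fin.succ 0) 1)
    rw [versalLinear_single hk, φ.right_inv hX.1] at h4
    simp only [conormal, φ.right_inv hX.1] at h4
    exact h4
  have h4 := congrArg (fun L => L (EuclideanSpace.single (0 : Fin n) (1 : ℝ)))
    ((hc1.congr_of_eventuallyEq h3.symm).unique h2)
  have h5 : φ y.2 0 = 0 := by rw [h.centered]; rfl
  simp only [h5] at h4
  simp at h4
  simp
  exact h4

/-- A kernel frame near a singular point. -/
theorem eventually_isKernelFrameAt (hF : IsAFrontDeformation g F)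
    (h : IsNormalFormChart k (F y.1) y.2 φ ψ) (hk : 1 ≤ k)
    (hν : ∀ᶠ y' in 𝓝 y, IsSmoothNormal g F ν y') :
    ∀ᶠ z in 𝓝 y, IsKernelFrameAt g F ν φ ψ (fun z => kernelVector (dMap F φ ψ z))
      (fun z => imageVector (conormal g F ν φ ψ z))
      (fun z => dMap F φ ψ z (kernelVector (dMap F φ ψ z)) (Fin.succ 0)) z := by
  have hy : IsSheetAt g F ν φ ψ y := h.isSheetAt hν
  have hT : ContinuousAt (fun z => frameOperator (dMap F φ ψ z)) y :=
    ContinuousAt.comp (f := dMap F φ ψ) continuous_frameOperator.continuousAt hy.continuousAt_dMap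
  -- Only the front at the parameter `y.1` is in normal form in these charts. Neighbouring fronts
  -- need not be, but invertibility of the frame operator and the nonvanishing conditions are open.
  have hT1 : frameOperator (dMap F φ ψ y) = 1 := frameOperator_dMap_normalForm h h.mem_source
  have hu : ∀ᶠ z in 𝓝 y, IsUnit (frameOperator (dMap F φ ψ z)) := by
    refine hT.eventually_mem (Units.isOpen.mem_nhds (x := frameOperator (dMap F φ ψ y)) ?_)
    change IsUnit (frameOperator (dMap F φ ψ y))
    rw [hT1]; exact isUnit_one
  have hη0 := conormal_single_ne_zero (s := y.1) (q := y.2) hF h hk hy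
  have hη : ∀ᶠ z in 𝓝 y, conormal g F ν φ ψ z (EuclideanSpace.single 0 1) ≠ 0 :=
    (hy.continuousAt_conormal.clm_apply continuousAt_const).eventually_ne hη0
  have hkc : ∀ z, IsSheetAt g F ν φ ψ z → IsUnit (frameOperator (dMap F φ ψ z)) →
      ContinuousAt (fun z => kernelVector (dMap F φ ψ z)) z := fun z hz hz' =>
    ContinuousAt.comp (f := dMap F φ ψ) (continuousAt_kernelVector hz') hz.continuousAt_dMap
  have hec : ∀ z, IsSheetAt g F ν φ ψ z → conormal g F ν φ ψ z (EuclideanSpace.single 0 1) ≠ 0 →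
      ContinuousAt (fun z => imageVector (conormal g F ν φ ψ z)) z := fun z hz hz' =>
    ContinuousAt.comp (f := conormal g F ν φ ψ) (continuousAt_imageVector hz')
      hz.continuousAt_conormal
  have hω : ∀ᶠ z in 𝓝 y, dConormal g F ν φ ψ z (kernelVector (dMap F φ ψ z))
      (imageVector (conormal g F ν φ ψ z)) ≠ 0 := by
    refine ((hy.continuousAt_dConormal.clm_apply (hkc y hy hu.self_of_nhds)).clm_apply
      (hec y hy hη0)).eventually_ne ?_
    have h1 : kernelVector (dMap F φ ψ y) = EuclideanSpace.single 0 1 :=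
      kernelVector_normalForm h h.mem_source
    rw [h1, dConormal_normalForm hF h hk hy]
    exact hη0
  filter_upwards [hu, hη, hω, hy.eventually] with z h1 h2 h3 h4
  have h5 := apply_kernelVector h1 h2 (h4.conormal_dMap hF)
  refine ⟨h4, hkc z h4 h1, hec z h4 h2, kernelVector_ne_zero h1, h5, ?_,
    fun w hw => ⟨_, eq_smul_kernelVector h1 hw⟩, h3⟩
  rw [← not_iff_not, h4.notMem_singularSet_iff hF]
  constructor
  · intro hi hβ
    rw [hβ, zero_smul] at h5
    exact kernelVector_ne_zero h1 (hi (h5.trans (map_zero _).symm))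
  · intro hβ
    rw [injective_iff_map_eq_zero]
    intro w hw
    have h6 := eq_smul_kernelVector h1 hw
    rw [h6, map_smul, h5, smul_smul, smul_eq_zero] at hw
    have h7 := (mul_eq_zero.1 (hw.resolve_right (imageVector_ne_zero _))).resolve_right hβ
    rw [h6, h7, zero_smul]

/-- In normal form charts the sign of the side function tells the inward direction. -/
theorem eventually_isInward_iff (hF : IsAFrontDeformation g F)
    (h : IsNormalFormChart k (F y.1) y.2 φ ψ) (hk : 1 ≤ k)
    (hν : ∀ᶠ y' in 𝓝 y, IsSmoothNormal g F ν y') :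
    ∀ᶠ q in 𝓝 y.2, q ∉ singularSet n (F y.1) →
      (IsInward k φ ψ q (fieldLift (F y.1) (ν y.1) q) ↔
        0 < sideFunction g F ν φ ψ (fun z => kernelVector (dMap F φ ψ z))
          (fun z => imageVector (conormal g F ν φ ψ z))
          (fun z => dMap F φ ψ z (kernelVector (dMap F φ ψ z)) (Fin.succ 0)) (y.1, q)) := by
  have hy : IsSheetAt g F ν φ ψ y := h.isSheetAt hν
  have hfr := eventually_isKernelFrameAt hF h hk hν
  have hη0 := conormal_single_ne_zero (s := y.1) (q := y.2) hF h hk hy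
  -- Near `y` the second form on `(k, e)` has the sign of `η₀`. With `β = -F_tt` the side function
  -- has the sign of `-η₀ F_tt`, and this is the criterion for `ν` to be inward.
  have hpos : ∀ᶠ z in 𝓝 y, 0 < dConormal g F ν φ ψ z (kernelVector (dMap F φ ψ z))
      (imageVector (conormal g F ν φ ψ z)) * conormal g F ν φ ψ z (EuclideanSpace.single 0 1) := by
    refine (((hy.continuousAt_dConormal.clm_apply hfr.self_of_nhds.continuousAt_kernel).clm_apply
      hfr.self_of_nhds.continuousAt_image).mul
      (hy.continuousAt_conormal.clm_apply continuousAt_const)).eventually (lt_mem_nhds ?_)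
    have h1 : kernelVector (dMap F φ ψ y) = EuclideanSpace.single 0 1 :=
      kernelVector_normalForm h h.mem_source
    change 0 < dConormal g F ν φ ψ y (kernelVector (dMap F φ ψ y))
      (imageVector (conormal g F ν φ ψ y)) * conormal g F ν φ ψ y (EuclideanSpace.single 0 1)
    rw [h1, dConormal_normalForm hF h hk hy]
    exact mul_self_pos.2 hη0
  have hc : Continuous (fun q : M => (y.1, q)) := by fun_prop
  filter_upwards [hc.continuousAt.eventually (hpos.and hy.eventually)] with q hq hqs
  rw [fieldLift, h.isInward_iff hk (hF.isAFront y.1 y.1.2).mdifferentiable hq.2.mem_source hqs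
    hq.2.isSmoothNormal.self_of_nhds.2]
  have h1 := hq.2.conormal_eq
  simp only at h1
  rw [← h1, sideFunction, dMap_kernelVector_normalForm h hq.2.mem_source]
  have h2 := hq.1
  set a := dConormal g F ν φ ψ (y.1, q) (kernelVector (dMap F φ ψ (y.1, q)))
      (imageVector (conormal g F ν φ ψ (y.1, q)))
  set c := conormal g F ν φ ψ (y.1, q) (EuclideanSpace.single 0 1)
  set x := versalSecond k (φ q)
  rcases mul_pos_iff.1 h2 with ⟨h3, h4⟩ | ⟨h3, h4⟩
  · rw [mul_pos_iff_of_pos_right h3, neg_pos]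
    exact ⟨fun h5 => (pos_iff_neg_of_mul_neg h5).1 h4, fun h5 => mul_neg_of_pos_of_neg h4 h5⟩
  · rw [neg_mul, neg_pos]
    exact ⟨fun h5 => mul_neg_of_pos_of_neg (pos_of_mul_neg_right h5 h4.le) h3,
      fun h5 => mul_neg_of_neg_of_pos h4 (pos_of_mul_neg_left h5 h3.le)⟩

end FrameExistence

/-! ### The inward unit normal field of a deformation -/

section InwardField

variable {n : ℕ} [NeZero n]
  {M : Type*} [TopologicalSpace M] [ChartedSpace (EuclideanSpace ℝ (Fin n)) M]
  {N : Type*} [TopologicalSpace N] [ChartedSpace (EuclideanSpace ℝ (Fin (n + 1))) N]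

/-- The singular points of the members of a family. -/
def singularFamily (n : ℕ) {M : Type*} [TopologicalSpace M]
    [ChartedSpace (EuclideanSpace ℝ (Fin n)) M] {N : Type*} [TopologicalSpace N]
    [ChartedSpace (EuclideanSpace ℝ (Fin (n + 1))) N] (F : ℝ → M → N) :
    Set (unitInterval × M) := {y | y.2 ∈ singularSet n (F y.1)}

variable [IsManifold (𝓡 (n + 1)) ∞ N] {g : SmoothMetric n N} {F : ℝ → M → N}
  {ν ν₀ ν₁ : ∀ (r : ℝ) (q : M), TangentSpace (𝓡 (n + 1)) (F r q)}
  {φ φ₀ φ₁ : OpenPartialHomeomorph M (EuclideanSpace ℝ (Fin n))}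
  {ψ ψ₀ ψ₁ : OpenPartialHomeomorph N (EuclideanSpace ℝ (Fin (n + 1)))} {y : unitInterval × M}
  {k : ℕ}

/-- Injectivity is an open condition on linear maps, and the space derivative is continuous jointly
in the parameter and the point. -/
theorem IsAFrontDeformation.isClosed_singularFamily [IsManifold (𝓡 n) ∞ M]
    (hF : IsAFrontDeformation g F) : IsClosed (singularFamily n F) := by
  rw [← isOpen_compl_iff, isOpen_iff_eventually]
  intro y hy
  obtain ⟨ν, hν⟩ := hF.exists_isSmoothNormal y
  have h : IsSheetAt g F ν (chartAt (EuclideanSpace ℝ (Fin n)) y.2)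
      (chartAt (EuclideanSpace ℝ (Fin (n + 1))) (F y.1 y.2)) y :=
    ⟨IsManifold.chart_mem_maximalAtlas _, IsManifold.chart_mem_maximalAtlas _,
      mem_chart_source _ _, mem_chart_source _ _, hν⟩
  have h1 := h.continuousAt_dMap.eventually_mem
    (ContinuousLinearMap.isOpen_injective.mem_nhds ((h.notMem_singularSet_iff hF).1 hy))
  filter_upwards [h1, h.eventually] with z hz1 hz2
  exact (hz2.notMem_singularSet_iff hF).2 hz1

/-- The standard kernel frame of a pair of charts. -/
def IsFrameAt (g : SmoothMetric n N) (F : ℝ → M → N)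
    (ν : ∀ (r : ℝ) (q : M), TangentSpace (𝓡 (n + 1)) (F r q))
    (φ : OpenPartialHomeomorph M (EuclideanSpace ℝ (Fin n)))
    (ψ : OpenPartialHomeomorph N (EuclideanSpace ℝ (Fin (n + 1)))) (y : unitInterval × M) : Prop :=
  IsKernelFrameAt g F ν φ ψ (fun z => kernelVector (dMap F φ ψ z))
      (fun z => imageVector (conormal g F ν φ ψ z))
      (fun z => dMap F φ ψ z (kernelVector (dMap F φ ψ z)) (Fin.succ 0)) y

/-- The side function of the standard kernel frame. -/
def frameSide (g : SmoothMetric n N) (F : ℝ → M → N)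
    (ν : ∀ (r : ℝ) (q : M), TangentSpace (𝓡 (n + 1)) (F r q))
    (φ : OpenPartialHomeomorph M (EuclideanSpace ℝ (Fin n)))
    (ψ : OpenPartialHomeomorph N (EuclideanSpace ℝ (Fin (n + 1)))) (y : unitInterval × M) : ℝ :=
  sideFunction g F ν φ ψ (fun z => kernelVector (dMap F φ ψ z))
      (fun z => imageVector (conormal g F ν φ ψ z))
      (fun z => dMap F φ ψ z (kernelVector (dMap F φ ψ z)) (Fin.succ 0)) y

/-- The values of a family of vector fields, as vectors of the model space. -/
def modelVector (F : ℝ → M → N) (ν : ∀ (r : ℝ) (q : M), TangentSpace (𝓡 (n + 1)) (F r q))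
    (y : unitInterval × M) : EuclideanSpace ℝ (Fin (n + 1)) := ν y.1 y.2

/-- The inward unit normal vector in a kernel frame. -/
def frameField (g : SmoothMetric n N) (F : ℝ → M → N)
    (ν : ∀ (r : ℝ) (q : M), TangentSpace (𝓡 (n + 1)) (F r q))
    (φ : OpenPartialHomeomorph M (EuclideanSpace ℝ (Fin n)))
    (ψ : OpenPartialHomeomorph N (EuclideanSpace ℝ (Fin (n + 1)))) (y : unitInterval × M) :
    EuclideanSpace ℝ (Fin (n + 1)) :=
  if 0 < frameSide g F ν φ ψ y then modelVector F ν y else -modelVector F ν y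

theorem frameField_of_pos (h : 0 < frameSide g F ν φ ψ y) :
    frameField g F ν φ ψ y = modelVector F ν y := if_pos h

theorem frameField_of_not_pos (h : ¬ 0 < frameSide g F ν φ ψ y) :
    frameField g F ν φ ψ y = -modelVector F ν y := if_neg h

theorem IsFrameAt.frameSide_ne_zero (h : IsFrameAt g F ν φ ψ y)
    (hy : y ∉ singularFamily n F) : frameSide g F ν φ ψ y ≠ 0 :=
  mul_ne_zero (fun h0 => hy (h.mem_singularSet_iff.2 h0)) h.dConormal_ne_zero

theorem IsFrameAt.continuousAt_frameSide (h : IsFrameAt g F ν φ ψ y) :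
    ContinuousAt (frameSide g F ν φ ψ) y := by
  have h1 := h.isSheetAt.continuousAt_dMap.clm_apply h.continuousAt_kernel
  have h2 : ContinuousAt (fun z => dMap F φ ψ z (kernelVector (dMap F φ ψ z)) (Fin.succ 0)) y :=
    ContinuousAt.comp (g := fun u : EuclideanSpace ℝ (Fin (n + 1)) => u (Fin.succ 0))
      (by fun_prop) h1
  exact h2.mul ((h.isSheetAt.continuousAt_dConormal.clm_apply h.continuousAt_kernel).clm_apply
    h.continuousAt_image)

theorem IsFrameAt.isUnitOrthogonal_frameField (h : IsFrameAt g F ν φ ψ y) :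
    IsUnitOrthogonal g (F y.1) y.2 (frameField g F ν φ ψ y) := by
  have h1 : IsUnitOrthogonal g (F y.1) y.2 (modelVector F ν y) := h.isSheetAt.isSmoothNormal.self_of_nhds.2
  unfold frameField
  split_ifs
  · exact h1
  · exact h1.neg

/-- The bundle map given by a family of vectors of the model space. -/
def familyLift (F : ℝ → M → N) (v : unitInterval × M → EuclideanSpace ℝ (Fin (n + 1)))
    (y : unitInterval × M) : TangentBundle (𝓡 (n + 1)) N := ⟨F y.1 y.2, v y⟩

theorem IsFrameAt.continuousAt_frameField (h : IsFrameAt g F ν φ ψ y)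
    (hy : y ∉ singularFamily n F) :
    ContinuousAt (familyLift F (frameField g F ν φ ψ)) y := by
  have h1 := h.isSheetAt.isSmoothNormal.self_of_nhds.continuousAt
  rcases lt_or_gt_of_ne (h.frameSide_ne_zero hy) with h2 | h2
  · have h3 : ContinuousAt (fun y : unitInterval × M =>
        oppositeVector (fieldLift (F y.1) (ν y.1) y.2)) y :=
      ContinuousAt.comp (continuousAt_oppositeVector _) h1
    refine h3.congr ?_
    filter_upwards [h.continuousAt_frameSide.eventually (gt_mem_nhds h2)] with z hz
    rw [familyLift, frameField_of_not_pos hz.not_gt]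
    rfl
  · refine h1.congr ?_
    filter_upwards [h.continuousAt_frameSide.eventually (lt_mem_nhds h2)] with z hz
    rw [familyLift, frameField_of_pos hz]
    rfl

/-- Two smooth unit normal vector fields agree up to a sign. -/
theorem eventually_eq_or_eq_neg (hF : IsAFrontDeformation g F)
    (h₀ : ∀ᶠ z in 𝓝 y, IsSmoothNormal g F ν₀ z) (h₁ : ∀ᶠ z in 𝓝 y, IsSmoothNormal g F ν₁ z) :
    ∃ ε : ℝ, (ε = 1 ∨ ε = -1) ∧ ∀ᶠ z : unitInterval × M in 𝓝 y,
      modelVector F ν₁ z = ε • modelVector F ν₀ z := by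
  have hc : ContinuousAt (fun z : unitInterval × M => vectorInner g
      (fieldLift (F z.1) (ν₀ z.1) z.2) (fieldLift (F z.1) (ν₁ z.1) z.2)) y := by
    rw [← continuousWithinAt_univ]
    exact continuousWithinAt_vectorInner g h₀.self_of_nhds.continuousAt.continuousWithinAt
      h₁.self_of_nhds.continuousAt.continuousWithinAt (Eventually.of_forall fun z => rfl) rfl
  have key : ∀ᶠ z : unitInterval × M in 𝓝 y,
      (modelVector F ν₁ z = modelVector F ν₀ z ∧
        vectorInner g (fieldLift (F z.1) (ν₀ z.1) z.2) (fieldLift (F z.1) (ν₁ z.1) z.2) = 1) ∨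
      (modelVector F ν₁ z = -modelVector F ν₀ z ∧
        vectorInner g (fieldLift (F z.1) (ν₀ z.1) z.2) (fieldLift (F z.1) (ν₁ z.1) z.2) = -1) := by
    filter_upwards [eventually_eventually_nhds.2 h₀, eventually_eventually_nhds.2 h₁] with z hz₀ hz₁
    have hn₀ := isUnitNormalAt_of_eventually hz₀
    rcases (hF.isAFront z.1 z.1.2).eq_or_eq hn₀ (isUnitNormalAt_of_eventually hz₁) with h | h
    · left
      refine ⟨eq_of_heq (Bundle.TotalSpace.mk.inj h).2, ?_⟩
      rw [h]; exact hn₀.vectorInner_self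
    · right
      refine ⟨eq_of_heq (Bundle.TotalSpace.mk.inj h).2, ?_⟩
      rw [h, vectorInner_oppositeVector, hn₀.vectorInner_self]
  rcases key.self_of_nhds with h | h
  · refine ⟨1, Or.inl rfl, ?_⟩
    have h2 := hc.eventually (lt_mem_nhds (one_pos.trans_eq h.2.symm))
    filter_upwards [key, h2] with z hz hz2
    rcases hz with hz | hz
    · rw [hz.1]; exact (one_smul ℝ _).symm
    · rw [hz.2] at hz2; norm_num at hz2
  · refine ⟨-1, Or.inr rfl, ?_⟩
    have h2 := hc.eventually (gt_mem_nhds (h.2.trans_lt (neg_lt_zero.2 one_pos)))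
    filter_upwards [key, h2] with z hz hz2
    rcases hz with hz | hz
    · rw [hz.2] at hz2; norm_num at hz2
    · rw [hz.1]; exact (neg_one_smul ℝ _).symm

/-- If `ν₁ = ε ν₀`, the side functions differ in sign by `ε` as well, so both frames choose the same
vector among the two unit normals. -/
theorem frameField_eventuallyEq (hF : IsAFrontDeformation g F)
    (h₀ : ∀ᶠ z in 𝓝 y, IsFrameAt g F ν₀ φ₀ ψ₀ z) (h₁ : ∀ᶠ z in 𝓝 y, IsFrameAt g F ν₁ φ₁ ψ₁ z)
    (hy : y ∈ singularFamily n F) : ∀ᶠ z in 𝓝 y, z ∉ singularFamily n F →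
      frameField g F ν₀ φ₀ ψ₀ z = frameField g F ν₁ φ₁ ψ₁ z := by
  obtain ⟨ε, hε, hν⟩ := eventually_eq_or_eq_neg hF h₀.self_of_nhds.isSheetAt.isSmoothNormal
    h₁.self_of_nhds.isSheetAt.isSmoothNormal
  have h := eventually_sideFunction_mul_pos hF h₀ h₁ hy
    (by rcases hε with rfl | rfl <;> norm_num) hν
  filter_upwards [h, hν] with z hz hνz hzs
  have h2 : 0 < ε * (frameSide g F ν₀ φ₀ ψ₀ z * frameSide g F ν₁ φ₁ ψ₁ z) := hz hzs
  rcases hε with rfl | rfl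
  · have h3 : modelVector F ν₁ z = modelVector F ν₀ z :=
      hνz.trans (one_smul ℝ _)
    rw [one_mul] at h2
    rcases mul_pos_iff.1 h2 with h4 | h4
    · rw [frameField_of_pos h4.1, frameField_of_pos h4.2, h3]
    · rw [frameField_of_not_pos h4.1.not_gt, frameField_of_not_pos h4.2.not_gt, h3]
  · have h3 : modelVector F ν₁ z = -modelVector F ν₀ z :=
      hνz.trans (neg_one_smul ℝ _)
    rw [neg_one_mul, neg_pos] at h2
    rcases mul_neg_iff.1 h2 with h4 | h4
    · rw [frameField_of_pos h4.1, frameField_of_not_pos h4.2.not_gt, h3, neg_neg]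
    · rw [frameField_of_not_pos h4.1.not_gt, frameField_of_pos h4.2, h3]

theorem IsNormalFormChart.isInward_neg_iff {f : M → N} {p q : M}
    (h : IsNormalFormChart k f p φ ψ) (hk : 1 ≤ k) (hf : MDifferentiable (𝓡 n) (𝓡 (n + 1)) f)
    (hq : q ∈ φ.source) (hqs : q ∉ singularSet n f) {v : EuclideanSpace ℝ (Fin (n + 1))}
    (hv : IsUnitOrthogonal g f q v) :
    IsInward k φ ψ q (⟨f q, -v⟩ : TangentBundle (𝓡 (n + 1)) N) ↔
      ¬ IsInward k φ ψ q (⟨f q, v⟩ : TangentBundle (𝓡 (n + 1)) N) := by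
  have h1 := h.isInward_iff hk hf hq hqs hv.neg
  have h2 : chartCovector g ψ (f q) (-v) (EuclideanSpace.single 0 1) =
      -chartCovector g ψ (f q) v (EuclideanSpace.single 0 1) := by
    simp [chartCovector]
  refine h1.trans ?_
  rw [h.isInward_iff hk hf hq hqs hv, h2, neg_mul, neg_lt_zero]
  have h3 : versalSecond k (φ q) ≠ 0 := fun h0 => hqs ((h.mem_singularSet_iff hf hq).2 h0)
  have h4 : chartCovector g ψ (f q) v (EuclideanSpace.single 0 1) ≠ 0 := by
    intro h0
    have h5 := h.chartCovector_eq hk hf hq hqs hv (chartDeriv ψ (f q) v)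
    rw [h0, zero_mul, chartCovector, ContinuousLinearMap.comp_apply,
      chartInvDeriv_chartDeriv h.target_mem_atlas (h.mapsTo hq)] at h5
    have h6 : modelInner g (f q) v v = 1 := hv.1
    rw [h5] at h6
    norm_num at h6
  rw [not_lt]
  exact ⟨le_of_lt, fun h5 => lt_of_le_of_ne h5 (mul_ne_zero h4 h3).symm⟩

/-- At a regular point exactly one of the two unit normals is inward, and the sign of the side
function selects it. This passes from a criterion for `ν` to a characterization among all unit
normals. -/
theorem eventually_isInward_iff_frameField (hF : IsAFrontDeformation g F)
    (h : IsNormalFormChart k (F y.1) y.2 φ ψ) (hk : 1 ≤ k)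
    (hν : ∀ᶠ y' in 𝓝 y, IsSmoothNormal g F ν y') :
    ∀ᶠ q in 𝓝 y.2, q ∉ singularSet n (F y.1) → ∀ v : EuclideanSpace ℝ (Fin (n + 1)),
      IsUnitOrthogonal g (F y.1) q v →
      (IsInward k φ ψ q (⟨F y.1 q, v⟩ : TangentBundle (𝓡 (n + 1)) N) ↔
        v = frameField g F ν φ ψ (y.1, q)) := by
  have hc : Continuous (fun q : M => (y.1, q)) := by fun_prop
  filter_upwards [eventually_isInward_iff hF h hk hν,
    hc.continuousAt.eventually (h.isSheetAt hν).eventually] with q h1 h2 hq v hv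
  set u := modelVector F ν (y.1, q) with hu
  have h3 : IsUnitOrthogonal g (F y.1) q u := h2.isSmoothNormal.self_of_nhds.2
  have hne : u ≠ -u := by
    intro h0
    have h5 : modelInner g (F y.1 q) u u = 1 := h3.1
    have h6 : modelInner g (F y.1 q) u (-u) = -1 := by rw [map_neg, h5]
    rw [← h0, h5] at h6
    norm_num at h6
  have h4 := h.isInward_neg_iff hk (hF.isAFront y.1 y.1.2).mdifferentiable h2.mem_source hq h3
  have h5 := h1 hq
  change _ ↔ 0 < frameSide g F ν φ ψ (y.1, q) at h5
  have h5' : IsInward k φ ψ q (⟨F y.1 q, u⟩ : TangentBundle (𝓡 (n + 1)) N) ↔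
    0 < frameSide g F ν φ ψ (y.1, q) := h5
  have hvu := IsUnitOrthogonal.eq_or_eq_neg hq h3 hv
  by_cases h6 : 0 < frameSide g F ν φ ψ (y.1, q)
  · rw [frameField_of_pos h6, ← hu]
    rcases hvu with rfl | rfl
    · exact ⟨fun _ => rfl, fun _ => h5'.2 h6⟩
    · exact ⟨fun h7 => absurd (h5'.2 h6) (h4.1 h7), fun h7 => absurd h7.symm hne⟩
  · rw [frameField_of_not_pos h6, ← hu]
    rcases hvu with rfl | rfl
    · exact ⟨fun h7 => absurd (h5'.1 h7) h6, fun h7 => absurd h7 hne⟩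
    · exact ⟨fun _ => rfl, fun _ => h4.2 fun h7 => h6 (h5'.1 h7)⟩

/-- The inward unit normal vector field of a deformation of A-fronts. -/
theorem IsAFrontDeformation.exists_inward [T2Space M] [SecondCountableTopology M]
    [IsManifold (𝓡 n) ∞ M] (hF : IsAFrontDeformation g F) :
    ∃ v : unitInterval × M → EuclideanSpace ℝ (Fin (n + 1)),
      (∀ y ∈ singularFamily n F, ∀ᶠ z in 𝓝 y, z ∉ singularFamily n F →
        ContinuousAt (familyLift F v) z ∧ IsUnitOrthogonal g (F z.1) z.2 (v z)) ∧
      ∀ y ∈ singularFamily n F, ∀ k, 1 ≤ k → ∀ φ ψ, IsNormalFormChart k (F y.1) y.2 φ ψ →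
        ∀ᶠ q in 𝓝 y.2, q ∉ singularSet n (F y.1) → ∀ w : EuclideanSpace ℝ (Fin (n + 1)),
          IsUnitOrthogonal g (F y.1) q w →
          (IsInward k φ ψ q (⟨F y.1 q, w⟩ : TangentBundle (𝓡 (n + 1)) N) ↔ w = v (y.1, q)) := by
  have : LocallyCompactSpace M := ChartedSpace.locallyCompactSpace (EuclideanSpace ℝ (Fin n)) M
  have hA := hF.isClosed_singularFamily
  have hex : ∀ y : unitInterval × M, ∃ (ν : ∀ (r : ℝ) (q : M), TangentSpace (𝓡 (n + 1)) (F r q))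
      (φ : OpenPartialHomeomorph M (EuclideanSpace ℝ (Fin n)))
      (ψ : OpenPartialHomeomorph N (EuclideanSpace ℝ (Fin (n + 1)))),
      y ∈ singularFamily n F → ∀ᶠ z in 𝓝 y, IsFrameAt g F ν φ ψ z := by
    intro y
    obtain ⟨ν, hν⟩ := hF.exists_isSmoothNormal y
    by_cases hy : y ∈ singularFamily n F
    · obtain ⟨k, hk, -, φ, ψ, h⟩ := (hF.isAFront y.1 y.1.2).2 y.2 hy
      exact ⟨ν, φ, ψ, fun _ => eventually_isKernelFrameAt hF h hk hν⟩
    · exact ⟨ν, chartAt _ y.2, chartAt _ (F y.1 y.2), fun h => absurd h hy⟩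
  choose ν φ ψ hfr using hex
  -- The frame fields of any two charts have the same germ, off the singular set, at each singular
  -- point where both are frames.
  obtain ⟨v, hv⟩ := exists_glue_germs (Y := fun _ => EuclideanSpace ℝ (Fin (n + 1))) hA
    (fun a => frameField g F (ν a) (φ a) (ψ a))
    (fun a => interior {z | IsFrameAt g F (ν a) (φ a) (ψ a) z}) (fun a _ => isOpen_interior)
    (fun a ha => mem_interior_iff_mem_nhds.2 (hfr a ha)) (fun a ha b hb hab =>
      frameField_eventuallyEq hF (mem_interior_iff_mem_nhds.1 hab) (hfr b hb) hb)
  refine ⟨v, fun y hy => ?_, fun y hy k hk φ' ψ' h => ?_⟩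
  · filter_upwards [hfr y hy, eventually_eventually_nhds.2 (hv y hy)] with z h1 h2 hz
    have h3 : ∀ᶠ z' in 𝓝 z, v z' = frameField g F (ν y) (φ y) (ψ y) z' := by
      filter_upwards [h2, hA.isOpen_compl.mem_nhds hz] with z' h4 h5
      exact h4 h5
    refine ⟨?_, ?_⟩
    · refine (h1.continuousAt_frameField hz).congr ?_
      filter_upwards [h3] with z' h4
      simp only [familyLift, h4]
    · rw [h3.self_of_nhds]; exact h1.isUnitOrthogonal_frameField
  · have hν := (hfr y hy).self_of_nhds.isSheetAt.isSmoothNormal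
    -- Arbitrary normal form charts at `y` also give a frame there, so their inward vector agrees
    -- with the glued field.
    have h1 := frameField_eventuallyEq hF (hfr y hy) (eventually_isKernelFrameAt hF h hk hν) hy
    have hc : Continuous (fun q : M => (y.1, q)) := by fun_prop
    filter_upwards [eventually_isInward_iff_frameField hF h hk hν,
      hc.continuousAt.eventually (h1.and (hv y hy))] with q h2 h3 hq w hw
    rw [h2 hq w hw, h3.2 hq, h3.1 hq]

end InwardField

/-! ### Disjoint neighborhoods of components -/

section LocallyConnectedSubset

/-- A locally connected subset of a locally connected metrizable space has disjoint connected
neighborhoods of its components, within given neighborhoods of its points. -/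
theorem exists_disjoint_connected_neighborhoods {X : Type*} [TopologicalSpace X]
    [TopologicalSpace.MetrizableSpace X] [LocallyConnectedSpace X] {S : Set X}
    (hS : ∀ p ∈ S, ∃ V ∈ 𝓝 p, ∃ C ⊆ S, IsPreconnected C ∧ p ∈ C ∧ V ∩ S ⊆ C)
    (W : X → Set X) (hW : ∀ p ∈ S, W p ∈ 𝓝 p) :
    ∃ O : ConnectedComponents S → Set X, (∀ α, IsOpen (O α)) ∧ (∀ α, IsConnected (O α)) ∧
      (∀ α β, α ≠ β → Disjoint (O α) (O β)) ∧ (∀ p : S, (p : X) ∈ O (ConnectedComponents.mk p)) ∧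
      ∀ α, O α ⊆ ⋃ p ∈ S, W p := by
  letI := TopologicalSpace.metrizableSpaceMetric X
  -- Within the radius `d p`, only points of the component of `p` in `S` occur.
  have hex : ∀ p : S, ∃ d > 0, Metric.ball (p : X) d ⊆ W p ∧
      ∀ q : S, (q : X) ∈ Metric.ball (p : X) d →
        ConnectedComponents.mk q = ConnectedComponents.mk p := by
    intro p
    obtain ⟨V, hV, C, hCS, hC, hpC, hVC⟩ := hS p p.2
    obtain ⟨d, hd, hdV⟩ := Metric.mem_nhds_iff.1 (inter_mem hV (hW p p.2))
    refine ⟨d, hd, fun x hx => (hdV hx).2, fun q hq => ?_⟩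
    have hC' : IsPreconnected ((↑) ⁻¹' C : Set S) := by
      rw [← IsInducing.subtypeVal.isPreconnected_image, Subtype.image_preimage_coe,
        inter_eq_right.2 hCS]
      exact hC
    rw [ConnectedComponents.coe_eq_coe']
    exact hC'.subset_connectedComponent (x := p) hpC (hVC ⟨(hdV hq).1, q.2⟩)
  choose d hd hdW hdS using hex
  -- Half radii: if two such pieces meet, one centre lies within the full radius of the other, so
  -- the centres belong to the same component. Taking components of the balls makes the unions
  -- connected.
  let B : S → Set X := fun p => connectedComponentIn (Metric.ball (p : X) (d p / 2)) p
  have hpB : ∀ p, (p : X) ∈ B p := fun p =>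
    mem_connectedComponentIn (Metric.mem_ball_self (half_pos (hd p)))
  have hBs : ∀ p, B p ⊆ Metric.ball (p : X) (d p / 2) := fun p => connectedComponentIn_subset _ _
  refine ⟨fun α => ⋃ p ∈ {p : S | ConnectedComponents.mk p = α}, B p, fun α => ?_, fun α => ?_,
    fun α β hαβ => ?_, fun p => ?_, fun α => ?_⟩
  · exact isOpen_biUnion fun p _ => Metric.isOpen_ball.connectedComponentIn
  · obtain ⟨p₀, rfl⟩ := ConnectedComponents.surjective_coe α
    refine ⟨⟨p₀, mem_biUnion (show p₀ ∈ {p : S | _} from rfl) (hpB p₀)⟩, ?_⟩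
    refine isPreconnected_of_forall (p₀ : X) fun y hy => ?_
    obtain ⟨p, hp, hyp⟩ := mem_iUnion₂.1 hy
    have hp' : p ∈ connectedComponent p₀ := ConnectedComponents.coe_eq_coe'.1 hp
    have hc : IsPreconnected ((↑) '' connectedComponent p₀ : Set X) :=
      isPreconnected_connectedComponent.image _ continuous_subtype_val.continuousOn
    refine ⟨(↑) '' connectedComponent p₀ ∪ B p, ?_, Or.inl ⟨p₀, mem_connectedComponent, rfl⟩,
      Or.inr hyp, hc.union (p : X) ⟨p, hp', rfl⟩ (hpB p) isPreconnected_connectedComponentIn⟩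
    rintro x (⟨q, hq, rfl⟩ | hx)
    · exact mem_biUnion (show q ∈ {p : S | _} from ConnectedComponents.coe_eq_coe'.2 hq) (hpB q)
    · exact mem_biUnion hp hx
  · rw [Set.disjoint_left]
    intro x hx hx'
    obtain ⟨p, hp, hxp⟩ := mem_iUnion₂.1 hx
    obtain ⟨q, hq, hxq⟩ := mem_iUnion₂.1 hx'
    have h1 := Metric.mem_ball.1 (hBs p hxp)
    have h2 := Metric.mem_ball.1 (hBs q hxq)
    have h3 : dist (p : X) q ≤ dist x p + dist x q := dist_triangle_left _ _ _
    apply hαβ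
    have hp : ConnectedComponents.mk p = α := hp
    have hq : ConnectedComponents.mk q = β := hq
    rw [← hp, ← hq]
    rcases le_total (d p) (d q) with h | h
    · exact hdS q p (Metric.mem_ball.2 (by linarith))
    · exact (hdS p q (by rw [Metric.mem_ball, dist_comm]; linarith)).symm
  · exact mem_biUnion (show p ∈ {q : S | _} from rfl) (hpB p)
  · refine iUnion₂_subset fun p _ x hx => ?_
    exact mem_biUnion p.2 (hdW p (Metric.ball_subset_ball (half_le_self (hd p).le) (hBs p hx)))

end LocallyConnectedSubset

/-! ### Existence and uniqueness of the inward field of a single front -/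

section Systems

variable {n : ℕ} [NeZero n]
  {M : Type*} [TopologicalSpace M] [ChartedSpace (EuclideanSpace ℝ (Fin n)) M]
  {N : Type*} [TopologicalSpace N] [ChartedSpace (EuclideanSpace ℝ (Fin (n + 1))) N]
  [IsManifold (𝓡 (n + 1)) ∞ N] {g : SmoothMetric n N}

/-- `v` is an inward unit normal vector field along the family `F`, near its singular points. -/
structure IsInwardField (g : SmoothMetric n N) (F : ℝ → M → N)
    (v : unitInterval × M → EuclideanSpace ℝ (Fin (n + 1))) : Prop where
  isUnitNormal : ∀ y ∈ singularFamily n F, ∀ᶠ z in 𝓝 y, z ∉ singularFamily n F →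
        ContinuousAt (familyLift F v) z ∧ IsUnitOrthogonal g (F z.1) z.2 (v z)
  isInward_iff : ∀ y ∈ singularFamily n F, ∀ k, 1 ≤ k → ∀ φ ψ,
    IsNormalFormChart k (F y.1) y.2 φ ψ →
      ∀ᶠ q in 𝓝 y.2, q ∉ singularSet n (F y.1) → ∀ w : EuclideanSpace ℝ (Fin (n + 1)),
        IsUnitOrthogonal g (F y.1) q w →
          (IsInward k φ ψ q (⟨F y.1 q, w⟩ : TangentBundle (𝓡 (n + 1)) N) ↔ w = v (y.1, q))

theorem IsAFrontDeformation.exists_isInwardField [T2Space M] [SecondCountableTopology M]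
    [IsManifold (𝓡 n) ∞ M] {F : ℝ → M → N} (hF : IsAFrontDeformation g F) :
    ∃ v, IsInwardField g F v := by
  obtain ⟨v, h1, h2⟩ := hF.exists_inward
  exact ⟨v, h1, h2⟩

variable {F : ℝ → M → N} {v : unitInterval × M → EuclideanSpace ℝ (Fin (n + 1))}

theorem IsInwardField.eventually_slice (hv : IsInwardField g F v) {s : unitInterval} {p : M}
    (hp : p ∈ singularSet n (F s)) : ∀ᶠ q in 𝓝 p, q ∉ singularSet n (F s) →
      ContinuousAt (fun q => familyLift F v (s, q)) q ∧ IsUnitOrthogonal g (F s) q (v (s, q)) := by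
  have hc : Continuous (fun q : M => (s, q)) := by fun_prop
  filter_upwards [hc.continuousAt.eventually (hv.isUnitNormal (s, p) hp)] with q hq hqs
  exact ⟨ContinuousAt.comp (f := fun q : M => (s, q)) (hq hqs).1 hc.continuousAt, (hq hqs).2⟩

/-- The inward field of an inward system is unique near the singular set. -/
theorem IsInwardField.eventually_eq_field (hv : IsInwardField g F v) {s : unitInterval}
    (D : InwardSystem g (F s)) {p : M} (hp : p ∈ singularSet n (F s)) :
    ∀ᶠ q in 𝓝 p, q ∉ singularSet n (F s) →
      fieldLift (F s) D.field q = familyLift F v (s, q) := by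
  obtain ⟨k, hk, -, φ, ψ, h, hD⟩ := D.inward p hp
  filter_upwards [hD, hv.isInward_iff (s, p) hp k hk φ ψ h,
    (D.isOpen _).mem_nhds (D.mem ⟨p, hp⟩)] with q h1 h2 h3 hq
  have h4 := D.isUnitNormalField.2 q ⟨mem_iUnion.2 ⟨_, h3⟩, hq⟩
  exact congrArg (Bundle.TotalSpace.mk (F s q)) ((h2 hq _ h4).1 (h1 hq))

theorem IsInwardField.nonempty_inwardSystem [T2Space M] [SecondCountableTopology M]
    (hv : IsInwardField g F v) (hF : IsAFrontDeformation g F) (s : unitInterval) :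
    Nonempty (InwardSystem g (F s)) := by
  have hf := hF.isAFront s s.2
  have : LocallyCompactSpace M := ChartedSpace.locallyCompactSpace (EuclideanSpace ℝ (Fin n)) M
  have : LocallyConnectedSpace M := ChartedSpace.locallyConnectedSpace (EuclideanSpace ℝ (Fin n)) M
  obtain ⟨O, h1, h2, h3, h4, h5⟩ := exists_disjoint_connected_neighborhoods
    (S := singularSet n (F s)) (fun p hp => by
      obtain ⟨k, -, -, φ, ψ, h⟩ := hf.2 p hp
      exact h.exists_preconnected hf.mdifferentiable hp)
    (fun _ => {q | q ∉ singularSet n (F s) → ContinuousAt (fun q => familyLift F v (s, q)) q ∧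
      IsUnitOrthogonal g (F s) q (v (s, q))}) (fun p hp => hv.eventually_slice hp)
  have h6 : ∀ q ∈ (⋃ α, O α) \ singularSet n (F s),
      ContinuousAt (fun q => familyLift F v (s, q)) q ∧ IsUnitOrthogonal g (F s) q (v (s, q)) := by
    rintro q ⟨hq, hqs⟩
    obtain ⟨α, hα⟩ := mem_iUnion.1 hq
    obtain ⟨p, hp, hpq⟩ := mem_iUnion₂.1 (h5 α hα)
    exact hpq hqs
  refine ⟨⟨O, h1, h2, h3, h4, fun q => v (s, q), ⟨fun q hq => ?_, fun q hq => (h6 q hq).2⟩,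
    fun p hp => ?_⟩⟩
  · exact (h6 q hq).1.continuousWithinAt
  · obtain ⟨k, hk, hkn, φ, ψ, h⟩ := hf.2 p hp
    refine ⟨k, hk, hkn, φ, ψ, h, ?_⟩
    filter_upwards [hv.isInward_iff (s, p) hp k hk φ ψ h, hv.eventually_slice hp] with q h7 h8 hq
    exact (h7 hq _ (h8 hq).2).2 rfl

end Systems

/-! ### Alternating sums of the signs -/

section SignSequences

theorem alternatingSum_append (l₁ l₂ : List ℤˣ) :
    alternatingSum (l₁ ++ l₂) = alternatingSum l₁ + (-1) ^ l₁.length * alternatingSum l₂ := by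
  induction l₁ with
  | nil => simp [alternatingSum]
  | cons x l ih => simp only [List.cons_append, alternatingSum, ih, List.length_cons, pow_succ]; ring

/-- The alternating sum of the signs of the crossings is the total change of the counter `h`. -/
theorem alternatingSum_filter (ε : ℕ → ℤˣ) (a b : ℕ → ℤˣ) (h : ℕ → ℤ) (cr : ℕ → Bool)
    (hε₀ : ε 0 = 1) (hb₀ : b 0 = 1) (m : ℕ)
    (hε : ∀ j < m, ε (j + 1) = ε j * b j * a (j + 1))
    (hh : ∀ j < m, 2 * (h (j + 1) - h j) = b (j + 1) - a (j + 1))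
    (hcr : ∀ j < m, cr (j + 1) = true ↔ a (j + 1) ≠ b (j + 1)) :
    alternatingSum ([ε 0] ++ ((List.range' 1 m).filter cr).map ε) = 1 + (h m - h 0) ∧
    ((-1) ^ ([ε 0] ++ ((List.range' 1 m).filter cr).map ε).length : ℤˣ) = -(ε m * b m) ∧
    Even ((([ε 0] ++ ((List.range' 1 m).filter cr).map ε).length : ℤ) + 1 + (h m - h 0)) := by
  induction m with
  | zero => simp [alternatingSum, hε₀, hb₀]
  | succ m ih =>
    -- In the application `a j` and `b j` are the signs of the inward vector, relative to the fixed
    -- normal field, at the two ends of `I_j`, and `h` is the integral part of the counting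
    -- function. The second invariant records the sign with which the next entry will enter.
    obtain ⟨h1, h2, h3⟩ := ih (fun j hj => hε j (by omega)) (fun j hj => hh j (by omega))
      (fun j hj => hcr j (by omega))
    set L := [ε 0] ++ ((List.range' 1 m).filter cr).map ε with hL
    have hr : [ε 0] ++ ((List.range' 1 (m + 1)).filter cr).map ε =
        L ++ if cr (m + 1) then [ε (m + 1)] else [] := by
      rw [List.range'_concat, List.filter_append, List.map_append, ← List.append_assoc, ← hL,
        one_mul, add_comm 1 m]
      by_cases hc : cr (m + 1) <;> simp [hc]
    have e1 := hε m (by omega)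
    have e2 := hh m (by omega)
    have e3 := hcr m (by omega)
    rw [hr]
    by_cases hc : cr (m + 1) = true
    · have hab := e3.1 hc
      have hab' : b (m + 1) = -a (m + 1) := by
        rcases Int.units_eq_one_or (a (m + 1)) with h | h <;>
          rcases Int.units_eq_one_or (b (m + 1)) with h' | h' <;> simp_all
      rw [hab'] at e2
      push_cast at e2
      -- A crossing adds the entry `ε m * b m * a (m + 1)` with the factor `-(ε m * b m)`, hence `-a
      -- (m + 1)`: exactly the jump of the counter.
      have e4 : h (m + 1) - h m = -(a (m + 1) : ℤ) := by linarith
      have e5 : ((-1) ^ L.length : ℤ) = -((ε m : ℤ) * b m) := by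
        have := congrArg (fun u : ℤˣ => (u : ℤ)) h2
        simpa using this
      have e6 : ((ε m : ℤ) * b m) * ((ε m : ℤ) * b m) = 1 := by
        rw [← Units.val_mul, ← Units.val_mul, Int.units_mul_self]; rfl
      have e7 : (ε (m + 1) : ℤ) = ε m * b m * a (m + 1) := by rw [e1]; push_cast; ring
      refine ⟨?_, ?_, ?_⟩
      · rw [if_pos hc, alternatingSum_append, h1, e5]
        simp only [alternatingSum, sub_zero]
        rw [e7]
        linear_combination -(a (m + 1) : ℤ) * e6 - e4
      · rw [if_pos hc, List.length_append, pow_add, h2, hab', e1]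
        simp only [List.length_cons, List.length_nil, zero_add, pow_one]
        simp [mul_assoc]
      · rw [if_pos hc, List.length_append]
        have e8 : h (m + 1) - h 0 = h m - h 0 - a (m + 1) := by linarith
        rw [e8]
        simp only [List.length_cons, List.length_nil, zero_add]
        push_cast
        rcases Int.units_eq_one_or (a (m + 1)) with h' | h' <;> rw [h'] <;> push_cast
        · have e : (L.length : ℤ) + 1 + 1 + (h m - h 0 - 1) = L.length + 1 + (h m - h 0) := by ring
          rw [e]; exact h3
        · have e : (L.length : ℤ) + 1 + 1 + (h m - h 0 - -1) = L.length + 1 + (h m - h 0) + 2 := by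
            ring
          rw [e]; exact h3.add even_two
    · have hab : a (m + 1) = b (m + 1) := by
        by_contra h'; exact hc (e3.2 h')
      rw [hab, sub_self] at e2
      have e4 : h (m + 1) = h m := by linarith
      rw [if_neg hc, List.append_nil, e4, e1, hab, mul_assoc (ε m * b m), Int.units_mul_self, mul_one]
      exact ⟨h1, h2, h3⟩

/-- The alternating sum of a sequence of signs, and the last sign, in terms of the counter. -/
theorem alternatingSum_signs (ε : ℕ → ℤˣ) (a b : ℕ → ℤˣ) (h : ℕ → ℤ) (cr : ℕ → Bool) (m : ℕ)
    (hε₀ : ε 0 = 1) (hb₀ : b 0 = 1) (ha : a (m + 1) = 1)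
    (hε : ∀ j ≤ m, ε (j + 1) = ε j * b j * a (j + 1))
    (hh : ∀ j < m, 2 * (h (j + 1) - h j) = b (j + 1) - a (j + 1))
    (hcr : ∀ j < m, cr (j + 1) = true ↔ a (j + 1) ≠ b (j + 1)) :
    alternatingSum ([ε 0] ++ ((List.range' 1 m).filter cr).map ε ++ [ε (m + 1)]) = h m - h 0 ∧
    (ε (m + 1) = 1 ↔ Even (h m - h 0)) := by
  obtain ⟨h1, h2, h3⟩ := alternatingSum_filter ε a b h cr hε₀ hb₀ m (fun j hj => hε j hj.le) hh hcr
  set L := [ε 0] ++ ((List.range' 1 m).filter cr).map ε with hL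
  have e1 := hε m le_rfl
  rw [ha, mul_one] at e1
  rw [← e1] at h2
  constructor
  -- The last entry enters with the factor `-ε (m + 1)`; it contributes `-1` and cancels the
  -- contribution of `ε 0 = 1`.
  · rw [alternatingSum_append, h1]
    have e5 : ((-1) ^ L.length : ℤ) = -(ε (m + 1) : ℤ) := by
      have := congrArg (fun u : ℤˣ => (u : ℤ)) h2
      simpa using this
    have e6 : (ε (m + 1) : ℤ) * ε (m + 1) = 1 := by
      rw [← Units.val_mul, Int.units_mul_self]; rfl
    rw [e5]
    simp only [alternatingSum, sub_zero]
    linarith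
  · rw [add_assoc, Int.even_add] at h3
    have h4 : ε (m + 1) = 1 ↔ ¬ Even (L.length : ℤ) := by
      rw [Int.even_coe_nat]
      rcases Nat.even_or_odd L.length with h | h
      · rw [h.neg_one_pow] at h2
        have : ε (m + 1) = -1 := by rw [← neg_neg (ε (m + 1)), ← h2]
        simp [this, h]
      · rw [h.neg_one_pow, neg_inj] at h2
        simp [← h2, Nat.not_even_iff_odd.2 h]
    rw [h4, h3, Int.even_add]
    simp

end SignSequences

/-! ### Signed subdivisions and counting functions along a loop -/

section Subdivisions

variable {n : ℕ} [NeZero n]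
  {M : Type*} [TopologicalSpace M] [ChartedSpace (EuclideanSpace ℝ (Fin n)) M]
  {N : Type*} [TopologicalSpace N] [ChartedSpace (EuclideanSpace ℝ (Fin (n + 1))) N]
  [IsManifold (𝓡 (n + 1)) ∞ N] {g : SmoothMetric n N} {f : M → N} {o : M} {γ : Path o o}
  {a b : ℝ} {μ μ' : ℝ → TangentBundle (𝓡 (n + 1)) N} {ν₀ : TangentBundle (𝓡 (n + 1)) N}

theorem IsUnitNormalAlong.oppositeVector (h : IsUnitNormalAlong g f γ a b μ) :
    IsUnitNormalAlong g f γ a b (fun t => oppositeVector (μ t)) :=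
  ⟨fun t ht => (continuousAt_oppositeVector _).comp_continuousWithinAt (h.1 t ht),
    fun t ht => (h.2 t ht).oppositeVector⟩

theorem IsUnitNormalAlong.mono (h : IsUnitNormalAlong g f γ a b μ) {a' b' : ℝ} (ha : a ≤ a')
    (hb : b' ≤ b) : IsUnitNormalAlong g f γ a' b' μ :=
  ⟨h.1.mono (Icc_subset_Icc ha hb), fun t ht => h.2 t (Icc_subset_Icc ha hb ht)⟩

theorem IsUnitNormalAlong.eqOn (hf : IsAFront g f) (h : IsUnitNormalAlong g f γ a b μ)
    (h' : IsUnitNormalAlong g f γ a b μ') {t : ℝ} (ht : t ∈ Icc a b) (he : μ t = μ' t) :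
    EqOn μ μ' (Icc a b) :=
  eqOn_of_isUnitNormalAt isPreconnected_Icc (f := fun _ => f) (p := γ.extend) (fun _ _ => hf)
    h.1 h'.1 h.2 h'.2 ht he

open Classical in
/-- The sign of `w` relative to `v`. -/
def relativeSign (v w : TangentBundle (𝓡 (n + 1)) N) : ℤˣ := if w = v then 1 else -1

theorem relativeSign_cases (hf : IsAFront g f) {p : M} {v w : TangentBundle (𝓡 (n + 1)) N}
    (hv : IsUnitNormalAt g f p v) (hw : IsUnitNormalAt g f p w) :
    relativeSign v w = 1 ∧ w = v ∨ relativeSign v w = -1 ∧ w = oppositeVector v := by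
  rcases hf.eq_or_eq hv hw with h | h
  · exact Or.inl ⟨if_pos h, h⟩
  · exact Or.inr ⟨if_neg (by rw [h]; exact hv.ne_oppositeVector), h⟩

namespace SignedSubdivision

variable (D : SignedSubdivision g f ν₀ γ)

theorem b_le_b {i j : ℕ} (hij : i ≤ j) (hj : j ≤ D.m) : D.b i ≤ D.b j := by
  induction j, hij using Nat.le_induction with
  | base => exact le_rfl
  | succ j hij ih =>
    exact (ih (by omega)).trans ((D.b_lt_a j (by omega)).trans (D.a_lt_b _ (by omega) hj)).le

theorem a_le_a {i j : ℕ} (hi : 1 ≤ i) (hij : i ≤ j) (hj : j ≤ D.m + 1) : D.a i ≤ D.a j := by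
  induction j, hij using Nat.le_induction with
  | base => exact le_rfl
  | succ j hij ih =>
    exact (ih (by omega)).trans ((D.a_lt_b j (by omega) (by omega)).trans
      (D.b_lt_a _ (by omega))).le

theorem mem_Icc_of_mem {j : ℕ} (hj : j ≤ D.m) {t : ℝ} (ht : t ∈ Icc (D.b j) (D.a (j + 1))) :
    t ∈ Icc (0 : ℝ) 1 := by
  refine ⟨?_, ?_⟩
  · rw [← D.b_zero]; exact (D.b_le_b (Nat.zero_le j) hj).trans ht.1
  · rw [← D.a_last]; exact ht.2.trans (D.a_le_a (by omega) (by omega) le_rfl)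

theorem notMem_singularSet {j : ℕ} (hj : j ≤ D.m) {t : ℝ}
    (ht : t ∈ Icc (D.b j) (D.a (j + 1))) : γ.extend t ∉ singularSet n f := by
  intro hs
  obtain ⟨i, hi1, hi2, hi3⟩ := D.cover t (D.mem_Icc_of_mem hj ht) hs
  rcases le_or_gt i j with h | h
  · exact absurd (hi3.2.trans_le (D.b_le_b h hj)) (not_lt.2 ht.1)
  · exact absurd (hi3.1.trans_le ht.2) (not_lt.2 (D.a_le_a (by omega) h (by omega)))

/-- The inward vector along the loop. -/
def fieldAlong (t : ℝ) : TangentBundle (𝓡 (n + 1)) N := fieldLift f D.system.field (γ.extend t)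

theorem eventually_isUnitNormalAt (hS : IsClosed (singularSet n f)) {j : ℕ} (hj1 : 1 ≤ j)
    (hj : j ≤ D.m) {t : ℝ} (ht : t ∈ Icc (D.a j) (D.b j)) (hts : γ.extend t ∉ singularSet n f) :
    ContinuousAt D.fieldAlong t ∧
      ∀ᶠ t' in 𝓝 t, IsUnitNormalAt g f (γ.extend t') (D.fieldAlong t') := by
  obtain ⟨α, hα⟩ := D.mapsTo j hj1 hj
  have hU : IsOpen ((⋃ α, D.system.O α) \ singularSet n f) :=
    (isOpen_iUnion D.system.isOpen).sdiff hS
  have htU : γ.extend t ∈ (⋃ α, D.system.O α) \ singularSet n f :=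
    ⟨mem_iUnion.2 ⟨α, hα t ht⟩, hts⟩
  refine ⟨?_, ?_⟩
  · exact ContinuousAt.comp (f := γ.extend)
      (D.system.isUnitNormalField.1.continuousAt (hU.mem_nhds htU)) γ.continuous_extend.continuousAt
  · filter_upwards [γ.continuous_extend.continuousAt.eventually_mem (hU.mem_nhds htU)] with t' ht'
    exact D.system.isUnitNormalField.isUnitNormalAt (hU.mem_nhds ht')

/-- Every unit normal field along `I_j` is `μ` or its opposite, so a crossing means that the inward
vector changes its sign relative to `μ`. -/
theorem crosses_iff (hf : IsAFront g f) (hS : IsClosed (singularSet n f))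
    (hμ : IsUnitNormalAlong g f γ 0 1 μ) {j : ℕ} (hj : j < D.m) :
    D.Crosses (j + 1) ↔ relativeSign (μ (D.a (j + 1))) (D.fieldAlong (D.a (j + 1))) ≠
      relativeSign (μ (D.b (j + 1))) (D.fieldAlong (D.b (j + 1))) := by
  have hab := D.a_lt_b (j + 1) (by omega) hj
  have ha : D.a (j + 1) ∈ Icc (D.b j) (D.a (j + 1)) := right_mem_Icc.2 (D.b_lt_a j hj.le).le
  have hb : D.b (j + 1) ∈ Icc (D.b (j + 1)) (D.a (j + 1 + 1)) :=
    left_mem_Icc.2 (D.b_lt_a (j + 1) hj).le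
  have ha1 := D.mem_Icc_of_mem hj.le ha
  have hb1 := D.mem_Icc_of_mem hj hb
  have hfa := (D.eventually_isUnitNormalAt hS (by omega) hj (left_mem_Icc.2 hab.le)
    (D.notMem_singularSet hj.le ha)).2.self_of_nhds
  have hfb := (D.eventually_isUnitNormalAt hS (by omega) hj (right_mem_Icc.2 hab.le)
    (D.notMem_singularSet hj hb)).2.self_of_nhds
  have hμa := hμ.2 _ ha1
  have hμb := hμ.2 _ hb1
  have hμ' := hμ.mono ha1.1 hb1.2
  constructor
  · rintro ⟨η, hη, hη1, hη2⟩
    change η _ = D.fieldAlong _ at hη1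
    change _ = D.fieldAlong _ at hη2
    rcases relativeSign_cases hf hμa hfa with ⟨h1, h2⟩ | ⟨h1, h2⟩
    · have h3 := hη.eqOn hf hμ' (left_mem_Icc.2 hab.le) (hη1.trans h2) (right_mem_Icc.2 hab.le)
      rw [h1, ← hη2, h3, relativeSign, if_neg hμb.ne_oppositeVector]
      decide
    · have h3 := hη.eqOn hf hμ'.oppositeVector (left_mem_Icc.2 hab.le) (hη1.trans h2)
        (right_mem_Icc.2 hab.le)
      rw [h1, ← hη2, h3, relativeSign, if_pos (oppositeVector_oppositeVector _)]
      decide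
  · intro hne
    rcases relativeSign_cases hf hμa hfa with ⟨h1, h2⟩ | ⟨h1, h2⟩ <;>
      rcases relativeSign_cases hf hμb hfb with ⟨h3, h4⟩ | ⟨h3, h4⟩
    · exact absurd (h1.trans h3.symm) hne
    · exact ⟨μ, hμ', h2.symm, h4.symm⟩
    · exact ⟨_, hμ'.oppositeVector, h2.symm, (oppositeVector_oppositeVector _).trans h4.symm⟩
    · exact absurd (h1.trans h3.symm) hne

/-- Between two intervals the loop is regular and `⌊H⌋` is constant. On an interval, the side where
`μ` is inward extends to the regular parameters away from the singular ones, because the inward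
field is defined on all of `O_α` off the singular set. The jump of `⌊H⌋` can then be read off at the
end points. -/
theorem floor_eq (hf : IsAFront g f) (hS : IsClosed (singularSet n f))
    (hμc : Continuous μ) (hμ : ∀ t, IsUnitNormalAt g f (γ.extend t) (μ t))
    {w : M → TangentBundle (𝓡 (n + 1)) N}
    (hw : ∀ p ∈ singularSet n f, ∀ᶠ q in 𝓝 p, q ∉ singularSet n f →
      fieldLift f D.system.field q = w q) {H : ℝ → ℝ}
    (hH : CountsCrossings (γ.extend ⁻¹' singularSet n f) {t | μ t = w (γ.extend t)} H)
    {j : ℕ} (hj : j < D.m) :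
    2 * (⌊H (D.b (j + 1))⌋ - ⌊H (D.b j)⌋) =
      (relativeSign (μ (D.b (j + 1))) (D.fieldAlong (D.b (j + 1))) : ℤ) -
      relativeSign (μ (D.a (j + 1))) (D.fieldAlong (D.a (j + 1))) := by
  classical
  have hab := D.a_lt_b (j + 1) (by omega) hj
  have ha : D.a (j + 1) ∈ Icc (D.b j) (D.a (j + 1)) := right_mem_Icc.2 (D.b_lt_a j hj.le).le
  have hb : D.b (j + 1) ∈ Icc (D.b (j + 1)) (D.a (j + 1 + 1)) :=
    left_mem_Icc.2 (D.b_lt_a (j + 1) hj).le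
  have h1 : ⌊H (D.b j)⌋ = ⌊H (D.a (j + 1))⌋ :=
    hH.floor_eq_of_disjoint isPreconnected_Icc (fun t ht => D.notMem_singularSet hj.le ht)
      (left_mem_Icc.2 (D.b_lt_a j hj.le).le) ha
  have h2 := hH.floor_add_eq (S := Icc (D.a (j + 1)) (D.b (j + 1)))
    (Q := {t | D.fieldAlong t = μ t}) isPreconnected_Icc ?_ ?_ (left_mem_Icc.2 hab.le)
    (right_mem_Icc.2 hab.le)
  · have h3 : ∀ t, t ∉ γ.extend ⁻¹' singularSet n f →
        ((if t ∉ γ.extend ⁻¹' singularSet n f ∧ t ∉ {t | D.fieldAlong t = μ t} then 1 else 0 : ℤ) =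
        if D.fieldAlong t = μ t then 0 else 1) := by
      intro t ht
      by_cases h : D.fieldAlong t = μ t <;> simp [ht, h]
    rw [h3 _ (D.notMem_singularSet hj.le ha), h3 _ (D.notMem_singularSet hj hb)] at h2
    rw [h1, relativeSign, relativeSign]
    split_ifs at h2 ⊢ <;> push_cast <;> omega
  · intro t ht hts
    obtain ⟨h3, h4⟩ := D.eventually_isUnitNormalAt hS (by omega) hj ht hts
    refine eventually_nhdsWithin_of_eventually_nhds ?_
    have h5 : ContinuousAt (fun t => vectorInner g (μ t) (D.fieldAlong t)) t := by
      rw [← continuousWithinAt_univ]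
      refine continuousWithinAt_vectorInner g hμc.continuousAt.continuousWithinAt
        h3.continuousWithinAt (Eventually.of_forall fun t => ?_) ?_
      · exact (hμ t).proj_eq
      · exact (hμ t).proj_eq
    have h6 : ∀ t', IsUnitNormalAt g f (γ.extend t') (D.fieldAlong t') →
        (D.fieldAlong t' = μ t' ∧ vectorInner g (μ t') (D.fieldAlong t') = 1) ∨
        (¬ D.fieldAlong t' = μ t' ∧ vectorInner g (μ t') (D.fieldAlong t') = -1) := by
      intro t' ht'
      rcases hf.eq_or_eq (hμ t') ht' with h | h
      · left; rw [h]; exact ⟨rfl, (hμ t').vectorInner_self⟩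
      · right; rw [h, vectorInner_oppositeVector, (hμ t').vectorInner_self]
        exact ⟨(hμ t').ne_oppositeVector, rfl⟩
    rcases h6 t h4.self_of_nhds with h7 | h7
    · filter_upwards [h4, h5.eventually (lt_mem_nhds (one_pos.trans_eq h7.2.symm))] with t' h8 h9
      rcases h6 t' h8 with h10 | h10
      · exact ⟨fun _ => h7.1, fun _ => h10.1⟩
      · rw [h10.2] at h9; norm_num at h9
    · filter_upwards [h4, h5.eventually (gt_mem_nhds (h7.2.trans_lt (neg_lt_zero.2 one_pos)))]
        with t' h8 h9
      rcases h6 t' h8 with h10 | h10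
      · rw [h10.2] at h9; norm_num at h9
      · exact ⟨fun h => absurd h h10.1, fun h => absurd h h7.1⟩
  · intro t ht hts
    refine eventually_nhdsWithin_of_eventually_nhds ?_
    filter_upwards [γ.continuous_extend.continuousAt.eventually (hw _ hts)] with t' ht' hts'
    rw [← ht' hts']
    exact eq_comm

/-- The field that starts at the inward vector is `μ` or its opposite on the whole regular interval,
as decided at its starting point. For `j = 0` the start is `ν₀ = μ 0`, whence the convention `1`. -/
theorem normal_eq (hf : IsAFront g f) (hS : IsClosed (singularSet n f))
    (hμ : IsUnitNormalAlong g f γ 0 1 μ) (hμ0 : μ 0 = ν₀) {j : ℕ} (hj : j ≤ D.m) :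
    ((if j = 0 then 1 else relativeSign (μ (D.b j)) (D.fieldAlong (D.b j))) = 1 ∧
      D.normal j (D.a (j + 1)) = μ (D.a (j + 1))) ∨
    ((if j = 0 then 1 else relativeSign (μ (D.b j)) (D.fieldAlong (D.b j))) = -1 ∧
      D.normal j (D.a (j + 1)) = oppositeVector (μ (D.a (j + 1)))) := by
  have hlt := (D.b_lt_a j hj).le
  have hb1 := D.mem_Icc_of_mem hj (left_mem_Icc.2 hlt)
  have ha1 := D.mem_Icc_of_mem hj (right_mem_Icc.2 hlt)
  have hμ' := hμ.mono hb1.1 ha1.2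
  by_cases h0 : j = 0
  · left
    subst h0
    refine ⟨if_pos rfl, (D.isUnitNormalAlong 0 hj).eqOn hf hμ' (left_mem_Icc.2 hlt) ?_
      (right_mem_Icc.2 hlt)⟩
    rw [D.normal_zero, D.b_zero, hμ0]
  · rw [if_neg h0]
    have hj1 : 1 ≤ j := Nat.one_le_iff_ne_zero.2 h0
    have hfb := (D.eventually_isUnitNormalAt hS hj1 hj (right_mem_Icc.2 (D.a_lt_b j hj1 hj).le)
      (D.notMem_singularSet hj (left_mem_Icc.2 hlt))).2.self_of_nhds
    have hs : D.normal j (D.b j) = D.fieldAlong (D.b j) := D.normal_start j hj1 hj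
    rcases relativeSign_cases hf (hμ.2 _ hb1) hfb with ⟨h1, h2⟩ | ⟨h1, h2⟩
    · exact Or.inl ⟨h1, (D.isUnitNormalAlong j hj).eqOn hf hμ' (left_mem_Icc.2 hlt)
        (hs.trans h2) (right_mem_Icc.2 hlt)⟩
    · exact Or.inr ⟨h1, (D.isUnitNormalAlong j hj).eqOn hf hμ'.oppositeVector (left_mem_Icc.2 hlt)
        (hs.trans h2) (right_mem_Icc.2 hlt)⟩

/-- The comparison defining `ε (j + 1)` is split into two comparisons with the global field `μ`. At
the very end the reference vector is `ν₀ = μ 1`, so the last factor is `1`. -/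
theorem ε_eq (hf : IsAFront g f) (hS : IsClosed (singularSet n f))
    (hμ : IsUnitNormalAlong g f γ 0 1 μ) (hμ0 : μ 0 = ν₀) (hμ1 : μ 1 = ν₀) {j : ℕ}
    (hj : j ≤ D.m) :
    D.ε (j + 1) = D.ε j * (if j = 0 then 1 else relativeSign (μ (D.b j)) (D.fieldAlong (D.b j))) *
      (if j + 1 = D.m + 1 then 1 else
        relativeSign (μ (D.a (j + 1))) (D.fieldAlong (D.a (j + 1)))) := by
  have hlt := (D.b_lt_a j hj).le
  have ha1 := D.mem_Icc_of_mem hj (right_mem_Icc.2 hlt)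
  have hμa := hμ.2 _ ha1
  have key : ∀ (T u : TangentBundle (𝓡 (n + 1)) N) (x y e e' : ℤˣ),
      (x = 1 ∧ u = μ (D.a (j + 1)) ∨ x = -1 ∧ u = oppositeVector (μ (D.a (j + 1)))) →
      (y = 1 ∧ T = μ (D.a (j + 1)) ∨ y = -1 ∧ T = oppositeVector (μ (D.a (j + 1)))) →
      (u = T ∧ e' = e ∨ oppositeVector u = T ∧ e' = -e) → e' = e * x * y := by
    rintro T u x y e e' (⟨rfl, rfl⟩ | ⟨rfl, rfl⟩) (⟨rfl, rfl⟩ | ⟨rfl, rfl⟩) (⟨h, rfl⟩ | ⟨h, rfl⟩)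
    · simp
    · exact absurd h hμa.ne_oppositeVector
    · exact absurd h.symm hμa.ne_oppositeVector
    · simp
    · exact absurd h hμa.ne_oppositeVector
    · simp
    · simp
    · exact absurd h hμa.oppositeVector.ne_oppositeVector
  have hn := D.normal_eq hf hS hμ hμ0 hj
  rcases hj.lt_or_eq with hj' | rfl
  · have hfa := (D.eventually_isUnitNormalAt hS (by omega) hj' (left_mem_Icc.2
      (D.a_lt_b (j + 1) (by omega) hj').le) (D.notMem_singularSet hj (right_mem_Icc.2 hlt))).2.self_of_nhds
    rw [if_neg (by omega : ¬ j + 1 = D.m + 1)]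
    exact key _ _ _ _ _ _ hn (relativeSign_cases hf hμa hfa) (D.ε_step j hj')
  · rw [if_pos rfl]
    refine key ν₀ _ _ _ _ _ hn (Or.inl ⟨rfl, ?_⟩) D.ε_last
    rw [D.a_last, hμ1]

/-- The zig-zag number in terms of a counting function along the loop. -/
theorem minusCount_signs (hf : IsAFront g f) (hS : IsClosed (singularSet n f))
    (hμc : Continuous μ) (hμ : ∀ t, IsUnitNormalAt g f (γ.extend t) (μ t))
    (hμ0 : μ 0 = ν₀) (hμ1 : μ 1 = ν₀) {w : M → TangentBundle (𝓡 (n + 1)) N}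
    (hw : ∀ p ∈ singularSet n f, ∀ᶠ q in 𝓝 p, q ∉ singularSet n f →
      fieldLift f D.system.field q = w q) {H : ℝ → ℝ}
    (hH : CountsCrossings (γ.extend ⁻¹' singularSet n f) {t | μ t = w (γ.extend t)} H) :
    (minusCount D.signs : ℤ) = |(⌊H 1⌋ - ⌊H 0⌋) / 2| ∧
      (D.ε (D.m + 1) = 1 ↔ Even (⌊H 1⌋ - ⌊H 0⌋)) := by
  classical
  have hμ' : IsUnitNormalAlong g f γ 0 1 μ := ⟨hμc.continuousOn, fun t _ => hμ t⟩
  have h1 := alternatingSum_signs D.ε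
    (fun j => if j = D.m + 1 then 1 else relativeSign (μ (D.a j)) (D.fieldAlong (D.a j)))
    (fun j => if j = 0 then 1 else relativeSign (μ (D.b j)) (D.fieldAlong (D.b j)))
    (fun j => ⌊H (D.b j)⌋) (fun j => decide (D.Crosses j)) D.m D.ε_zero (if_pos rfl) (if_pos rfl)
    (fun j hj => D.ε_eq hf hS hμ' hμ0 hμ1 hj) (fun j hj => ?_) (fun j hj => ?_)
  · have h2 : ⌊H (D.b D.m)⌋ = ⌊H 1⌋ := by
      rw [← D.a_last]
      exact hH.floor_eq_of_disjoint isPreconnected_Icc (fun t ht => D.notMem_singularSet le_rfl ht)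
        (left_mem_Icc.2 (D.b_lt_a _ le_rfl).le) (right_mem_Icc.2 (D.b_lt_a _ le_rfl).le)
    simp only [D.b_zero, h2] at h1
    refine ⟨?_, h1.2⟩
    rw [minusCount_eq, ← h1.1, signs]
  · simp only [if_neg (by omega : ¬ j + 1 = D.m + 1), if_neg (Nat.succ_ne_zero j)]
    exact D.floor_eq hf hS hμc hμ hw hH hj
  · simp only [if_neg (by omega : ¬ j + 1 = D.m + 1), if_neg (Nat.succ_ne_zero j),
      decide_eq_true_eq]
    exact D.crosses_iff hf hS hμ' hj

end SignedSubdivision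

end Subdivisions

/-! ### Subdivisions of the unit interval -/

section RealSubdivision

/-- Passing over the first part of a closed set that is covered by disjoint open sets. -/
theorem exists_next_interval {ι : Type*} {K : Set ℝ} (hK : IsClosed K) {U : ι → Set ℝ}
    (hU : ∀ i, IsOpen (U i)) (hd : ∀ i j, i ≠ j → Disjoint (U i) (U j)) (hKU : K ⊆ ⋃ i, U i)
    (h1 : (1 : ℝ) ∉ K) {δ : ℝ} (hδ : 0 < δ)
    (hδK : ∀ y ∈ K ∩ Icc 0 1, ∃ i, Metric.ball y δ ⊆ U i)
    {x : ℝ} (hx0 : 0 ≤ x) (hxK : x ∉ K) (hne : (K ∩ Icc x 1).Nonempty) :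
    ∃ a b : ℝ, x < a ∧ a < b ∧ b < 1 ∧ b ∉ K ∧ (∀ t ∈ Icc x a, t ∉ K) ∧
      (∃ i, Icc a b ⊆ U i) ∧ (x + δ / 2 ≤ b ∨ ¬ (K ∩ Icc b 1).Nonempty) := by
  obtain ⟨y, ⟨hyK, hyx, hy1⟩, hymin⟩ := (isCompact_Icc.inter_left hK).exists_isLeast hne
  have hxy : x < y := lt_of_le_of_ne hyx (fun h => hxK (h ▸ hyK))
  have hy1' : y < 1 := lt_of_le_of_ne hy1 (fun h => h1 (h ▸ hyK))
  obtain ⟨i, hyi⟩ := mem_iUnion.1 (hKU hyK)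
  have hball : Metric.ball y δ ⊆ U i := by
    obtain ⟨j, hj⟩ := hδK y ⟨hyK, hx0.trans hyx, hy1⟩
    by_cases hij : i = j
    · rwa [hij]
    · exact absurd (hj (Metric.mem_ball_self hδ)) (Set.disjoint_left.1 (hd i j hij) hyi)
  -- Starting from the first point `y` of `K`, go to the first exit `z` from `U i`. It is not in
  -- `K`, as otherwise another open set of the family would contain `z` and meet `U i`.
  have hz : ∃ z, y < z ∧ z ≤ 1 ∧ z ∉ K ∧ (∀ t, y ≤ t → t < z → t ∈ U i) ∧ (z = 1 ∨ y + δ ≤ z) := by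
    by_cases hE : (Icc y 1 ∩ (U i)ᶜ).Nonempty
    · obtain ⟨z, ⟨⟨hyz, hz1⟩, hzU⟩, hzmin⟩ :=
        (isCompact_Icc.inter_right (hU i).isClosed_compl).exists_isLeast hE
      have hlt : ∀ t, y ≤ t → t < z → t ∈ U i := by
        intro t h2 h3
        by_contra h4
        exact absurd (hzmin ⟨⟨h2, (h3.trans_le hz1).le⟩, h4⟩) (not_le.2 h3)
      have hyz' : y < z := lt_of_le_of_ne hyz (fun h => hzU (h ▸ hyi))
      refine ⟨z, hyz', hz1, fun hzK => ?_, hlt, Or.inr ?_⟩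
      · obtain ⟨j, hzj⟩ := mem_iUnion.1 (hKU hzK)
        have hij : i ≠ j := fun h => hzU (h ▸ hzj)
        obtain ⟨l, hl, hlU⟩ := exists_Ioc_subset_of_mem_nhds ((hU j).mem_nhds hzj) ⟨y, hyz'⟩
        have h2 : max l y < z := max_lt hl hyz'
        have h3 : (max l y + z) / 2 ∈ U j :=
          hlU ⟨by linarith [le_max_left l y], by linarith⟩
        have h4 : (max l y + z) / 2 ∈ U i := hlt _ (by linarith [le_max_right l y]) (by linarith)
        exact Set.disjoint_left.1 (hd i j hij) h4 h3
      · by_contra h2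
        refine hzU (hball ?_)
        rw [Metric.mem_ball, Real.dist_eq, abs_lt]
        constructor <;> linarith
    · refine ⟨1, hy1', le_rfl, h1, fun t h2 h3 => ?_, Or.inl rfl⟩
      by_contra h4
      exact hE ⟨t, ⟨h2, h3.le⟩, h4⟩
  obtain ⟨z, hyz, hz1, hzK, hzU, hz2⟩ := hz
  obtain ⟨η, hη, hηK⟩ := Metric.mem_nhds_iff.1 (hK.isOpen_compl.mem_nhds hzK)
  have hηK' : ∀ t, z - η < t → t ≤ z → t ∉ K := by
    intro t h2 h3
    refine hηK ?_
    rw [Metric.mem_ball, Real.dist_eq, abs_lt]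
    constructor <;> linarith
  -- `b` lies so close to `z` that `K` does not meet `[b, z]`. It lies beyond `y`, and at most `δ /
  -- 2` before `z`, so each step gains at least `δ / 2` unless `z = 1`.
  set b := max (max (z - η / 2) (z - δ / 2)) ((y + z) / 2) with hb
  have hbz : b < z := by
    rw [hb, max_lt_iff, max_lt_iff]; refine ⟨⟨?_, ?_⟩, ?_⟩ <;> linarith
  have hb1 : z - η / 2 ≤ b := (le_max_left _ _).trans (le_max_left _ _)
  have hb2 : z - δ / 2 ≤ b := (le_max_right _ _).trans (le_max_left _ _)
  have hb3 : (y + z) / 2 ≤ b := le_max_right _ _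
  -- `a` lies strictly between `x` and `y` and within `δ` of `y`, so that `[a, y]` is still in `U
  -- i`.
  set a := max ((x + y) / 2) (y - δ / 2) with ha
  have hay : a < y := by rw [ha, max_lt_iff]; constructor <;> linarith
  have ha1 : (x + y) / 2 ≤ a := le_max_left _ _
  have ha2 : y - δ / 2 ≤ a := le_max_right _ _
  refine ⟨a, b, by linarith, by linarith, by linarith, hηK' b (by linarith) hbz.le, ?_,
    ⟨i, ?_⟩, ?_⟩
  · intro t ht htK
    have h2 : t < y := ht.2.trans_lt hay
    exact absurd (hymin ⟨htK, ht.1, (h2.trans hy1').le⟩) (not_le.2 h2)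
  · intro t ht
    rcases lt_or_ge t y with h2 | h2
    · refine hball ?_
      rw [Metric.mem_ball, Real.dist_eq, abs_lt]
      constructor <;> linarith [ht.1]
    · exact hzU t h2 (ht.2.trans_lt hbz)
  · rcases hz2 with rfl | h2
    · right
      rintro ⟨t, htK, ht⟩
      exact hηK' t (by linarith [ht.1]) ht.2 htK
    · left; linarith

/-- Subdivision of the unit interval such that a closed set is contained in subintervals contained
in given disjoint open sets. -/
theorem exists_subdivision {ι : Type*} {K : Set ℝ} (hK : IsClosed K) {U : ι → Set ℝ}
    (hU : ∀ i, IsOpen (U i)) (hd : ∀ i j, i ≠ j → Disjoint (U i) (U j)) (hKU : K ⊆ ⋃ i, U i)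
    (h0 : (0 : ℝ) ∉ K) (h1 : (1 : ℝ) ∉ K) :
    ∃ (m : ℕ) (a b : ℕ → ℝ), b 0 = 0 ∧ a (m + 1) = 1 ∧ (∀ j ≤ m, b j < a (j + 1)) ∧
      (∀ j, 1 ≤ j → j ≤ m → a j < b j) ∧
      (∀ t ∈ Icc (0 : ℝ) 1, t ∈ K → ∃ j, 1 ≤ j ∧ j ≤ m ∧ t ∈ Ioo (a j) (b j)) ∧
      ∀ j, 1 ≤ j → j ≤ m → ∃ i, Icc (a j) (b j) ⊆ U i := by
  obtain ⟨δ, hδ, hδK⟩ := lebesgue_number_lemma_of_metric (isCompact_Icc.inter_left hK) hU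
    (inter_subset_left.trans hKU : K ∩ Icc (0 : ℝ) 1 ⊆ _)
  have hstep : ∀ x : ℝ, ∃ a b : ℝ, 0 ≤ x → x ∉ K → (K ∩ Icc x 1).Nonempty →
      x < a ∧ a < b ∧ b < 1 ∧ b ∉ K ∧ (∀ t ∈ Icc x a, t ∉ K) ∧
      (∃ i, Icc a b ⊆ U i) ∧ (x + δ / 2 ≤ b ∨ ¬ (K ∩ Icc b 1).Nonempty) := by
    intro x
    by_cases h : 0 ≤ x ∧ x ∉ K ∧ (K ∩ Icc x 1).Nonempty
    · obtain ⟨a, b, h2⟩ := exists_next_interval hK hU hd hKU h1 hδ hδK h.1 h.2.1 h.2.2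
      exact ⟨a, b, fun _ _ _ => h2⟩
    · exact ⟨0, 0, fun h2 h3 h4 => absurd ⟨h2, h3, h4⟩ h⟩
  choose na nb hn using hstep
  let b : ℕ → ℝ := fun j => nb^[j] 0
  have hb0 : b 0 = 0 := rfl
  have hbs : ∀ j, b (j + 1) = nb (b j) := fun j => Function.iterate_succ_apply' nb j 0
  have hgood : ∀ j, (∀ i < j, (K ∩ Icc (b i) 1).Nonempty) → 0 ≤ b j ∧ b j < 1 ∧ b j ∉ K := by
    intro j
    induction j with
    | zero => intro _; rw [hb0]; exact ⟨le_rfl, one_pos, h0⟩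
    | succ j ih =>
      intro h
      obtain ⟨h2, h3, h4⟩ := ih (fun i hi => h i (by omega))
      obtain ⟨h5, h6, h7, h8, -⟩ := hn (b j) h2 h4 (h j (by omega))
      rw [hbs]
      exact ⟨by linarith, h7, h8⟩
  -- While points of `K` remain ahead, each step advances by `δ / 2` but stays below `1`, so the
  -- process stops.
  have hend : ∃ j, ¬ (K ∩ Icc (b j) 1).Nonempty := by
    by_contra hcon
    push Not at hcon
    have h2 : ∀ j : ℕ, j * (δ / 2) ≤ b j := by
      intro j
      induction j with
      | zero => simp [hb0]
      | succ j ih =>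
        obtain ⟨h3, -, h4⟩ := hgood j (fun i _ => hcon i)
        obtain ⟨-, -, -, -, -, -, h5⟩ := hn (b j) h3 h4 (hcon j)
        rw [← hbs] at h5
        have h6 := h5.resolve_right (not_not.2 (hcon (j + 1)))
        push_cast
        linarith
    obtain ⟨j, hj⟩ := exists_nat_gt (1 / (δ / 2))
    have h3 := (hgood j (fun i _ => hcon i)).2.1
    rw [div_lt_iff₀ (half_pos hδ)] at hj
    linarith [h2 j]
  classical
  set m := Nat.find hend with hm
  have hm1 : ¬ (K ∩ Icc (b m) 1).Nonempty := Nat.find_spec hend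
  have hm2 : ∀ i < m, (K ∩ Icc (b i) 1).Nonempty := fun i hi => not_not.1 (Nat.find_min hend hi)
  have hg : ∀ j ≤ m, 0 ≤ b j ∧ b j < 1 ∧ b j ∉ K := fun j hj =>
    hgood j (fun i hi => hm2 i (by omega))
  let a : ℕ → ℝ := fun j => if j ≤ m then na (b (j - 1)) else 1
  have hs : ∀ j < m, b j < a (j + 1) ∧ a (j + 1) < b (j + 1) ∧
      (∀ t ∈ Icc (b j) (a (j + 1)), t ∉ K) ∧ ∃ i, Icc (a (j + 1)) (b (j + 1)) ⊆ U i := by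
    intro j hj
    have ha : a (j + 1) = na (b j) := by
      simp only [a, if_pos (by omega : j + 1 ≤ m), Nat.add_sub_cancel]
    obtain ⟨h2, h3, h4, h5, h6, h7, -⟩ := hn (b j) (hg j hj.le).1 (hg j hj.le).2.2 (hm2 j hj)
    rw [ha, hbs]
    exact ⟨h2, h3, h6, h7⟩
  have ham : a (m + 1) = 1 := if_neg (by omega)
  have hcov : ∀ j ≤ m, ∀ t, 0 ≤ t → t < b j → t ∈ K → ∃ i, 1 ≤ i ∧ i ≤ m ∧ t ∈ Ioo (a i) (b i) := by
    intro j
    induction j with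
    | zero => intro _ t h2 h3; rw [hb0] at h3; linarith
    | succ j ih =>
      intro hj t h2 h3 h4
      rcases lt_or_ge t (b j) with h5 | h5
      · exact ih (by omega) t h2 h5 h4
      · refine ⟨j + 1, by omega, hj, ?_, h3⟩
        by_contra h6
        exact (hs j (by omega)).2.2.1 t ⟨h5, not_lt.1 h6⟩ h4
  refine ⟨m, a, b, hb0, ham, fun j hj => ?_, fun j hj1 hj => ?_, fun t ht htK => ?_,
    fun j hj1 hj => ?_⟩
  · rcases hj.lt_or_eq with h2 | rfl
    · exact (hs j h2).1
    · rw [ham]; exact (hg _ le_rfl).2.1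
  · obtain ⟨i, rfl⟩ := Nat.exists_eq_add_of_le' hj1
    exact (hs i (by omega)).2.1
  · refine hcov m le_rfl t ht.1 ?_ htK
    by_contra h2
    exact hm1 ⟨t, htK, not_lt.1 h2, ht.2⟩
  · obtain ⟨i, rfl⟩ := Nat.exists_eq_add_of_le' hj1
    exact (hs i (by omega)).2.2.2

end RealSubdivision

/-! ### Existence of signed subdivisions -/

section ExistenceOfSubdivisions

variable {n : ℕ} [NeZero n]
  {M : Type*} [TopologicalSpace M] [ChartedSpace (EuclideanSpace ℝ (Fin n)) M]
  {N : Type*} [TopologicalSpace N] [ChartedSpace (EuclideanSpace ℝ (Fin (n + 1))) N]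
  [IsManifold (𝓡 (n + 1)) ∞ N] {g : SmoothMetric n N} {f : M → N} {o : M} {γ : Path o o}
  {μ : ℝ → TangentBundle (𝓡 (n + 1)) N} {ν₀ : TangentBundle (𝓡 (n + 1)) N}

theorem nonempty_signedSubdivision (hf : IsAFront g f) (hS : IsClosed (singularSet n f))
    (ho : o ∉ singularSet n f) (system : InwardSystem g f)
    (hμ : IsUnitNormalAlong g f γ 0 1 μ) (hμ0 : μ 0 = ν₀) (hμ1 : μ 1 = ν₀) :
    Nonempty (SignedSubdivision g f ν₀ γ) := by
  obtain ⟨m, a, b, hb0, ham, hba, hab, hcov, hmaps⟩ := exists_subdivision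
    (K := γ.extend ⁻¹' singularSet n f) (U := fun α => γ.extend ⁻¹' system.O α)
    (hS.preimage γ.continuous_extend) (fun α => (system.isOpen α).preimage γ.continuous_extend)
    (fun α β h => (system.disjoint α β h).preimage _)
    (fun t ht => mem_iUnion.2 ⟨_, system.mem ⟨γ.extend t, ht⟩⟩)
    (by simpa using ho) (by simpa using ho)
  have hbm : ∀ j ≤ m, ∀ i ≤ j, b i ≤ b j := by
    intro j hj i hij
    induction j, hij using Nat.le_induction with
    | base => exact le_rfl
    | succ j hij ih =>
      exact (ih (by omega)).trans ((hba j (by omega)).trans (hab _ (by omega) hj)).le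
  have ham' : ∀ j ≤ m + 1, ∀ i, 1 ≤ i → i ≤ j → a i ≤ a j := by
    intro j hj i hi hij
    induction j, hij using Nat.le_induction with
    | base => exact le_rfl
    | succ j hij ih =>
      exact (ih (by omega)).trans ((hab j (by omega) (by omega)).trans (hba _ (by omega))).le
  have hmem : ∀ j ≤ m, ∀ t ∈ Icc (b j) (a (j + 1)), t ∈ Icc (0 : ℝ) 1 ∧
      γ.extend t ∉ singularSet n f := by
    intro j hj t ht
    have h1 : t ∈ Icc (0 : ℝ) 1 := by
      refine ⟨?_, ?_⟩
      · rw [← hb0]; exact (hbm j hj 0 (Nat.zero_le _)).trans ht.1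
      · rw [← ham]; exact ht.2.trans (ham' _ le_rfl _ (by omega) (by omega))
    refine ⟨h1, fun hs => ?_⟩
    obtain ⟨i, hi1, hi2, hi3⟩ := hcov t h1 hs
    rcases le_or_gt i j with h | h
    · exact absurd (hi3.2.trans_le (hbm j hj i h)) (not_lt.2 ht.1)
    · exact absurd (hi3.1.trans_le ht.2) (not_lt.2 (ham' i (by omega) _ (by omega) h))
  let fld : ℝ → TangentBundle (𝓡 (n + 1)) N := fun t => fieldLift f system.field (γ.extend t)
  have hfld : ∀ j, 1 ≤ j → j ≤ m → ∀ t ∈ Icc (a j) (b j), γ.extend t ∉ singularSet n f →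
      IsUnitNormalAt g f (γ.extend t) (fld t) := by
    intro j hj1 hj t ht hts
    obtain ⟨α, hα⟩ := hmaps j hj1 hj
    exact system.isUnitNormalField.isUnitNormalAt
      (((isOpen_iUnion system.isOpen).sdiff hS).mem_nhds ⟨mem_iUnion.2 ⟨α, hα ht⟩, hts⟩)
  -- The formula that every subdivision must satisfy serves as the definition: `A` and `B` compare
  -- the reference vectors with `μ`, and the exceptional values `1` belong to `ν₀` at the two ends
  -- of the loop. The normal fields are `μ` or its opposite.
  let A : ℕ → ℤˣ := fun j => if j = m + 1 then 1 else relativeSign (μ (a j)) (fld (a j))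
  let B : ℕ → ℤˣ := fun j => if j = 0 then 1 else relativeSign (μ (b j)) (fld (b j))
  let ε : ℕ → ℤˣ := fun j => Nat.rec 1 (fun j e => e * B j * A (j + 1)) j
  have hε : ∀ j, ε (j + 1) = ε j * B j * A (j + 1) := fun j => rfl
  let normal : ℕ → ℝ → TangentBundle (𝓡 (n + 1)) N := fun j t =>
    if B j = 1 then μ t else oppositeVector (μ t)
  have key : ∀ j ≤ m, ∀ T : TangentBundle (𝓡 (n + 1)) N,
      (A (j + 1) = 1 ∧ T = μ (a (j + 1)) ∨ A (j + 1) = -1 ∧ T = oppositeVector (μ (a (j + 1)))) →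
      (normal j (a (j + 1)) = T ∧ ε (j + 1) = ε j) ∨
        (oppositeVector (normal j (a (j + 1))) = T ∧ ε (j + 1) = -ε j) := by
    intro j _ T hT
    rw [hε]
    by_cases hB : B j = 1
    · simp only [normal, hB, if_true]
      rcases hT with ⟨h1, rfl⟩ | ⟨h1, rfl⟩ <;> rw [h1]
      · left; simp
      · right; simp
    · have hB' : B j = -1 := (Int.units_eq_one_or _).resolve_left hB
      simp only [normal, hB, if_false]
      rcases hT with ⟨h1, rfl⟩ | ⟨h1, rfl⟩ <;> rw [h1, hB']
      · right; exact ⟨oppositeVector_oppositeVector _, by simp⟩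
      · left; simp
  refine ⟨⟨system, m, a, b, hb0, ham, hba, hab, hcov, fun j hj1 hj => ?_, normal, fun j hj => ?_,
    ?_, fun j hj1 hj => ?_, ε, rfl, fun j hj => ?_, ?_⟩⟩
  · obtain ⟨α, hα⟩ := hmaps j hj1 hj
    exact ⟨α, fun t ht => hα ht⟩
  · have h1 := hmem j hj _ (left_mem_Icc.2 (hba j hj).le)
    have h2 := hmem j hj _ (right_mem_Icc.2 (hba j hj).le)
    have h3 := hμ.mono h1.1.1 h2.1.2
    by_cases hB : B j = 1
    · simpa only [normal, hB, if_true] using h3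
    · simpa only [normal, hB, if_false] using h3.oppositeVector
  · simp only [normal, B, if_true, hb0, hμ0]
  · have h1 := hmem j hj _ (left_mem_Icc.2 (hba j hj).le)
    have hBj : B j = relativeSign (μ (b j)) (fld (b j)) := if_neg (by omega)
    rcases relativeSign_cases hf (hμ.2 _ h1.1)
      (hfld j hj1 hj _ (right_mem_Icc.2 (hab j hj1 hj).le) h1.2) with ⟨h2, h3⟩ | ⟨h2, h3⟩
    · simp only [normal, hBj.trans h2, if_true]; exact h3.symm
    · simp only [normal, hBj.trans h2]
      rw [if_neg (by decide)]
      exact h3.symm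
  · refine key j hj.le _ ?_
    have h1 := hmem j hj.le _ (right_mem_Icc.2 (hba j hj.le).le)
    have hAj : A (j + 1) = relativeSign (μ (a (j + 1))) (fld (a (j + 1))) := if_neg (by omega)
    rw [hAj]
    exact relativeSign_cases hf (hμ.2 _ h1.1)
      (hfld (j + 1) (by omega) hj _ (left_mem_Icc.2 (hab (j + 1) (by omega) hj).le) h1.2)
  · refine key m le_rfl ν₀ (Or.inl ⟨if_pos rfl, ?_⟩)
    rw [ham, hμ1]

end ExistenceOfSubdivisions

/-! ### Squares of loops -/

section Squares

variable {n : ℕ} [NeZero n]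
  {M : Type*} [TopologicalSpace M] [ChartedSpace (EuclideanSpace ℝ (Fin n)) M]
  {N : Type*} [TopologicalSpace N] [ChartedSpace (EuclideanSpace ℝ (Fin (n + 1))) N]
  [IsManifold (𝓡 (n + 1)) ∞ N] {g : SmoothMetric n N}

theorem eventually_eq_iff_of_isUnitNormalAt {X : Type*} [TopologicalSpace X] {f : X → M → N}
    {p : X → M} {a b : X → TangentBundle (𝓡 (n + 1)) N} {x : X} (hf : ∀ x, IsAFront g (f x))
    (ha : ContinuousAt a x) (hb : ContinuousAt b x)
    (ha' : ∀ᶠ y in 𝓝 x, IsUnitNormalAt g (f y) (p y) (a y))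
    (hb' : ∀ᶠ y in 𝓝 x, IsUnitNormalAt g (f y) (p y) (b y)) :
    ∀ᶠ y in 𝓝 x, (a y = b y ↔ a x = b x) := by
  have hiff : ∀ y, IsUnitNormalAt g (f y) (p y) (a y) → IsUnitNormalAt g (f y) (p y) (b y) →
      (vectorInner g (a y) (b y) = 1 ∧ a y = b y) ∨
        (vectorInner g (a y) (b y) = -1 ∧ a y ≠ b y) := by
    intro y h1 h2
    rcases (hf y).eq_or_eq h1 h2 with h | h
    · rw [h]
      exact Or.inl ⟨h1.vectorInner_self, rfl⟩
    · rw [h, vectorInner_oppositeVector, h1.vectorInner_self]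
      exact Or.inr ⟨rfl, h1.ne_oppositeVector.symm⟩
  have hc : ContinuousAt (fun y => vectorInner g (a y) (b y)) x := by
    rw [← continuousWithinAt_univ]
    refine continuousWithinAt_vectorInner g ha.continuousWithinAt hb.continuousWithinAt ?_
      (ha'.self_of_nhds.proj_eq.trans hb'.self_of_nhds.proj_eq.symm)
    rw [nhdsWithin_univ]
    filter_upwards [ha', hb'] with y h1 h2
    exact h1.proj_eq.trans h2.proj_eq.symm
  rcases hiff x ha'.self_of_nhds hb'.self_of_nhds with ⟨h1, h2⟩ | ⟨h1, h2⟩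
  · filter_upwards [hc.eventually (lt_mem_nhds (h1.symm ▸ zero_lt_one)), ha', hb'] with y hy h3 h4
    rcases hiff y h3 h4 with ⟨-, h6⟩ | ⟨h5, -⟩
    · exact iff_of_true h6 h2
    · linarith
  · filter_upwards [hc.eventually (gt_mem_nhds (h1.symm ▸ neg_one_lt_zero)), ha', hb']
      with y hy h3 h4
    rcases hiff y h3 h4 with ⟨h5, -⟩ | ⟨-, h6⟩
    · linarith
    · exact iff_of_false h6 h2

variable {F : ℝ → M → N} {v : unitInterval × M → EuclideanSpace ℝ (Fin (n + 1))}

theorem IsAFrontDeformation.isClosed_singularSet [IsManifold (𝓡 n) ∞ M]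
    (hF : IsAFrontDeformation g F) (s : unitInterval) : IsClosed (singularSet n (F s)) :=
  hF.isClosed_singularFamily.preimage (f := fun q : M => (s, q)) (by fun_prop)

theorem IsInwardField.eventually_isUnitNormalAt [IsManifold (𝓡 n) ∞ M]
    (hF : IsAFrontDeformation g F) (hv : IsInwardField g F v) {y : unitInterval × M}
    (hy : y ∈ singularFamily n F) : ∀ᶠ z in 𝓝 y, z ∉ singularFamily n F →
      ContinuousAt (familyLift F v) z ∧
        ∀ᶠ z' in 𝓝 z, IsUnitNormalAt g (F z'.1) z'.2 (familyLift F v z') := by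
  filter_upwards [hv.isUnitNormal y hy, (hv.isUnitNormal y hy).eventually_nhds] with z hz hz' hzs
  refine ⟨(hz hzs).1, ?_⟩
  have h1 : ∀ᶠ z' in 𝓝 z, z' ∉ singularFamily n F :=
    hF.isClosed_singularFamily.isOpen_compl.mem_nhds hzs
  have h2 : ∀ᶠ z' in 𝓝 z,
      ContinuousAt (familyLift F v) z' ∧ IsUnitOrthogonal g (F z'.1) z'.2 (v z') := by
    filter_upwards [h1, hz'] with z' h3 h4 using h4 h3
  filter_upwards [h2.eventually_nhds] with z' h3
  have hc : Continuous (fun q : M => (z'.1, q)) := by fun_prop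
  refine ⟨_, (hc.continuousAt (x := z'.2)).eventually h3, fun q => v (z'.1, q), ⟨?_, ?_⟩, rfl⟩
  · intro q hq
    exact (ContinuousAt.comp (f := fun q : M => (z'.1, q)) hq.1 hc.continuousAt).continuousWithinAt
  · exact fun q hq => hq.2

variable {c : ℝ × ℝ → unitInterval × M} {G : ℝ × ℝ → TangentBundle (𝓡 (n + 1)) N}

/-- This is the hypothesis for a counting function on the plane: near the singular parameters, the
set where `G` is the inward vector is a locally constant side. -/
theorem IsInwardField.eventually_eq_iff [IsManifold (𝓡 n) ∞ M]
    (hF : IsAFrontDeformation g F) (hv : IsInwardField g F v) (hc : Continuous c)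
    (hG : Continuous G) (hG' : ∀ x, IsUnitNormalAt g (F (c x).1) (c x).2 (G x)) {x : ℝ × ℝ}
    (hx : c x ∈ singularFamily n F) : ∀ᶠ y in 𝓝 x, c y ∉ singularFamily n F →
      IsUnitNormalAt g (F (c y).1) (c y).2 (familyLift F v (c y)) ∧
        ∀ᶠ z in 𝓝 y, (G z = familyLift F v (c z) ↔ G y = familyLift F v (c y)) := by
  filter_upwards [hc.continuousAt.eventually (hv.eventually_isUnitNormalAt hF hx)] with y hy hys
  obtain ⟨h1, h2⟩ := hy hys
  have h3 := hc.continuousAt.eventually h2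
  exact ⟨h3.self_of_nhds, eventually_eq_iff_of_isUnitNormalAt (f := fun x => F (c x).1)
    (p := fun x => (c x).2) (fun x => hF.isAFront _ (c x).1.2) hG.continuousAt
    (ContinuousAt.comp (g := familyLift F v) h1 hc.continuousAt) (Eventually.of_forall hG') h3⟩

/-- `d` determines the signs of the loop `γ` up to cancellation. -/
def IsSignedCount (g : SmoothMetric n N) (f : M → N) {o : M} (ν₀ : TangentBundle (𝓡 (n + 1)) N)
    (γ : Path o o) (d : ℤ) : Prop :=
  Nonempty (SignedSubdivision g f ν₀ γ) ∧ ∀ D : SignedSubdivision g f ν₀ γ,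
    (minusCount D.signs : ℤ) = |d / 2| ∧ (D.ε (D.m + 1) = 1 ↔ Even d)

theorem IsSignedCount.zigzagNumber_eq {f : M → N} {o : M} {ν₀ : TangentBundle (𝓡 (n + 1)) N}
    {γ : Path o o} {d : ℤ} (h : IsSignedCount g f ν₀ γ d) :
    (zigzagNumber g f ν₀ γ : ℤ) = |d / 2| := by
  rw [zigzagNumber, dif_pos h.1]
  exact (h.2 _).1

/-- Co-orientability at one `r₀` closes the lift up there. Both `G (r, 0)` and `G (r, 1)` are normal
fields along the same curve of base points, so they then agree for every `r`. -/
theorem IsAFrontDeformation.exists_square_lift (hF : IsAFrontDeformation g F) (hc : Continuous c)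
    (hc01 : ∀ r, c (r, 0) = c (r, 1)) {r₀ : ℝ} {s : unitInterval} {o : M} {γ : Path o o}
    (hγ : ∀ t, c (r₀, t) = (s, γ.extend t)) (hco : IsCoorientable g (F s) γ)
    {ν₀ : TangentBundle (𝓡 (n + 1)) N} (hν₀ : IsUnitNormalAt g (F s) o ν₀) :
    ∃ G : ℝ × ℝ → TangentBundle (𝓡 (n + 1)) N, Continuous G ∧ G (r₀, 0) = ν₀ ∧
      (∀ x, IsUnitNormalAt g (F (c x).1) (c x).2 (G x)) ∧ ∀ r, G (r, 0) = G (r, 1) := by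
  obtain ⟨G, hG, hG0, hG'⟩ := hF.exists_lift hc (r₀, 0) (v := ν₀) (by simpa [hγ] using hν₀)
  refine ⟨G, hG, hG0, hG', ?_⟩
  have hf := hF.isAFront s s.2
  have hGr : IsUnitNormalAlong g (F s) γ 0 1 (fun t => G (r₀, t)) :=
    ⟨(hG.comp (by fun_prop : Continuous fun t : ℝ => (r₀, t))).continuousOn, fun t _ => by
      simpa only [hγ] using hG' (r₀, t)⟩
  obtain ⟨μ, hμ, hμ0, hμ01⟩ : ∃ μ, IsUnitNormalAlong g (F s) γ 0 1 μ ∧ μ 0 = ν₀ ∧ μ 0 = μ 1 := by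
    obtain ⟨μ, hμ, hμ01⟩ := hco
    have h1 : IsUnitNormalAt g (F s) o (μ 0) := by
      simpa using hμ.2 0 (left_mem_Icc.2 zero_le_one)
    rcases hf.eq_or_eq h1 hν₀ with h | h
    · exact ⟨μ, hμ, h.symm, hμ01⟩
    · exact ⟨_, hμ.oppositeVector, h.symm, congrArg oppositeVector hμ01⟩
  have h01 : G (r₀, 0) = G (r₀, 1) := by
    have h2 := hGr.eqOn hf hμ (left_mem_Icc.2 zero_le_one) (hG0.trans hμ0.symm)
    exact (h2 (left_mem_Icc.2 zero_le_one)).trans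
      (hμ01.trans (h2 (right_mem_Icc.2 zero_le_one)).symm)
  intro r
  exact eqOn_of_isUnitNormalAt (S := univ) isPreconnected_univ (f := fun r => F (c (r, 0)).1)
    (p := fun r => (c (r, 0)).2) (fun r _ => hF.isAFront _ (c (r, 0)).1.2)
    (a := fun r => G (r, 0)) (b := fun r => G (r, 1))
    (hG.comp (by fun_prop : Continuous fun r : ℝ => (r, (0 : ℝ)))).continuousOn
    (hG.comp (by fun_prop : Continuous fun r : ℝ => (r, (1 : ℝ)))).continuousOn
    (fun r _ => hG' (r, 0)) (fun r _ => by rw [hc01]; exact hG' (r, 1)) (mem_univ r₀) h01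
    (mem_univ r)

theorem isCoorientable_of_square (hG : Continuous G)
    (hG' : ∀ x, IsUnitNormalAt g (F (c x).1) (c x).2 (G x)) (hG01 : ∀ r, G (r, 0) = G (r, 1))
    {r : ℝ} {s : unitInterval} {o : M} {γ : Path o o} (hγ : ∀ t, c (r, t) = (s, γ.extend t)) :
    IsCoorientable g (F s) γ :=
  ⟨fun t => G (r, t), ⟨(hG.comp (by fun_prop : Continuous fun t : ℝ => (r, t))).continuousOn,
    fun t _ => by simpa only [hγ] using hG' (r, t)⟩, hG01 r⟩

variable [T2Space M] [SecondCountableTopology M] [IsManifold (𝓡 n) ∞ M]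

theorem IsInwardField.isSignedCount (hF : IsAFrontDeformation g F) (hv : IsInwardField g F v)
    {s : unitInterval} {o : M} {γ : Path o o} (ho : o ∉ singularSet n (F s))
    {μ : ℝ → TangentBundle (𝓡 (n + 1)) N} (hμc : Continuous μ)
    (hμ : ∀ t, IsUnitNormalAt g (F s) (γ.extend t) (μ t)) (hμ01 : μ 0 = μ 1) {H : ℝ → ℝ}
    (hH : CountsCrossings (γ.extend ⁻¹' singularSet n (F s))
      {t | μ t = familyLift F v (s, γ.extend t)} H) :
    IsSignedCount g (F s) (μ 0) γ (⌊H 1⌋ - ⌊H 0⌋) := by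
  obtain ⟨system⟩ := hv.nonempty_inwardSystem hF s
  have hf := hF.isAFront s s.2
  have hS := hF.isClosed_singularSet s
  exact ⟨nonempty_signedSubdivision hf hS ho system ⟨hμc.continuousOn, fun t _ => hμ t⟩ rfl
    hμ01.symm, fun D => D.minusCount_signs hf hS hμc hμ rfl hμ01.symm
      (w := fun q => familyLift F v (s, q)) (fun p hp => hv.eventually_eq_field D.system hp) hH⟩

/-- The signed count is the same for all loops of a square. -/
theorem IsAFrontDeformation.exists_isSignedCount (hF : IsAFrontDeformation g F) (hc : Continuous c)
    (hc01 : ∀ r, c (r, 0) = c (r, 1)) (hG : Continuous G)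
    (hG' : ∀ x, IsUnitNormalAt g (F (c x).1) (c x).2 (G x)) (hG01 : ∀ r, G (r, 0) = G (r, 1)) :
    ∃ d : ℤ, ∀ (r : ℝ) (s : unitInterval) (o : M) (γ : Path o o),
      (∀ t, c (r, t) = (s, γ.extend t)) → o ∉ singularSet n (F s) →
        IsSignedCount g (F s) (G (r, 0)) γ d ∧
        IsSignedCount g (F s) (oppositeVector (G (r, 0))) γ (-d) := by
  obtain ⟨v, hv⟩ := hF.exists_isInwardField
  have hP := fun x hx => hv.eventually_eq_iff hF hc hG hG' (x := x) hx
  -- A single counting function on the plane restricts to one for each loop `r` and to one for each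
  -- edge. The edges may pass through singular points.
  obtain ⟨H, hH⟩ := exists_countsCrossings (hF.isClosed_singularFamily.preimage hc)
    (P := {x | G x = familyLift F v (c x)})
    (fun x hx => (hP x hx).mono fun y hy hys => (hy hys).2)
  have hr : ∀ t : ℝ, Continuous (fun r : ℝ => (r, t)) := fun t => by fun_prop
  have ht : ∀ r : ℝ, Continuous (fun t : ℝ => (r, t)) := fun r => by fun_prop
  have h0 := hH.comp (hr 0)
  have h1 := hH.comp (hr 1)
  have e1 : (fun r : ℝ => (r, (0 : ℝ))) ⁻¹' (c ⁻¹' singularFamily n F) =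
      (fun r : ℝ => (r, (1 : ℝ))) ⁻¹' (c ⁻¹' singularFamily n F) := by
    ext r; simp only [mem_preimage, hc01]
  have e2 : (fun r : ℝ => (r, (0 : ℝ))) ⁻¹' {x | G x = familyLift F v (c x)} =
      (fun r : ℝ => (r, (1 : ℝ))) ⁻¹' {x | G x = familyLift F v (c x)} := by
    ext r; simp only [mem_preimage, mem_ofPred_eq, hc01, hG01]
  rw [e1, e2] at h0
  refine ⟨⌊H (0, 1)⌋ - ⌊H (0, 0)⌋, fun r s o γ hγ ho => ?_⟩
  have hd : ⌊H (0, 1)⌋ - ⌊H (0, 0)⌋ = ⌊H (r, 1)⌋ - ⌊H (r, 0)⌋ := h1.floor_sub_floor h0 0 r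
  rw [hd]
  have hμ : ∀ t, IsUnitNormalAt g (F s) (γ.extend t) (G (r, t)) := fun t => by
    simpa only [hγ] using hG' (r, t)
  have hHr := hH.comp (ht r)
  have e3 : (fun t : ℝ => (r, t)) ⁻¹' (c ⁻¹' singularFamily n F) =
      γ.extend ⁻¹' singularSet n (F s) := by
    ext t; simp only [mem_preimage, hγ]; rfl
  have e4 : (fun t : ℝ => (r, t)) ⁻¹' {x | G x = familyLift F v (c x)} =
      {t | G (r, t) = familyLift F v (s, γ.extend t)} := by
    ext t; simp only [mem_preimage, mem_ofPred_eq, hγ]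
  rw [e3, e4] at hHr
  refine ⟨hv.isSignedCount hF ho (hG.comp (ht r)) hμ (hG01 r) hHr, ?_⟩
  -- For the opposite normal field the sides are exchanged near the singular set, and `-H` counts.
  -- Its integral part is `-⌊H⌋ - 1` at regular points, so the difference over the loop changes
  -- sign.
  have hneg : CountsCrossings (γ.extend ⁻¹' singularSet n (F s))
      {t | oppositeVector (G (r, t)) = familyLift F v (s, γ.extend t)}
      (-(H ∘ fun t => (r, t))) := by
    refine hHr.neg.congr fun t hts => ?_
    have hts' : c (r, t) ∈ singularFamily n F := by rw [hγ]; exact hts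
    filter_upwards [(ht r).continuousAt.eventually (hP (r, t) hts')] with t' h2 h3
    have h4 := (h2 (by rw [hγ]; exact h3)).1
    rw [hγ] at h4
    have h5 := hμ t'
    simp only [mem_compl_iff, mem_ofPred_eq]
    rcases (hF.isAFront s s.2).eq_or_eq h5 h4 with h6 | h6
    · rw [h6]
      exact iff_of_false (not_not.2 rfl) h5.ne_oppositeVector
    · rw [h6]
      exact iff_of_true h5.ne_oppositeVector.symm rfl
  have hcount := hv.isSignedCount hF ho (μ := fun t => oppositeVector (G (r, t)))
    (continuous_iff_continuousAt.2 fun t => ContinuousAt.comp (f := fun t => G (r, t))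
      (continuousAt_oppositeVector _) (hG.comp (ht r)).continuousAt)
    (fun t => (hμ t).oppositeVector) (congrArg oppositeVector (hG01 r)) hneg
  have hmem : ∀ t, γ.extend t = o → t ∉ γ.extend ⁻¹' singularSet n (F s) := fun t h => by
    rwa [mem_preimage, h]
  rw [hHr.floor_neg (hmem 0 (by simp)), hHr.floor_neg (hmem 1 (by simp))] at hcount
  convert hcount using 1
  simp only [Function.comp_apply]
  ring

end Squares

end

/-! ### The theorem -/

theorem mainTheorem11 {n : ℕ} [NeZero n]
    {M : Type*} [TopologicalSpace M] [T2Space M] [SecondCountableTopology M]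
    [ChartedSpace (EuclideanSpace ℝ (Fin n)) M] [IsManifold (𝓡 n) ∞ M]
    {N : Type*} [TopologicalSpace N] [T2Space N] [SecondCountableTopology N]
    [ChartedSpace (EuclideanSpace ℝ (Fin (n + 1))) N] [IsManifold (𝓡 (n + 1)) ∞ N]
    (g : SmoothMetric n N) :
    -- the zig-zag number of a loop on a fixed A-front
    (∀ f : M → N, IsAFront g f → ∀ o ∉ singularSet n f,
      ∀ ν₀ : TangentBundle (𝓡 (n + 1)) N, IsUnitNormalAt g f o ν₀ →
      ∀ γ : Path o o, IsCoorientable g f γ →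
        -- it is well defined
        Nonempty (SignedSubdivision g f ν₀ γ) ∧
        (∀ D : SignedSubdivision g f ν₀ γ, minusCount D.signs = zigzagNumber g f ν₀ γ) ∧
        ((∃ D : SignedSubdivision g f ν₀ γ, D.ε (D.m + 1) = 1) →
          zigzagNumber g f (oppositeVector ν₀) γ = zigzagNumber g f ν₀ γ) ∧
        -- it depends only on the homotopy class
        ∀ γ' : Path o o, γ.Homotopic γ' →
          IsCoorientable g f γ' ∧ zigzagNumber g f ν₀ γ' = zigzagNumber g f ν₀ γ) ∧
    -- stability under deformations
    (∀ F : ℝ → M → N, IsAFrontDeformation g F →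
      ∀ (o : M) (ν : ℝ → TangentBundle (𝓡 (n + 1)) N), ContinuousOn ν (Icc 0 1) →
      (∀ s ∈ Icc (0 : ℝ) 1, IsUnitNormalAt g (F s) o (ν s)) →
      ∀ γ : Path o o, ∀ s ∈ Icc (0 : ℝ) 1, ∀ s' ∈ Icc (0 : ℝ) 1,
        IsCoorientable g (F s) γ →
          IsCoorientable g (F s') γ ∧
          (o ∉ singularSet n (F s) → o ∉ singularSet n (F s') →
            ((∀ r ∈ Icc (0 : ℝ) 1, o ∉ singularSet n (F r)) ∨
              ∃ D : SignedSubdivision g (F s) (ν s) γ, D.ε (D.m + 1) = 1) →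
            zigzagNumber g (F s') (ν s') γ = zigzagNumber g (F s) (ν s) γ)) := by

  refine ⟨fun f hf o ho ν₀ hν₀ γ hγ => ?_, fun F hF o ν hν hν' γ s hs s' hs' hγ => ?_⟩
  · have hF := hf.isAFrontDeformation
    have key : ∀ γ' : Path o o, γ.Homotopic γ' → IsCoorientable g f γ' ∧ ∃ d : ℤ,
        IsSignedCount g f ν₀ γ d ∧ IsSignedCount g f (oppositeVector ν₀) γ (-d) ∧
          IsSignedCount g f ν₀ γ' d := by
      rintro γ' ⟨K⟩
      -- The homotopy is extended to the whole plane by clamping both coordinates; the parameter of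
      -- the constant family stays at `0`.
      let c : ℝ × ℝ → unitInterval × M := fun x =>
        (0, K (projIcc 0 1 zero_le_one x.1, projIcc 0 1 zero_le_one x.2))
      have hc : Continuous c := by fun_prop
      have hcr : ∀ r, c (r, 0) = (0, o) ∧ c (r, 1) = (0, o) := fun r => by simp [c]
      have hc0 : ∀ t, c (0, t) = (0, γ.extend t) := fun t => by
        simp [c, Path.extend, IccExtend]
      have hc1 : ∀ t, c (1, t) = (0, γ'.extend t) := fun t => by
        simp [c, Path.extend, IccExtend]
      obtain ⟨G, hG, hG0, hG', hG01⟩ := hF.exists_square_lift hc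
        (fun r => (hcr r).1.trans (hcr r).2.symm) hc0 hγ hν₀
      obtain ⟨d, hd⟩ := hF.exists_isSignedCount hc
        (fun r => (hcr r).1.trans (hcr r).2.symm) hG hG' hG01
      -- The base point does not move during the homotopy, so the lifted normal there stays equal to
      -- `ν₀`.
      have hGr : ∀ r, G (r, 0) = ν₀ := fun r =>
        eqOn_of_isUnitNormalAt (S := univ) isPreconnected_univ (f := fun _ => f)
          (p := fun _ : ℝ => o) (a := fun r => G (r, 0)) (b := fun _ => ν₀) (fun _ _ => hf)
          (hG.comp (by fun_prop : Continuous fun r : ℝ => (r, (0 : ℝ)))).continuousOn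
          continuousOn_const (fun r _ => by simpa only [hcr] using hG' (r, 0))
          (fun _ _ => hν₀) (mem_univ (0 : ℝ)) hG0 (mem_univ r)
      have h0 := hd 0 0 o γ hc0 ho
      have h1 := hd 1 0 o γ' hc1 ho
      rw [hGr] at h0 h1
      exact ⟨isCoorientable_of_square (F := fun _ => f) hG hG' hG01 hc1, d, h0.1, h0.2, h1.1⟩
    obtain ⟨-, d, hd, hd', -⟩ := key γ (Path.Homotopic.refl γ)
    refine ⟨hd.1, fun D => ?_, ?_, fun γ' h => ?_⟩
    · exact_mod_cast (hd.2 D).1.trans hd.zigzagNumber_eq.symm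
    · rintro ⟨D, hD⟩
      obtain ⟨e, rfl⟩ := (hd.2 D).2.1 hD
      have h1 := hd.zigzagNumber_eq
      have h2 := hd'.zigzagNumber_eq
      -- Here evenness matters: for odd `d`, division rounding down does not commute with the change
      -- of sign.
      rw [show -(e + e) / 2 = -((e + e) / 2) by omega, abs_neg, ← h1] at h2
      exact_mod_cast h2
    · obtain ⟨hco, d, hd, -, hd'⟩ := key γ' h
      exact ⟨hco, by exact_mod_cast hd'.zigzagNumber_eq.trans hd.zigzagNumber_eq.symm⟩
  -- Now the loop is fixed and the front varies with the first coordinate. The edge curves are the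
  -- fixed base point seen on the varying fronts.
  · let c : ℝ × ℝ → unitInterval × M := fun x => (projIcc 0 1 zero_le_one x.1, γ.extend x.2)
    have hc : Continuous c := by
      have := γ.continuous_extend
      fun_prop
    have hcr : ∀ r, ∀ hr : r ∈ Icc (0 : ℝ) 1, ∀ t, c (r, t) = (⟨r, hr⟩, γ.extend t) :=
      fun r hr t => by simp [c, projIcc_of_mem, hr]
    have hc01 : ∀ r, c (r, 0) = c (r, 1) := fun r => by simp [c]
    obtain ⟨G, hG, hG0, hG', hG01⟩ := hF.exists_square_lift hc hc01 (hcr s hs) hγ (hν' s hs)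
    -- The lift along the base point and the given family `ν` agree at `s`, hence on all of `[0,
    -- 1]`.
    have hGr : EqOn (fun r => G (r, 0)) ν (Icc 0 1) :=
      eqOn_of_isUnitNormalAt isPreconnected_Icc (f := F) (p := fun _ : ℝ => o) hF.isAFront
        (hG.comp (by fun_prop : Continuous fun r : ℝ => (r, (0 : ℝ)))).continuousOn hν
        (fun r hr => by simpa [hcr r hr] using hG' (r, 0)) hν' hs hG0
    refine ⟨isCoorientable_of_square hG hG' hG01 (hcr s' hs'), fun ho ho' _ => ?_⟩
    obtain ⟨d, hd⟩ := hF.exists_isSignedCount hc hc01 hG hG' hG01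
    have h1 := (hd s ⟨s, hs⟩ o γ (hcr s hs) ho).1
    have h2 := (hd s' ⟨s', hs'⟩ o γ (hcr s' hs') ho').1
    rw [show G (s, 0) = ν s from hGr hs] at h1
    rw [show G (s', 0) = ν s' from hGr hs'] at h2
    exact_mod_cast h2.zigzagNumber_eq.trans h1.zigzagNumber_eq.symm
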